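/- All graphs are simple. An infinite graph $G$ is *2-connected* if $G-v$ is connected for every vertex $v$; subdividing an edge means replacing it by a finite path. A *ray* is a one-way infinite path, and an edge between two vertices is regarded as a path. **Theorem.** Every infinite 2-connected graph $G$, of any cardinality, contains as an induced subgraph at least one of the following (countably infinite) graphs. 1. $K_\infty$, the complete graph on countably infinitely many vertices. 2. An *infinite clean ladder*: a locally finite graph $L$ with two disjoint rays $W$, $X$ that are induced in $L$, lie in the same end of $L$ (that is, $L$ has infinitely many pairwise disjoint paths joining them), and together contain all vertices of $L$, such that the initial vertices of $W$ and $X$ are adjacent and all crosses are degenerate. Here a *cross* is a pair of edges $(e_We_X,\ f_Wf_X)$ of $L$ with $e_W,f_W\in W$ and $e_X,f_X\in X$, where $e_W$ precedes $f_W$ on $W$ and $f_X$ precedes $e_X$ on $X$; it is *degenerate* if $e_W,f_W$ are consecutive on $W$ and $f_X,e_X$ are consecutive on $X$. 3. A member of $\Theta_\infty$: the union of countably infinitely many distinct paths between two distinct vertices, any two of which have only these two ends in common. 4. A member of $\mathscr F_\infty$: a graph obtained from a vertex (the apex) and a ray by joining the apex to every vertex of the ray and then subdividing each edge finitely many (possibly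 zero) times. 5. A member of $\mathscr F^{\Delta}_\infty$: a graph obtained from a vertex $v$, vertices $v_1,v_2,\dots$ and a ray $p_1p_2\cdots$, all distinct, by adding the edges $vv_i$, $v_ip_{2i-1}$, $v_ip_{2i}$ for all $i\ge 1$, and then subdividing each of the edges $vv_i$ and $p_{2i}p_{2i+1}$ ($i\ge1$) finitely many (possibly zero) times. 6. A member of $\mathscr L_\infty$, $\mathscr L^{\Delta}_\infty$ or $\mathscr L^{\nabla\Delta}_\infty$, as follows. For two disjoint induced rays $P$, $Q$ of a graph $L$, a *tie* is a component of $L\setminus E(P\cup Q)$ that meets both $P$ and $Q$; its vertices on $P$ and $Q$ are its *attachments*. Two ties *cross* if all attachments of the first precede all those of the second on one of the rays, and the reverse holds on the other ray. A tie is - of *type $I$* if it has exactly one attachment on each ray and is a path joining them; - of *type $Y$* if its attachments are two consecutive vertices $p,p'$ of $P$ and one vertex $q$ of $Q$, and it consists of a path from a vertex $u\notin P\cup Q$ to $q$ together with the edges $up$ and $up'$; - of *type $\lambda$* if it is as in type $Y$ with the roles of $P$ and $Q$ interchanged; - of *type $Y$-$\lambda$* if its attachments are two consecutive vertices $p,p'$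 of $P$ and two consecutive vertices $q,q'$ of $Q$, and it consists of a path from a vertex $u\notin P\cup Q$ to a vertex $w\notin P\cup Q$ (possibly $u=w$) together with the edges $up,up',wq,wq'$. The graph $L$ belongs to $\mathscr L_\infty$ if it has disjoint induced rays $P$, $Q$ such that every component of $L\setminus E(P\cup Q)$ is a single vertex of $P\cup Q$ or a tie of type $I$, there are infinitely many ties, no two ties cross, and some tie contains the initial vertices of both rays. The families $\mathscr L^{\Delta}_\infty$ and $\mathscr L^{\nabla\Delta}_\infty$ are defined in the same way, with "of type $I$" replaced, respectively, by "of type $Y$" for all ties or "of type $\lambda$" for all ties, and by "of type $Y$-$\lambda$". -/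

import Mathlib

namespace InfTwoConnected

universe u v

/-! ### Connectivity -/

/-- A graph is `2`-connected if deleting any one vertex leaves a connected graph. -/
def TwoConnected {V : Type u} (G : SimpleGraph V) : Prop :=
  ∀ x : V, (G.induce {y | y ≠ x}).Connected

/-! ### The infinite complete graph and the infinite theta graphs -/

/-- `H` is (a copy of) the countably infinite complete graph. -/
def IsKInf {W : Type u} (H : SimpleGraph W) : Prop :=
  Nonempty (H ≃g (⊤ : SimpleGraph ℕ))

/-- `H` consists of two distinct vertices `x`, `y` and countably infinitely many distinct
`x`-`y` paths, any two of which share only `x` and `y`. One of the paths may be the edge `xy`. -/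
def IsTheta {W : Type u} (H : SimpleGraph W) : Prop :=
  ∃ (x y : W) (p : ℕ → H.Walk x y),
    x ≠ y ∧
    Function.Injective p ∧
    (∀ n, (p n).IsPath) ∧
    (∀ m n, m ≠ n → ∀ w, w ∈ (p m).support → w ∈ (p n).support → w = x ∨ w = y) ∧
    (∀ w, ∃ n, w ∈ (p n).support) ∧
    (∀ w w', H.Adj w w' → ∃ n, s(w, w') ∈ (p n).edges)

/-! ### Subdivisions -/

/-- `H` is obtained from `F` by replacing edges of `F` with pairwise independent finite paths
between the same ends; only the edges in `E` may be replaced by a path of length more than one.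
The map `branch` sends the vertices of `F` to the branch vertices of `H`, and `path a b h` is the
path of `H` that replaces the edge `ab`. -/
structure Subdivision {A : Type u} {W : Type v} (F : SimpleGraph A) (E : Set (Sym2 A))
    (H : SimpleGraph W) where
  branch : A ↪ W
  path : ∀ a b : A, F.Adj a b → H.Walk (branch a) (branch b)
  path_symm : ∀ (a b : A) (h : F.Adj a b), path b a h.symm = (path a b h).reverse
  isPath : ∀ (a b : A) (h : F.Adj a b), (path a b h).IsPath
  length_eq_one : ∀ (a b : A) (h : F.Adj a b), s(a, b) ∉ E → (path a b h).length = 1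
  branch_mem : ∀ (a b : A) (h : F.Adj a b) (c : A),
    branch c ∈ (path a b h).support → c = a ∨ c = b
  independent : ∀ (a b : A) (h : F.Adj a b) (c d : A) (h' : F.Adj c d), s(a, b) ≠ s(c, d) →
    ∀ w, w ∈ (path a b h).support → w ∈ (path c d h').support → ∃ x, w = branch x
  vertex_mem : ∀ w : W, (∃ c, w = branch c) ∨
    ∃ (a b : A) (h : F.Adj a b), w ∈ (path a b h).support
  edge_mem : ∀ w w' : W, H.Adj w w' →
    ∃ (a b : A) (h : F.Adj a b), s(w, w') ∈ (path a b h).edges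

/-! ### Infinite fans and infinite `Δ`-fans -/

/-- The infinite fan: the apex `none` is joined to every vertex of the ray
`some 0, some 1, some 2, …` (the rim). -/
def infFan : SimpleGraph (Option ℕ) :=
  SimpleGraph.fromRel fun x y =>
    (x = none ∧ ∃ i, y = some i) ∨ (∃ i, x = some i ∧ y = some (i + 1))

/-- `H` is obtained from the infinite fan by subdividing edges. -/
def IsFan {W : Type u} (H : SimpleGraph W) : Prop :=
  Nonempty (Subdivision infFan Set.univ H)

/-- The vertices of the infinite `Δ`-fan. -/
inductive DeltaFanVertex : Type
  | apex : DeltaFanVertex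
  | mid : ℕ → DeltaFanVertex
  | rim : ℕ → DeltaFanVertex

/-- The infinite `Δ`-fan: the apex is joined to `mid 0, mid 1, …`; the vertices
`rim 0, rim 1, …` form a ray; and `mid i` is joined to `rim (2 * i)` and `rim (2 * i + 1)`. -/
def infDeltaFan : SimpleGraph DeltaFanVertex :=
  SimpleGraph.fromRel fun x y =>
    (x = .apex ∧ ∃ i, y = .mid i) ∨
    (∃ i, x = .mid i ∧ (y = .rim (2 * i) ∨ y = .rim (2 * i + 1))) ∨
    (∃ k, x = .rim k ∧ y = .rim (k + 1))

/-- The edges of the infinite `Δ`-fan that do not lie on one of its triangles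
`mid i, rim (2 * i), rim (2 * i + 1)`. -/
def deltaFanFreeEdges : Set (Sym2 DeltaFanVertex) :=
  {e | (∃ i, e = s(.apex, .mid i)) ∨ (∃ j, e = s(.rim (2 * j + 1), .rim (2 * j + 2)))}

/-- `H` is obtained from the infinite `Δ`-fan by subdividing edges that lie on no triangle. -/
def IsDeltaFan {W : Type u} (H : SimpleGraph W) : Prop :=
  Nonempty (Subdivision infDeltaFan deltaFanFreeEdges H)

/-! ### Rays -/

/-- The ray `0, 1, 2, …`. -/
def rayGraph : SimpleGraph ℕ where
  Adj i j := j = i + 1 ∨ i = j + 1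
  symm := ⟨fun _ _ h => h.symm⟩
  loopless := ⟨fun i h => by omega⟩

/-- A ray that is an induced subgraph of `H`, with its vertices listed from the initial one. -/
abbrev InducedRay {W : Type u} (H : SimpleGraph W) := rayGraph ↪g H

/-- Two rays have no common vertex. -/
def DisjointRays {W : Type u} {H : SimpleGraph W} (P Q : InducedRay H) : Prop :=
  ∀ i j, P i ≠ Q j

/-- Two rays belong to the same end: infinitely many pairwise disjoint paths join them. -/
def SameEnd {W : Type u} {H : SimpleGraph W} (P Q : InducedRay H) : Prop :=
  ∃ (a b : ℕ → ℕ) (p : ∀ n, H.Walk (P (a n)) (Q (b n))),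
    (∀ n, (p n).IsPath) ∧
    ∀ m n, m ≠ n → ∀ w, w ∈ (p m).support → w ∉ (p n).support

/-! ### Infinite clean ladders -/

/-- `H` is an infinite messy ladder with rails `R` and `X`. Its rungs are the edges that are
on neither rail; as the rails are induced and contain all the vertices, these are the edges
between a vertex `R i` and a vertex `X j`. -/
structure IsMessyLadder {W : Type u} (H : SimpleGraph W) (R X : InducedRay H) : Prop where
  locallyFinite : ∀ w, (H.neighborSet w).Finite
  disjoint : DisjointRays R X
  cover : ∀ w, (∃ i, w = R i) ∨ (∃ j, w = X j)
  sameEnd : SameEnd R X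
  initial : H.Adj (R 0) (X 0)

/-- The rungs `R i, X j` and `R i', X j'` cross, in this order. -/
def IsCross {W : Type u} {H : SimpleGraph W} (R X : InducedRay H) (i j i' j' : ℕ) : Prop :=
  H.Adj (R i) (X j) ∧ H.Adj (R i') (X j') ∧ i < i' ∧ j' < j

/-- `H` is an infinite clean ladder: a messy ladder in which each cross is degenerate, that is,
each of its two spans is a single edge. -/
def IsCleanLadder {W : Type u} (H : SimpleGraph W) : Prop :=
  ∃ R X : InducedRay H, IsMessyLadder H R X ∧
    ∀ i j i' j', IsCross R X i j i' j' → i' = i + 1 ∧ j = j' + 1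

/-! ### Ladders built from two rays and ties -/

section Ties

variable {W : Type u} {H : SimpleGraph W}

/-- The graph `H` without the edges of the rays `P` and `Q`. -/
def offRays (P Q : InducedRay H) : SimpleGraph W :=
  H.deleteEdges ({e | ∃ i, e = s(P i, P (i + 1))} ∪ {e | ∃ j, e = s(Q j, Q (j + 1))})

/-- The positions on `P` of the vertices of attachment on `P` of a component. -/
def attachP (P Q : InducedRay H) (J : (offRays P Q).ConnectedComponent) : Set ℕ :=
  {i | P i ∈ J.supp}

/-- The positions on `Q` of the vertices of attachment on `Q` of a component. -/
def attachQ (P Q : InducedRay H) (J : (offRays P Q).ConnectedComponent) : Set ℕ :=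
  {j | Q j ∈ J.supp}

/-- A tie of `P ∪ Q`: a component of `H` without the edges of `P` and `Q` that has a vertex of
attachment on each of the rays. -/
def IsTie (P Q : InducedRay H) (J : (offRays P Q).ConnectedComponent) : Prop :=
  (attachP P Q J).Nonempty ∧ (attachQ P Q J).Nonempty

/-- A tie of type `I` is a path that joins its only vertex of attachment on `P` to its only
vertex of attachment on `Q`. -/
def IsTypeI (P Q : InducedRay H) (J : (offRays P Q).ConnectedComponent) : Prop :=
  ∃ (i j : ℕ) (r : (offRays P Q).Walk (P i) (Q j)),
    attachP P Q J = {i} ∧ attachQ P Q J = {j} ∧ r.IsPath ∧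
    (∀ w, w ∈ J.supp ↔ w ∈ r.support) ∧
    (∀ w w', w ∈ J.supp → (offRays P Q).Adj w w' → s(w, w') ∈ r.edges)

/-- A tie of type `Y` has two consecutive vertices of attachment `P i`, `P (i + 1)` on `P` and
one vertex of attachment `Q j` on `Q`; it consists of a path from a vertex `x` not on the rays
to `Q j` and of the two edges that join `x` to `P i` and `P (i + 1)`. -/
def IsTypeY (P Q : InducedRay H) (J : (offRays P Q).ConnectedComponent) : Prop :=
  ∃ (i j : ℕ) (x : W) (r : (offRays P Q).Walk x (Q j)),
    attachP P Q J = {i, i + 1} ∧ attachQ P Q J = {j} ∧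
    (∀ k, x ≠ P k) ∧ (∀ k, x ≠ Q k) ∧
    (offRays P Q).Adj x (P i) ∧ (offRays P Q).Adj x (P (i + 1)) ∧ r.IsPath ∧
    (∀ w, w ∈ J.supp ↔ w = P i ∨ w = P (i + 1) ∨ w ∈ r.support) ∧
    (∀ w w', w ∈ J.supp → (offRays P Q).Adj w w' →
      s(w, w') = s(x, P i) ∨ s(w, w') = s(x, P (i + 1)) ∨ s(w, w') ∈ r.edges)

/-- A tie of type `λ`: the same as type `Y`, with the roles of the two rays interchanged. -/
def IsTypeLambda (P Q : InducedRay H) (J : (offRays P Q).ConnectedComponent) : Prop :=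
  ∃ (i j : ℕ) (y : W) (r : (offRays P Q).Walk y (P i)),
    attachP P Q J = {i} ∧ attachQ P Q J = {j, j + 1} ∧
    (∀ k, y ≠ P k) ∧ (∀ k, y ≠ Q k) ∧
    (offRays P Q).Adj y (Q j) ∧ (offRays P Q).Adj y (Q (j + 1)) ∧ r.IsPath ∧
    (∀ w, w ∈ J.supp ↔ w = Q j ∨ w = Q (j + 1) ∨ w ∈ r.support) ∧
    (∀ w w', w ∈ J.supp → (offRays P Q).Adj w w' →
      s(w, w') = s(y, Q j) ∨ s(w, w') = s(y, Q (j + 1)) ∨ s(w, w') ∈ r.edges)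

/-- A tie of type `Y`-`λ` has two consecutive vertices of attachment on each ray; it consists of
a path from `x` to `y`, where `x` and `y` are not on the rays and may be equal, of the two edges
that join `x` to `P i` and `P (i + 1)`, and of the two edges that join `y` to `Q j` and
`Q (j + 1)`. -/
def IsTypeYLambda (P Q : InducedRay H) (J : (offRays P Q).ConnectedComponent) : Prop :=
  ∃ (i j : ℕ) (x y : W) (r : (offRays P Q).Walk x y),
    attachP P Q J = {i, i + 1} ∧ attachQ P Q J = {j, j + 1} ∧
    (∀ k, x ≠ P k) ∧ (∀ k, x ≠ Q k) ∧ (∀ k, y ≠ P k) ∧ (∀ k, y ≠ Q k) ∧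
    (offRays P Q).Adj x (P i) ∧ (offRays P Q).Adj x (P (i + 1)) ∧
    (offRays P Q).Adj y (Q j) ∧ (offRays P Q).Adj y (Q (j + 1)) ∧ r.IsPath ∧
    (∀ w, w ∈ J.supp ↔
      w = P i ∨ w = P (i + 1) ∨ w = Q j ∨ w = Q (j + 1) ∨ w ∈ r.support) ∧
    (∀ w w', w ∈ J.supp → (offRays P Q).Adj w w' →
      s(w, w') = s(x, P i) ∨ s(w, w') = s(x, P (i + 1)) ∨
      s(w, w') = s(y, Q j) ∨ s(w, w') = s(y, Q (j + 1)) ∨ s(w, w') ∈ r.edges)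

/-- The ties `J` and `J'` cross: `J` is before `J'` on `P` and after `J'` on `Q`, or the other
way round. -/
def TiesCross (P Q : InducedRay H) (J J' : (offRays P Q).ConnectedComponent) : Prop :=
  ((∀ i ∈ attachP P Q J, ∀ i' ∈ attachP P Q J', i < i') ∧
    (∀ j ∈ attachQ P Q J, ∀ j' ∈ attachQ P Q J', j' < j)) ∨
  ((∀ i ∈ attachP P Q J, ∀ i' ∈ attachP P Q J', i' < i) ∧
    (∀ j ∈ attachQ P Q J, ∀ j' ∈ attachQ P Q J', j < j'))

/-- `H` consists of two disjoint induced rays `P`, `Q` and of infinitely many pairwise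
non-crossing ties of `P ∪ Q`, all of type `T`, one of which joins the initial vertices of `P`
and `Q`. -/
structure IsTieLadder (P Q : InducedRay H)
    (T : (offRays P Q).ConnectedComponent → Prop) : Prop where
  disjoint : DisjointRays P Q
  components : ∀ J : (offRays P Q).ConnectedComponent,
    (∃ i, J.supp = {P i}) ∨ (∃ j, J.supp = {Q j}) ∨ (IsTie P Q J ∧ T J)
  initial : ∃ J, IsTie P Q J ∧ T J ∧ P 0 ∈ J.supp ∧ Q 0 ∈ J.supp
  infinite : {J | IsTie P Q J ∧ T J}.Infinite
  nonCrossing : ∀ J J', IsTie P Q J → IsTie P Q J' → J ≠ J' → ¬ TiesCross P Q J J'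

end Ties

/-- The family of ladders with subdivided rungs and rails: all ties are of type `I`. -/
def IsLadder {W : Type u} (H : SimpleGraph W) : Prop :=
  ∃ P Q : InducedRay H, IsTieLadder P Q (IsTypeI P Q)

/-- All ties are of type `Y`, or all ties are of type `λ`. -/
def IsDeltaLadder {W : Type u} (H : SimpleGraph W) : Prop :=
  ∃ P Q : InducedRay H, IsTieLadder P Q (IsTypeY P Q) ∨ IsTieLadder P Q (IsTypeLambda P Q)

/-- All ties are of type `Y`-`λ`. -/
def IsNablaDeltaLadder {W : Type u} (H : SimpleGraph W) : Prop :=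
  ∃ P Q : InducedRay H, IsTieLadder P Q (IsTypeYLambda P Q)

end InfTwoConnected

/-! The proof splits according to whether some vertex has infinite degree.

Suppose that `v` has infinitely many neighbours. The graph `G - v` is connected, so a geodesic form
of the star–comb lemma (`exists_star_or_comb`) applies in it to the neighbours of `v`. A star with
centre `x` yields infinitely many paths from `x` to `v` that share only their ends. They can be
thinned out to an induced theta graph, unless some vertex `z` of one path has neighbours on
infinitely many others. As the paths are geodesics, these neighbours lie at bounded distance from
`x`, so `x` and `z` are joined by infinitely many disjoint short connections. Repeated halving of
the bound on their length (`exists_kInf_or_theta_of_bundle`) leads to a theta graph or to two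
vertices with infinitely many common neighbours, where Ramsey's theorem gives `K_∞` or a theta
graph. A comb yields a geodesic ray with legs to neighbours of `v`; legs at very different distances
from the root do not interact, and one obtains a fan or a `Δ`-fan (`exists_of_comb`).

Suppose now that `G` is locally finite, and take a geodesic ray `R`. Either some component of `G -
R` attaches to `R` infinitely often, and a second ray is found inside it (`hasLadder_of_component`);
or every component attaches finitely often, and 2-connectedness gives a chain of overlapping ears of
`R`, which contains two disjoint rays (`hasLadder_of_ears`). In both cases the two rays lie in a set
that induces a one-ended subgraph. Among all pairs of disjoint rays in this set with the same
initial vertices, a limit of pairs that minimize the number of vertices in larger and larger finite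
sets has induced rays and only degenerate crosses (`IsRayPair.exists_tight`). If infinitely many
vertices of the first ray have neighbours on the second, tails of the rays induce a clean ladder.
Otherwise, beyond some point there are no edges between the rays, and one-endedness provides
infinitely many induced legs between them, pairwise far apart (`hasLadder_of_rays`).

The ends of legs at a ray are cleaned up in the same way throughout (`Raw.normalize`). A leg that
sees one vertex of the ray is extended to it; two consecutive vertices form a triangle with the end
of the leg; and if the visible vertices span more than one edge, the ray is rerouted through the end
of the leg. The first and third outcome give a leg that starts on the ray, the second gives the
triangles of `Δ`-fans and of the ties of types `Y`, `λ` and `Y`-`λ`. -/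

namespace InfTwoConnected

open SimpleGraph Set Filter

universe u v

variable {V : Type u} {G : SimpleGraph V}

/-! ### Walks given by functions -/

/-- `f 0, …, f s` is a walk of `G` with all vertices in `I`. -/
def IsLink (G : SimpleGraph V) (I : Set V) (s : ℕ) (f : ℕ → V) : Prop :=
  (∀ i ≤ s, f i ∈ I) ∧ ∀ i < s, G.Adj (f i) (f (i + 1))

/-- `f 0, …, f s` is an induced path of `G`. -/
def IsInducedPath (G : SimpleGraph V) (s : ℕ) (f : ℕ → V) : Prop :=
  (∀ i ≤ s, ∀ j ≤ s, f i = f j → i = j) ∧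
    ∀ i ≤ s, ∀ j ≤ s, G.Adj (f i) (f j) ↔ (j = i + 1 ∨ i = j + 1)

/-- `a` and `b` are joined by a walk with all vertices in `I`. -/
def Joined (G : SimpleGraph V) (I : Set V) (a b : V) : Prop :=
  ∃ p : G.Walk a b, ∀ x ∈ p.support, x ∈ I

lemma Joined.refl {I : Set V} {a : V} (h : a ∈ I) : Joined G I a a :=
  ⟨.nil, by simpa using h⟩

lemma Joined.symm {I : Set V} {a b : V} (h : Joined G I a b) : Joined G I b a := by
  obtain ⟨p, hp⟩ := h
  exact ⟨p.reverse, by simpa using hp⟩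

lemma Joined.trans {I : Set V} {a b c : V} (h : Joined G I a b) (h' : Joined G I b c) :
    Joined G I a c := by
  obtain ⟨p, hp⟩ := h
  obtain ⟨q, hq⟩ := h'
  refine ⟨p.append q, fun x hx => ?_⟩
  rcases (Walk.mem_support_append_iff _ _).1 hx with h | h
  exacts [hp _ h, hq _ h]

lemma Joined.of_adj {I : Set V} {a b : V} (h : G.Adj a b) (ha : a ∈ I) (hb : b ∈ I) :
    Joined G I a b :=
  ⟨.cons h .nil, by simp [ha, hb]⟩

lemma Joined.mono {I J : Set V} {a b : V} (h : Joined G I a b) (hIJ : I ⊆ J) :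
    Joined G J a b := by
  obtain ⟨p, hp⟩ := h
  exact ⟨p, fun x hx => hIJ (hp x hx)⟩

lemma Joined.right_mem {I : Set V} {a b : V} (h : Joined G I a b) : b ∈ I := by
  obtain ⟨p, hp⟩ := h
  exact hp _ (by simp)

lemma Joined.exists_link {I : Set V} {a b : V} (h : Joined G I a b) :
    ∃ s f, IsLink G I s f ∧ f 0 = a ∧ f s = b := by
  obtain ⟨p, hp⟩ := h
  exact ⟨p.length, p.getVert, ⟨fun i _ => hp _ (p.getVert_mem_support i),
    fun i hi => p.adj_getVert_succ hi⟩, p.getVert_zero, p.getVert_length⟩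

/-- A walk given by a function, as a walk. -/
lemma IsLink.exists_walk {I : Set V} {s : ℕ} {f : ℕ → V} (h : IsLink G I s f) :
    ∃ p : G.Walk (f 0) (f s), p.support = (List.range (s + 1)).map f ∧
      p.edges = (List.range s).map (fun i => s(f i, f (i + 1))) ∧ p.length = s := by
  induction s with
  | zero => exact ⟨.nil, by simp, by simp, rfl⟩
  | succ s ih =>
    obtain ⟨p, h1, h2, h3⟩ := ih ⟨fun i hi => h.1 i (by omega), fun i hi => h.2 i (by omega)⟩
    refine ⟨p.concat (h.2 s (by omega)), ?_, ?_, by simp [h3]⟩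
    · rw [Walk.support_concat, h1, List.range_succ (n := s + 1)]; simp
    · rw [Walk.edges_concat, h2, List.range_succ (n := s)]; simp

/-- A walk given by a function, as a walk between prescribed ends. -/
lemma IsLink.exists_walk' {I : Set V} {s : ℕ} {f : ℕ → V} {a b : V} (h : IsLink G I s f)
    (ha : f 0 = a) (hb : f s = b) :
    ∃ p : G.Walk a b, (∀ x, x ∈ p.support ↔ ∃ i ≤ s, f i = x) ∧
      (∀ e, e ∈ p.edges ↔ ∃ i < s, e = s(f i, f (i + 1))) ∧ p.length = s ∧
      ((∀ i ≤ s, ∀ j ≤ s, f i = f j → i = j) → p.IsPath) := by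
  subst ha hb
  obtain ⟨p, h1, h2, h3⟩ := h.exists_walk
  refine ⟨p, fun x => ?_, fun e => ?_, h3, fun hinj => ?_⟩
  · rw [h1]; simp
  · rw [h2]; simp [eq_comm]
  · rw [Walk.isPath_def, h1]
    refine List.Nodup.map_on ?_ List.nodup_range
    intro x hx y hy hxy
    simp only [List.mem_range] at hx hy
    exact hinj x (by omega) y (by omega) hxy

lemma IsLink.joined {I : Set V} {s : ℕ} {f : ℕ → V} (h : IsLink G I s f) {i j : ℕ}
    (hi : i ≤ s) (hj : j ≤ s) : Joined G I (f i) (f j) := by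
  have key : ∀ i ≤ s, Joined G I (f 0) (f i) := by
    intro i
    induction i with
    | zero => intro h0; exact .refl (h.1 0 h0)
    | succ i ih =>
      intro hi
      exact (ih (by omega)).trans (.of_adj (h.2 i (by omega)) (h.1 i (by omega)) (h.1 _ hi))
  exact (key i hi).symm.trans (key j hj)

/-- A shortest link between two sets is an induced path that meets the sets only in its ends. -/
lemma exists_shortest_link {I A B : Set V} {s : ℕ} {f : ℕ → V} (hf : IsLink G I s f)
    (ha : f 0 ∈ A) (hb : f s ∈ B) :
    ∃ s' f', IsLink G I s' f' ∧ IsInducedPath G s' f' ∧ f' 0 ∈ A ∧ f' s' ∈ B ∧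
      (∀ i ≤ s', f' i ∈ A → i = 0) ∧ (∀ i ≤ s', f' i ∈ B → i = s') ∧ s' ≤ s := by
  classical
  have hex : ∃ s f, IsLink G I s f ∧ f 0 ∈ A ∧ f s ∈ B := ⟨s, f, hf, ha, hb⟩
  have hmin : ∀ t f, IsLink G I t f → f 0 ∈ A → f t ∈ B → Nat.find hex ≤ t :=
    fun t f h1 h2 h3 => Nat.find_min' hex ⟨f, h1, h2, h3⟩
  obtain ⟨g, ⟨hgI, hgadj⟩, hgA, hgB⟩ := Nat.find_spec hex
  have hle := hmin s f hf ha hb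
  generalize Nat.find hex = t at *
  -- Cutting out the stretch between two occurrences of a vertex would give a shorter link; likewise
  -- for a chord below.
  have inj : ∀ i j, i < j → j ≤ t → g i ≠ g j := by
    intro i j hij hj heq
    have := hmin (t - (j - i)) (fun n => if n ≤ i then g n else g (n + (j - i))) ⟨?_, ?_⟩ ?_ ?_
    · omega
    · intro n hn
      dsimp only
      split_ifs
      · exact hgI _ (by omega)
      · exact hgI _ (by omega)
    · intro n hn
      dsimp only
      rcases lt_trichotomy n i with h | h | h
      · rw [if_pos (by omega), if_pos (by omega)]; exact hgadj n (by omega)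
      · subst h
        rw [if_pos le_rfl, if_neg (by omega), heq]
        have := hgadj j (by omega)
        rwa [show n + 1 + (j - n) = j + 1 by omega]
      · rw [if_neg (by omega), if_neg (by omega)]
        have := hgadj (n + (j - i)) (by omega)
        rwa [show n + 1 + (j - i) = n + (j - i) + 1 by omega]
    · simpa using hgA
    · split_ifs with h
      · rw [show t - (j - i) = i by omega, heq, show j = t by omega]; exact hgB
      · rwa [show t - (j - i) + (j - i) = t by omega]
  have chord : ∀ i j, i + 1 < j → j ≤ t → ¬ G.Adj (g i) (g j) := by
    intro i j hij hj hadj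
    have := hmin (t - (j - i - 1)) (fun n => if n ≤ i then g n else g (n + (j - i - 1)))
      ⟨?_, ?_⟩ ?_ ?_
    · omega
    · intro n hn
      dsimp only
      split_ifs
      · exact hgI _ (by omega)
      · exact hgI _ (by omega)
    · intro n hn
      dsimp only
      rcases lt_trichotomy n i with h | h | h
      · rw [if_pos (by omega), if_pos (by omega)]; exact hgadj n (by omega)
      · subst h
        rw [if_pos le_rfl, if_neg (by omega)]
        rwa [show n + 1 + (j - n - 1) = j by omega]
      · rw [if_neg (by omega), if_neg (by omega)]
        have := hgadj (n + (j - i - 1)) (by omega)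
        rwa [show n + 1 + (j - i - 1) = n + (j - i - 1) + 1 by omega]
    · simpa using hgA
    · rw [if_neg (by omega), show t - (j - i - 1) + (j - i - 1) = t by omega]; exact hgB
  refine ⟨t, g, ⟨hgI, hgadj⟩, ⟨?_, ?_⟩, hgA, hgB, ?_, ?_, hle⟩
  · intro i hi j hj hij
    rcases lt_trichotomy i j with h | h | h
    · exact absurd hij (inj i j h hj)
    · exact h
    · exact absurd hij.symm (inj j i h hi)
  · intro i hi j hj
    constructor
    · intro hadj
      rcases lt_trichotomy i j with h | h | h
      · by_contra hc
        exact chord i j (by omega) hj hadj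
      · subst h; exact absurd hadj G.irrefl
      · by_contra hc
        exact chord j i (by omega) hi hadj.symm
    · rintro (h | h)
      · subst h; exact hgadj i (by omega)
      · subst h; exact (hgadj j (by omega)).symm
  · intro i hi hA
    have := hmin (t - i) (fun n => g (n + i)) ⟨fun n hn => hgI _ (by omega), fun n hn => ?_⟩
      (by simpa using hA) (by rwa [show t - i + i = t by omega])
    · omega
    · have := hgadj (n + i) (by omega)
      show G.Adj (g (n + i)) (g (n + 1 + i))
      rwa [show n + 1 + i = n + i + 1 by omega]
  · intro i hi hB
    have := hmin i g ⟨fun n hn => hgI _ (by omega), fun n hn => hgadj _ (by omega)⟩ hgA hB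
    omega

lemma Joined.exists_shortest {I A B : Set V} {a b : V} (h : Joined G I a b)
    (ha : a ∈ A) (hb : b ∈ B) :
    ∃ s f, IsLink G I s f ∧ IsInducedPath G s f ∧ f 0 ∈ A ∧ f s ∈ B ∧
      (∀ i ≤ s, f i ∈ A → i = 0) ∧ (∀ i ≤ s, f i ∈ B → i = s) := by
  obtain ⟨s, f, hf, rfl, rfl⟩ := h.exists_link
  obtain ⟨s', f', h1, h2, h3, h4, h5, h6, -⟩ := exists_shortest_link hf ha hb
  exact ⟨s', f', h1, h2, h3, h4, h5, h6⟩

/-! ### Choosing subsequences -/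

lemma exists_subseq_or {p q : ℕ → Prop} (h : ∀ k, p k ∨ q k) :
    (∃ φ : ℕ → ℕ, StrictMono φ ∧ ∀ k, p (φ k)) ∨ (∃ φ : ℕ → ℕ, StrictMono φ ∧ ∀ k, q (φ k)) := by
  by_cases hp : ∃ᶠ k in atTop, p k
  · exact .inl (extraction_of_frequently_atTop hp)
  · refine .inr (extraction_of_eventually_atTop ?_)
    rw [not_frequently] at hp
    exact hp.mono fun k hk => (h k).resolve_left hk

/-- A sequence can be thinned out so that no two terms are in a relation in which each term is
with only finitely many terms. -/
lemma exists_subseq_of_finite {r : ℕ → ℕ → Prop} (h : ∀ i, {j | r i j}.Finite) :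
    ∃ φ : ℕ → ℕ, StrictMono φ ∧ ∀ i j, i < j → ¬ r (φ i) (φ j) := by
  have key : ∀ s : Finset ℕ, (∀ x ∈ s, True) → ∃ y, True ∧ ∀ x ∈ s, x < y ∧ ¬ r x y := by
    intro s _
    have : (⋃ i ∈ s, (Set.Iic i ∪ {j | r i j})).Finite :=
      s.finite_toSet.biUnion fun i _ => (Set.finite_Iic i).union (h i)
    obtain ⟨j, hj⟩ := this.infinite_compl.nonempty
    refine ⟨j, trivial, fun i hi => ?_⟩
    simp only [mem_compl_iff, mem_iUnion, mem_union, mem_Iic, mem_ofPred_eq, not_exists,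
      not_or] at hj
    exact ⟨not_le.1 (hj i hi).1, (hj i hi).2⟩
  obtain ⟨φ, -, hφ⟩ := exists_seq_of_forall_finset_exists (fun _ : ℕ => True)
    (fun i j => i < j ∧ ¬ r i j) key
  exact ⟨φ, strictMono_nat_of_lt_succ fun n => (hφ n (n + 1) (by omega)).1,
    fun i j hij => (hφ i j hij).2⟩

/-- Ramsey's theorem for a graph on a sequence. -/
lemma exists_subseq_clique_or_indep (r : ℕ → ℕ → Prop) :
    (∃ φ : ℕ → ℕ, StrictMono φ ∧ ∀ i j, i < j → r (φ i) (φ j)) ∨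
      (∃ φ : ℕ → ℕ, StrictMono φ ∧ ∀ i j, i < j → ¬ r (φ i) (φ j)) := by
  -- A nonprincipal ultrafilter replaces the iterated pigeonhole argument: the next term is taken
  -- from the large set of indices that are related to all earlier terms and are themselves related
  -- to almost all indices.
  have key : ∀ q : ℕ → ℕ → Prop, (∀ᶠ i in (hyperfilter ℕ : Filter ℕ),
      ∀ᶠ j in (hyperfilter ℕ : Filter ℕ), q i j) →
      ∃ φ : ℕ → ℕ, StrictMono φ ∧ ∀ i j, i < j → q (φ i) (φ j) := by
    intro q hq
    have key : ∀ s : Finset ℕ, (∀ x ∈ s, ∀ᶠ j in (hyperfilter ℕ : Filter ℕ), q x j) →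
        ∃ y, (∀ᶠ j in (hyperfilter ℕ : Filter ℕ), q y j) ∧ ∀ x ∈ s, x < y ∧ q x y := by
      intro s hs
      have h1 : ∀ᶠ j in (hyperfilter ℕ : Filter ℕ), ∀ x ∈ s, x < j ∧ q x j := by
        rw [eventually_all_finset]
        intro x hx
        refine Eventually.and ?_ (hs x hx)
        have : {j | x < j} ∈ (cofinite : Filter ℕ) := by
          rw [Nat.cofinite_eq_atTop]; exact eventually_gt_atTop x
        exact hyperfilter_le_cofinite this
      exact (hq.and h1).exists
    obtain ⟨φ, -, hφ⟩ := exists_seq_of_forall_finset_exists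
      (fun i : ℕ => ∀ᶠ j in (hyperfilter ℕ : Filter ℕ), q i j) (fun i j => i < j ∧ q i j) key
    exact ⟨φ, strictMono_nat_of_lt_succ fun n => (hφ n (n + 1) (by omega)).1,
      fun i j hij => (hφ i j hij).2⟩
  by_cases h : ∀ᶠ i in (hyperfilter ℕ : Filter ℕ), ∀ᶠ j in (hyperfilter ℕ : Filter ℕ), r i j
  · exact .inl (key r h)
  · refine .inr (key (fun i j => ¬ r i j) ?_)
    rw [← Ultrafilter.eventually_not] at h
    exact h.mono fun i hi => Ultrafilter.eventually_not.2 hi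

/-- A walk with all vertices in `S`, as a walk of the subgraph induced by `S`. -/
lemma IsLink.exists_induce_walk {S : Set V} {s : ℕ} {g : ℕ → V} {a b : V} (h : IsLink G S s g)
    (ha : g 0 = a) (hb : g s = b) (haS : a ∈ S) (hbS : b ∈ S) :
    ∃ p : (G.induce S).Walk ⟨a, haS⟩ ⟨b, hbS⟩, (∀ x, x ∈ p.support ↔ ∃ i ≤ s, g i = x.1) ∧
      (∀ x y, s(x, y) ∈ p.edges ↔ ∃ i < s,
        (g i = x.1 ∧ g (i + 1) = y.1) ∨ (g i = y.1 ∧ g (i + 1) = x.1)) ∧ p.length = s ∧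
      ((∀ i ≤ s, ∀ j ≤ s, g i = g j → i = j) → p.IsPath) := by
  classical
  -- The sequence may leave `S` only after index `s`; the value there is irrelevant.
  set g' : ℕ → S := fun i => if h : g i ∈ S then ⟨g i, h⟩ else ⟨a, haS⟩ with hg'
  have hval : ∀ i ≤ s, (g' i).1 = g i := by
    intro i hi
    simp [hg', h.1 i hi]
  have hlink : IsLink (G.induce S) univ s g' := by
    refine ⟨fun i _ => trivial, fun i hi => ?_⟩
    rw [comap_adj]
    have h1 := hval i (by omega)
    have h2 := hval (i + 1) (by omega)
    simp only [Function.Embedding.subtype_apply, h1, h2]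
    exact h.2 i hi
  obtain ⟨p, h1, h2, h3, h4⟩ := hlink.exists_walk' (a := ⟨a, haS⟩) (b := ⟨b, hbS⟩)
    (Subtype.ext (by rw [hval 0 (by omega), ha])) (Subtype.ext (by rw [hval s le_rfl, hb]))
  refine ⟨p, fun x => ?_, fun x y => ?_, h3, fun hinj => h4 fun i hi j hj hij => ?_⟩
  · rw [h1]
    refine exists_congr fun i => and_congr_right fun hi => ?_
    rw [Subtype.ext_iff, hval i hi]
  · rw [h2]
    refine exists_congr fun i => and_congr_right fun hi => ?_
    rw [Sym2.eq_iff]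
    simp only [Subtype.ext_iff, hval i (by omega), hval (i + 1) (by omega)]
    constructor
    · rintro (⟨h, h'⟩ | ⟨h, h'⟩)
      exacts [.inl ⟨h.symm, h'.symm⟩, .inr ⟨h'.symm, h.symm⟩]
    · rintro (⟨h, h'⟩ | ⟨h, h'⟩)
      exacts [.inl ⟨h.symm, h'.symm⟩, .inr ⟨h'.symm, h.symm⟩]
  · refine hinj i hi j hj ?_
    rw [← hval i hi, ← hval j hj, hij]

/-! ### Theta graphs -/

/-- A shortest path inside `I j` from a neighbour of `x` to a neighbour of `y` is induced, and `x`
and `y` see only its ends. Together with `hE` this leaves `x y` as the only possible edge outside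
the paths. -/
lemma exists_theta_of_links {x y : V} (hxy : x ≠ y) {I : ℕ → Set V}
    (hd : ∀ i j, i < j → Disjoint (I i) (I j)) (hx : ∀ j, x ∉ I j) (hy : ∀ j, y ∉ I j)
    (hI : ∀ j, ∃ a b, G.Adj x a ∧ G.Adj y b ∧ Joined G (I j) a b)
    (hE : ∀ i j, i < j → ∀ a ∈ I i, ∀ b ∈ I j, ¬ G.Adj a b) :
    ∃ S : Set V, IsTheta (G.induce S) := by
  classical
  have hd' : ∀ i j, i ≠ j → ∀ a ∈ I i, ∀ b ∈ I j, a ≠ b ∧ ¬ G.Adj a b := by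
    intro i j hij a ha b hb
    rcases lt_or_gt_of_ne hij with h | h
    · exact ⟨fun e => (Set.disjoint_left.1 (hd i j h)) ha (e ▸ hb), hE i j h a ha b hb⟩
    · exact ⟨fun e => (Set.disjoint_left.1 (hd j i h)) hb (e ▸ ha),
        fun e => hE j i h b hb a ha e.symm⟩
  have hI' : ∀ j, ∃ s f, IsLink G (I j) s f ∧ IsInducedPath G s f ∧ G.Adj x (f 0) ∧
      G.Adj y (f s) ∧ (∀ i ≤ s, G.Adj x (f i) → i = 0) ∧ (∀ i ≤ s, G.Adj y (f i) → i = s) := by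
    intro j
    obtain ⟨a, b, ha, hb, hab⟩ := hI j
    exact hab.exists_shortest (A := {z | G.Adj x z}) (B := {z | G.Adj y z}) ha hb
  choose s f hl hp h0 hs hu0 hus using hI'
  set S : Set V := {z | z = x ∨ z = y ∨ ∃ j, ∃ i ≤ s j, f j i = z} with hS
  have hxS : x ∈ S := .inl rfl
  have hyS : y ∈ S := .inr (.inl rfl)
  have hfS : ∀ j, ∀ i ≤ s j, f j i ∈ S := fun j i hi => .inr (.inr ⟨j, i, hi, rfl⟩)
  have hfx : ∀ j, ∀ i ≤ s j, f j i ≠ x := fun j i hi e => hx j (e ▸ (hl j).1 i hi)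
  have hfy : ∀ j, ∀ i ≤ s j, f j i ≠ y := fun j i hi e => hy j (e ▸ (hl j).1 i hi)
  set g : ℕ → ℕ → V := fun j n => if n = 0 then x else if n ≤ s j + 1 then f j (n - 1) else y
    with hg
  have g0 : ∀ j, g j 0 = x := fun j => by simp [hg]
  have g1 : ∀ j, ∀ i ≤ s j, g j (i + 1) = f j i := fun j i hi => by simp [hg, hi]
  have g2 : ∀ j, g j (s j + 2) = y := fun j => by simp [hg]
  have hcase : ∀ j, ∀ n ≤ s j + 2, n = 0 ∨ (∃ i ≤ s j, n = i + 1) ∨ n = s j + 2 := by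
    intro j n hn
    rcases Nat.eq_zero_or_pos n with h | h
    · exact .inl h
    · by_cases h' : n = s j + 2
      · exact .inr (.inr h')
      · exact .inr (.inl ⟨n - 1, by omega, by omega⟩)
  have hlink : ∀ j, IsLink G S (s j + 2) (g j) := by
    intro j
    refine ⟨fun n hn => ?_, fun n hn => ?_⟩
    · rcases hcase j n hn with rfl | ⟨i, hi, rfl⟩ | rfl
      · rwa [g0]
      · rw [g1 j i hi]; exact hfS j i hi
      · rwa [g2]
    · rcases hcase j n (by omega) with rfl | ⟨i, hi, rfl⟩ | rfl
      · rw [g0, g1 j 0 (by omega)]; exact h0 j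
      · rw [g1 j i hi]
        by_cases his : i = s j
        · subst his; rw [g2]; exact (hs j).symm
        · rw [g1 j (i + 1) (by omega)]; exact (hl j).2 i (by omega)
      · omega
  have hinj : ∀ j, ∀ n ≤ s j + 2, ∀ m ≤ s j + 2, g j n = g j m → n = m := by
    intro j n hn m hm e
    rcases hcase j n hn with rfl | ⟨i, hi, rfl⟩ | rfl <;>
      rcases hcase j m hm with rfl | ⟨i', hi', rfl⟩ | rfl <;>
      try simp only [g0, g2] at e
    · rfl
    · rw [g1 j i' hi'] at e; exact absurd e.symm (hfx j i' hi')
    · exact absurd e hxy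
    · rw [g1 j i hi] at e; exact absurd e (hfx j i hi)
    · rw [g1 j i hi, g1 j i' hi'] at e
      rw [(hp j).1 i hi i' hi' e]
    · rw [g1 j i hi] at e; exact absurd e (hfy j i hi)
    · exact absurd e.symm hxy
    · rw [g1 j i' hi'] at e; exact absurd e.symm (hfy j i' hi')
    · rfl
  have hw := fun j => (hlink j).exists_induce_walk (g0 j) (g2 j) hxS hyS
  choose p hsup hedge hlen hpath using hw
  have hsup' : ∀ j w, w ∈ (p j).support ↔ w.1 = x ∨ w.1 = y ∨ ∃ i ≤ s j, f j i = w.1 := by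
    intro j w
    rw [hsup]
    constructor
    · rintro ⟨n, hn, e⟩
      rcases hcase j n hn with rfl | ⟨i, hi, rfl⟩ | rfl
      · exact .inl (by rw [← e, g0])
      · exact .inr (.inr ⟨i, hi, by rw [← e, g1 j i hi]⟩)
      · exact .inr (.inl (by rw [← e, g2]))
    · rintro (h | h | ⟨i, hi, e⟩)
      · exact ⟨0, by omega, by rw [g0, h]⟩
      · exact ⟨s j + 2, le_rfl, by rw [g2, h]⟩
      · exact ⟨i + 1, by omega, by rw [g1 j i hi, e]⟩
  have hdisj : ∀ m n, m ≠ n → ∀ w, w ∈ (p m).support → w ∈ (p n).support →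
      w = ⟨x, hxS⟩ ∨ w = ⟨y, hyS⟩ := by
    intro m n hmn w hm hn
    rcases (hsup' m w).1 hm with h | h | ⟨i, hi, e⟩
    · exact .inl (Subtype.ext h)
    · exact .inr (Subtype.ext h)
    rcases (hsup' n w).1 hn with h | h | ⟨i', hi', e'⟩
    · exact .inl (Subtype.ext h)
    · exact .inr (Subtype.ext h)
    exact absurd (e.trans e'.symm) (hd' m n hmn _ ((hl m).1 i hi) _ ((hl n).1 i' hi')).1
  have hpinj : Function.Injective p := by
    intro m n hmn
    by_contra hne
    have h1 : (⟨f m 0, hfS m 0 (by omega)⟩ : S) ∈ (p m).support :=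
      (hsup' _ _).2 (.inr (.inr ⟨0, by omega, rfl⟩))
    rcases hdisj m n hne _ h1 (hmn ▸ h1) with h | h
    · exact hfx m 0 (by omega) (congrArg Subtype.val h)
    · exact hfy m 0 (by omega) (congrArg Subtype.val h)
  have hcover : ∀ w, ∃ n, w ∈ (p n).support := by
    rintro ⟨w, h | h | ⟨j, i, hi, e⟩⟩
    · exact ⟨0, (hsup' _ _).2 (.inl h)⟩
    · exact ⟨0, (hsup' _ _).2 (.inr (.inl h))⟩
    · exact ⟨j, (hsup' _ _).2 (.inr (.inr ⟨i, hi, e⟩))⟩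
  have hxedge : ∀ j i, i ≤ s j → G.Adj x (f j i) → g j 0 = x ∧ g j 1 = f j i := by
    intro j i hi hadj
    have := hu0 j i hi hadj
    subst this
    exact ⟨g0 j, g1 j 0 hi⟩
  have hyedge : ∀ j i, i ≤ s j → G.Adj y (f j i) →
      g j (s j + 1) = f j i ∧ g j (s j + 1 + 1) = y := by
    intro j i hi hadj
    have := hus j i hi hadj
    subst this
    exact ⟨g1 j _ le_rfl, g2 j⟩
  have hedges : ∀ w w', (G.induce S).Adj w w' → (∃ n, s(w, w') ∈ (p n).edges) ∨
      s(w, w') = s(⟨x, hxS⟩, ⟨y, hyS⟩) := by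
    rintro ⟨w, hw⟩ ⟨w', hw'⟩ hadj
    have hadj : G.Adj w w' := hadj
    rcases id hw with rfl | rfl | ⟨j, i, hi, rfl⟩ <;>
      rcases id hw' with rfl | rfl | ⟨j', i', hi', rfl⟩
    · exact absurd hadj G.irrefl
    · exact .inr rfl
    · exact .inl ⟨j', (hedge _ _ _).2 ⟨0, by omega, .inl (hxedge _ _ hi' hadj)⟩⟩
    · exact .inr Sym2.eq_swap
    · exact absurd hadj G.irrefl
    · exact .inl ⟨j', (hedge _ _ _).2 ⟨s j' + 1, by omega, .inr (hyedge _ _ hi' hadj)⟩⟩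
    · exact .inl ⟨j, (hedge _ _ _).2 ⟨0, by omega, .inr (hxedge _ _ hi hadj.symm)⟩⟩
    · exact .inl ⟨j, (hedge _ _ _).2 ⟨s j + 1, by omega, .inl (hyedge _ _ hi hadj.symm)⟩⟩
    · have hjj : j = j' := by
        by_contra hne
        exact (hd' j j' hne _ ((hl j).1 i hi) _ ((hl j').1 i' hi')).2 hadj
      subst hjj
      refine .inl ⟨j, (hedge _ _ _).2 ?_⟩
      rcases ((hp j).2 i hi i' hi').1 hadj with rfl | rfl
      · exact ⟨i + 1, by omega, .inl ⟨g1 j i hi, g1 j _ hi'⟩⟩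
      · exact ⟨i' + 1, by omega, .inr ⟨g1 j i' hi', g1 j _ hi⟩⟩
  have hXY : (⟨x, hxS⟩ : S) ≠ ⟨y, hyS⟩ := fun e => hxy (congrArg Subtype.val e)
  -- An edge `x y` is put in front as a further path. It differs from the others because they have
  -- length at least two.
  by_cases hadj : G.Adj x y
  · have hadj' : (G.induce S).Adj ⟨x, hxS⟩ ⟨y, hyS⟩ := hadj
    set q : ℕ → (G.induce S).Walk ⟨x, hxS⟩ ⟨y, hyS⟩ := fun n =>
      Nat.casesOn n (.cons hadj' .nil) p with hq
    have q0 : ∀ w, w ∈ (q 0).support ↔ w = ⟨x, hxS⟩ ∨ w = ⟨y, hyS⟩ := by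
      intro w; simp [hq]
    have q1 : ∀ n, q (n + 1) = p n := fun n => rfl
    have hql : (q 0).length = 1 := by simp [hq]
    refine ⟨S, ⟨x, hxS⟩, ⟨y, hyS⟩, q, hXY, ?_, ?_, ?_, ?_, ?_⟩
    · rintro (_ | m) (_ | n) e
      · rfl
      · have := congrArg Walk.length e
        rw [q1, hlen, hql] at this; omega
      · have := congrArg Walk.length e
        rw [q1, hlen, hql] at this; omega
      · rw [hpinj e]
    · rintro (_ | n)
      · simpa [hq] using hxy
      · exact hpath n (hinj n)
    · rintro (_ | m) (_ | n) hmn w h1 h2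
      · exact absurd rfl hmn
      · exact (q0 w).1 h1
      · exact (q0 w).1 h2
      · exact hdisj m n (by omega) w h1 h2
    · intro w
      obtain ⟨n, hn⟩ := hcover w
      exact ⟨n + 1, hn⟩
    · intro w w' h
      rcases hedges w w' h with ⟨n, hn⟩ | h
      · exact ⟨n + 1, hn⟩
      · exact ⟨0, by rw [h]; simp [hq]⟩
  · refine ⟨S, ⟨x, hxS⟩, ⟨y, hyS⟩, p, hXY, hpinj, fun n => hpath n (hinj n), hdisj, hcover, ?_⟩
    intro w w' h
    rcases hedges w w' h with h1 | h1
    · exact h1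
    · exfalso
      have h2 : G.Adj w.1 w'.1 := h
      rcases Sym2.eq_iff.1 h1 with ⟨rfl, rfl⟩ | ⟨rfl, rfl⟩
      · exact hadj h2
      · exact hadj h2.symm

lemma exists_theta_of_links_of_finite {x y : V} (hxy : x ≠ y) {I : ℕ → Set V}
    (hd : ∀ i j, i < j → Disjoint (I i) (I j)) (hx : ∀ j, x ∉ I j) (hy : ∀ j, y ∉ I j)
    (hI : ∀ j, ∃ a b, G.Adj x a ∧ G.Adj y b ∧ Joined G (I j) a b)
    (hE : ∀ i, {j | ∃ a ∈ I i, ∃ b ∈ I j, G.Adj a b}.Finite) :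
    ∃ S : Set V, IsTheta (G.induce S) := by
  obtain ⟨φ, hφ, h⟩ := exists_subseq_of_finite hE
  refine exists_theta_of_links hxy (I := fun n => I (φ n)) (fun i j hij => hd _ _ (hφ hij))
    (fun j => hx _) (fun j => hy _) (fun j => hI _) ?_
  intro i j hij a ha b hb hab
  exact h i j hij ⟨a, ha, b, hb, hab⟩

/-! ### Bundles of bounded length -/

/-- There are infinitely many disjoint connecting paths of length at most `k` between the
neighbourhoods of `x` and `y`. -/
def HasBundle (G : SimpleGraph V) (x y : V) (k : ℕ) : Prop :=
  ∃ (I : ℕ → Set V), (∀ i j, i < j → Disjoint (I i) (I j)) ∧ (∀ j, x ∉ I j) ∧ (∀ j, y ∉ I j) ∧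
    ∀ j, ∃ s ≤ k, ∃ f, IsLink G (I j) s f ∧ G.Adj x (f 0) ∧ G.Adj y (f s)

/-- By Ramsey's theorem the common neighbours contain an infinite clique, which is a `K_∞`, or an
infinite independent set, whose vertices are the links of a theta graph. -/
lemma exists_kInf_or_theta_of_common {x y : V} (hxy : x ≠ y) {f : ℕ → V}
    (hf : ∀ i j, i < j → f i ≠ f j) (hx : ∀ i, G.Adj x (f i)) (hy : ∀ i, G.Adj y (f i)) :
    ∃ S : Set V, IsKInf (G.induce S) ∨ IsTheta (G.induce S) := by
  rcases exists_subseq_clique_or_indep (fun i j => G.Adj (f i) (f j)) with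
    ⟨φ, hφ, h⟩ | ⟨φ, hφ, h⟩
  · have hadj : ∀ i j, i ≠ j → G.Adj (f (φ i)) (f (φ j)) := by
      intro i j hij
      rcases lt_or_gt_of_ne hij with h' | h'
      · exact h i j h'
      · exact (h j i h').symm
    have hinj : Function.Injective (fun i => f (φ i)) := by
      intro i j hij
      by_contra hne
      exact (hadj i j hne).ne hij
    refine ⟨range (fun i => f (φ i)), .inl ⟨(RelIso.mk (Equiv.ofInjective _ hinj) ?_).symm⟩⟩
    intro i j
    change G.Adj (f (φ i)) (f (φ j)) ↔ i ≠ j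
    exact ⟨fun h1 h2 => h1.ne (by rw [h2]), hadj i j⟩
  · obtain ⟨S, hS⟩ := exists_theta_of_links (G := G) hxy (I := fun i => {f (φ i)})
      (fun i j hij => by simpa using hf _ _ (hφ hij)) (fun j => by simpa using (hx _).ne)
      (fun j => by simpa using (hy _).ne)
      (fun j => ⟨f (φ j), f (φ j), hx _, hy _, .refl rfl⟩)
      (fun i j hij a ha b hb => by
        rw [mem_singleton_iff] at ha hb; subst ha hb; exact h i j hij)
    exact ⟨S, .inr hS⟩

/-- Induction on the bound. If every link has edges to only finitely many others, thinning out gives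
a theta graph. Otherwise some vertex `z` of a link has neighbours on infinitely many links. Such a
neighbour divides its link into two parts, one of which has length at most `k / 2`, so `z` forms a
bundle of bound `k / 2` with `x` or with `y`. -/
lemma exists_kInf_or_theta_of_bundle (k : ℕ) : ∀ {x y : V}, x ≠ y → HasBundle G x y k →
    ∃ S : Set V, IsKInf (G.induce S) ∨ IsTheta (G.induce S) := by
  induction k using Nat.strong_induction_on with
  | _ k ih =>
  rintro x y hxy ⟨I, hd, hx, hy, hI⟩
  choose s hsk f hl h0 hs using hI
  rcases Nat.eq_zero_or_pos k with rfl | hk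
  · refine exists_kInf_or_theta_of_common hxy (f := fun j => f j 0) ?_ h0 ?_
    · intro i j hij e
      exact Set.disjoint_left.1 (hd i j hij) ((hl i).1 0 (by omega)) (e ▸ (hl j).1 0 (by omega))
    · intro j
      have := hs j
      rwa [show s j = 0 by have := hsk j; omega] at this
  by_contra hno
  refine hno ?_
  suffices ∃ S : Set V, IsTheta (G.induce S) from this.imp fun S h => .inr h
  set I' : ℕ → Set V := fun j => {z | ∃ i ≤ s j, f j i = z} with hI'
  have hII : ∀ j, I' j ⊆ I j := by
    rintro j z ⟨i, hi, rfl⟩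
    exact (hl j).1 i hi
  have hd' : ∀ i j, i < j → Disjoint (I' i) (I' j) :=
    fun i j hij => (hd i j hij).mono (hII i) (hII j)
  have hl' : ∀ j, IsLink G (I' j) (s j) (f j) := fun j => ⟨fun i hi => ⟨i, hi, rfl⟩, (hl j).2⟩
  refine exists_theta_of_links_of_finite hxy (I := I') hd' (fun j h => hx j (hII j h))
    (fun j h => hy j (hII j h)) (fun j => ⟨f j 0, f j (s j), h0 j, hs j,
      (hl' j).joined (by omega) le_rfl⟩) ?_
  intro i
  by_contra hinf
  have h1 : (⋃ n ∈ Set.Iic (s i), {j | ∃ m ≤ s j, G.Adj (f i n) (f j m)}).Infinite := by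
    refine Set.Infinite.mono ?_ hinf
    rintro j ⟨_, ⟨n, hn, rfl⟩, _, ⟨m, hm, rfl⟩, hadj⟩
    exact mem_biUnion hn ⟨m, hm, hadj⟩
  -- Pigeonhole over the finitely many vertices of the `i`-th link.
  obtain ⟨n, hn, h2⟩ : ∃ n ≤ s i, {j | ∃ m ≤ s j, G.Adj (f i n) (f j m)}.Infinite := by
    by_contra hc
    push Not at hc
    exact h1 ((Set.finite_Iic _).biUnion fun n hn => hc n hn)
  set z := f i n with hz
  have hzi : z ∈ I' i := ⟨n, hn, rfl⟩
  have hzx : z ≠ x := fun e => hx i (hII i (e ▸ hzi))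
  have hzy : z ≠ y := fun e => hy i (hII i (e ▸ hzi))
  have h3 : {j | i < j ∧ ∃ m ≤ s j, G.Adj z (f j m)}.Infinite := by
    have := h2.sdiff (Set.finite_Iic i)
    refine this.mono ?_
    rintro j ⟨hj, hj'⟩
    exact ⟨not_le.1 hj', hj⟩
  have h4 := Nat.frequently_atTop_iff_infinite.2 h3
  obtain ⟨φ, hφ, hφ'⟩ := extraction_of_frequently_atTop h4
  have hzn : ∀ j, z ∉ I' (φ j) := fun j h =>
    Set.disjoint_left.1 (hd' i (φ j) (hφ' j).1) hzi h
  have hm := fun j => (hφ' j).2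
  choose m hms hmadj using hm
  have h5 : ∀ j, m j ≤ k / 2 ∨ s (φ j) - m j ≤ k / 2 := by
    intro j
    have := hsk (φ j)
    have := hms j
    omega
  -- The same end has the short part infinitely often. Since `k` is positive, `k / 2 < k` and
  -- induction applies.
  rcases exists_subseq_or h5 with ⟨ψ, hψ, h⟩ | ⟨ψ, hψ, h⟩
  · refine hno (ih (k / 2) (by omega) hzx.symm ⟨fun j => I' (φ (ψ j)), fun a b hab =>
      hd' _ _ (hφ (hψ hab)), fun j h => hx _ (hII _ h), fun j => hzn _, fun j =>
      ⟨m (ψ j), h j, f (φ (ψ j)), ⟨fun a ha => (hl' _).1 a ?_, fun a ha => (hl' _).2 a ?_⟩,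
        h0 _, hmadj _⟩⟩)
    · have := hms (ψ j); omega
    · have := hms (ψ j); omega
  · refine hno (ih (k / 2) (by omega) hzy ⟨fun j => I' (φ (ψ j)), fun a b hab =>
      hd' _ _ (hφ (hψ hab)), fun j => hzn _, fun j h => hy _ (hII _ h), fun j =>
      ⟨s (φ (ψ j)) - m (ψ j), h j, fun a => f (φ (ψ j)) (m (ψ j) + a),
        ⟨fun a ha => (hl' _).1 _ ?_, fun a ha => (hl' _).2 _ ?_⟩, hmadj _, ?_⟩⟩)
    · have := hms (ψ j); omega
    · have := hms (ψ j); omega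
    · have := hms (ψ j)
      change G.Adj y (f (φ (ψ j)) (m (ψ j) + (s (φ (ψ j)) - m (ψ j))))
      rw [show m (ψ j) + (s (φ (ψ j)) - m (ψ j)) = s (φ (ψ j)) by omega]
      exact hs _

/-! ### Geodesic stars and combs -/

/-- The vertices `u` of `U` for which `x` lies on a shortest path from `r` to `u`. -/
def desc (K : SimpleGraph V) (r : V) (U : Set V) (x : V) : Set V :=
  {u | u ∈ U ∧ K.dist r u = K.dist r x + K.dist x u}

section Geodesics

variable {K : SimpleGraph V} {r : V} {U : Set V}

lemma desc_root : desc K r U r = U := by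
  ext u; simp [desc]

lemma desc_subset_of_adj (hK : K.Connected) {y z : V} (h : K.Adj y z)
    (hz : K.dist r z = K.dist r y + 1) : desc K r U z ⊆ desc K r U y := by
  rintro u ⟨hu, hd⟩
  refine ⟨hu, ?_⟩
  have h1 := hK.dist_triangle (u := y) (v := z) (w := u)
  have h2 := hK.dist_triangle (u := r) (v := y) (w := u)
  have h3 : K.dist y z = 1 := dist_eq_one_iff_adj.2 h
  omega

/-- As `x` lies on a geodesic from `r` to `u`, the triangle inequality is tight along any shortest
path from `x` to `u`: each step goes one further from `r`, and `u` stays behind every vertex of the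
path. -/
lemma exists_geodesic (hK : K.Connected) {x u : V} (hu : u ∈ desc K r U x) :
    ∃ s g, IsLink K univ s g ∧ g 0 = x ∧ g s = u ∧
      (∀ i ≤ s, K.dist r (g i) = K.dist r x + i) ∧ ∀ i ≤ s, u ∈ desc K r U (g i) := by
  obtain ⟨p, hp⟩ := hK.exists_walk_length_eq_dist x u
  have hl : IsLink K univ p.length p.getVert :=
    ⟨fun i _ => trivial, fun i hi => p.adj_getVert_succ hi⟩
  have h1 : ∀ i ≤ p.length, K.dist x (p.getVert i) ≤ i := by
    intro i hi
    have := dist_le (p.take i)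
    rwa [Walk.take_length, min_eq_left hi] at this
  have h2 : ∀ i ≤ p.length, K.dist (p.getVert i) u ≤ p.length - i := by
    intro i hi
    have := dist_le (p.drop i)
    rwa [Walk.drop_length] at this
  have h3 : ∀ i ≤ p.length, K.dist r (p.getVert i) = K.dist r x + i ∧
      K.dist (p.getVert i) u = p.length - i := by
    intro i hi
    have a1 := h1 i hi
    have a2 := h2 i hi
    have a3 := hK.dist_triangle (u := r) (v := x) (w := p.getVert i)
    have a4 := hK.dist_triangle (u := r) (v := p.getVert i) (w := u)
    have a5 := hu.2
    omega
  refine ⟨p.length, p.getVert, hl, p.getVert_zero, p.getVert_length, fun i hi => (h3 i hi).1,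
    fun i hi => ⟨hu.1, ?_⟩⟩
  have a5 := hu.2
  have := h3 i hi
  omega

/-- In a connected graph with an infinite set `U` of vertices there is a vertex with infinitely
many geodesics to `U` that are disjoint otherwise, or a geodesic ray each of whose vertices
has infinitely many vertices of `U` behind it. -/
theorem exists_star_or_comb (hK : K.Connected) (r : V) (hU : U.Infinite) :
    (∃ (x : V) (s : ℕ → ℕ) (g : ℕ → ℕ → V),
      (∀ j, 1 ≤ s j ∧ g j 0 = x ∧ g j (s j) ∈ U ∧ IsLink K univ (s j) (g j) ∧
        ∀ i ≤ s j, K.dist r (g j i) = K.dist r x + i) ∧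
      ∀ j j', j < j' → ∀ i i', 1 ≤ i → i ≤ s j → 1 ≤ i' → i' ≤ s j' → g j i ≠ g j' i') ∨
    (∃ R : ℕ → V, R 0 = r ∧ (∀ n, K.Adj (R n) (R (n + 1))) ∧ (∀ n, K.dist r (R n) = n) ∧
      ∀ n, (desc K r U (R n)).Infinite) := by
  -- Either infinitely many vertices of `U` lie behind some `x` but only finitely many behind each
  -- of its neighbours one level up, and `x` is the centre of a star; or it is always possible to go
  -- up and keep infinitely many vertices of `U` behind.
  by_cases h : ∃ x, (desc K r U x).Infinite ∧
      ∀ y, K.Adj x y → K.dist r y = K.dist r x + 1 → (desc K r U y).Finite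
  · left
    obtain ⟨x, hx, hfin⟩ := h
    set P : ℕ × (ℕ → V) → Prop := fun p => (1 ≤ p.1 ∧ p.2 0 = x ∧ p.2 p.1 ∈ U ∧
      IsLink K univ p.1 p.2 ∧ ∀ i ≤ p.1, K.dist r (p.2 i) = K.dist r x + i) ∧
      ∀ i, 1 ≤ i → i ≤ p.1 → (desc K r U (p.2 i)).Finite with hP
    set Q : ℕ × (ℕ → V) → ℕ × (ℕ → V) → Prop := fun p q =>
      ∀ i i', 1 ≤ i → i ≤ p.1 → 1 ≤ i' → i' ≤ q.1 → p.2 i ≠ q.2 i' with hQ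
    have key : ∀ T : Finset (ℕ × (ℕ → V)), (∀ p ∈ T, P p) → ∃ q, P q ∧ ∀ p ∈ T, Q p q := by
      intro T hT
      -- A vertex `u` outside this finite set has a geodesic from `x` that misses all earlier
      -- geodesics after `x`, because `u` lies behind each vertex of its own geodesic.
      have hF : (⋃ p ∈ T, ⋃ i ∈ Set.Icc 1 p.1, desc K r U (p.2 i)).Finite :=
        T.finite_toSet.biUnion fun p hp => (Set.finite_Icc _ _).biUnion fun i hi =>
          (hT p hp).2 i hi.1 hi.2
      obtain ⟨u, hu, hu'⟩ := (hx.sdiff (hF.union (Set.finite_singleton x))).nonempty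
      obtain ⟨s, g, hl, hg0, hgs, hlev, hdesc⟩ := exists_geodesic hK hu
      have hs : 1 ≤ s := by
        by_contra hc
        have : s = 0 := by omega
        subst this
        exact hu' (.inr (by rw [mem_singleton_iff, ← hgs, hg0]))
      refine ⟨(s, g), ⟨⟨hs, hg0, by simpa [hgs] using hu.1, hl, hlev⟩, ?_⟩, ?_⟩
      -- The first vertex after `x` has finitely many vertices of `U` behind it by the choice of
      -- `x`, and going up only shrinks this set.
      · intro i hi
        induction i, hi using Nat.le_induction with
        | base =>
          intro _
          refine hfin _ ?_ (hlev 1 hs)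
          have := hl.2 0 (by omega)
          rwa [hg0] at this
        | succ i hi ih =>
          intro his
          have his : i + 1 ≤ s := his
          have a1 := hlev i (by omega)
          have a2 := hlev (i + 1) his
          exact (ih (show i ≤ s by omega)).subset
            (desc_subset_of_adj hK (hl.2 i his) (show K.dist r (g (i + 1)) = K.dist r (g i) + 1 by omega))
      · intro p hp i i' hi hip hi' his e
        refine hu' (.inl ?_)
        refine mem_biUnion hp (mem_biUnion ⟨hi, hip⟩ ?_)
        rw [e]
        exact hdesc i' his
    obtain ⟨F, hF, hFF⟩ := exists_seq_of_forall_finset_exists P Q key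
    exact ⟨x, fun j => (F j).1, fun j => (F j).2, fun j => (hF j).1, hFF⟩
  · right
    push Not at h
    choose! nx hnx1 hnx2 hnx3 using h
    set R : ℕ → V := fun n => nx^[n] r with hR
    have hR1 : ∀ n, R (n + 1) = nx (R n) := fun n => Function.iterate_succ_apply' nx n r
    have hinf : ∀ n, (desc K r U (R n)).Infinite := by
      intro n
      induction n with
      | zero => simpa [hR, desc_root] using hU
      | succ n ih => rw [hR1]; exact hnx3 _ ih
    refine ⟨R, rfl, fun n => ?_, fun n => ?_, hinf⟩
    · rw [hR1]; exact hnx1 _ (hinf n)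
    · induction n with
      | zero => simp [hR]
      | succ n ih => rw [hR1, hnx2 _ (hinf n), ih]

lemma dist_le_succ_of_adj (hK : K.Connected) {a b : V} (h : K.Adj a b) :
    K.dist r b ≤ K.dist r a + 1 := by
  have h1 := hK.dist_triangle (u := r) (v := a) (w := b)
  have h3 : K.dist a b = 1 := dist_eq_one_iff_adj.2 h
  omega

/-- A ray in which all distances from the initial vertex are attained along the ray is induced. -/
lemma geodesic_adj_iff (hK : K.Connected) {R : ℕ → V} (hR : ∀ n, K.Adj (R n) (R (n + 1)))
    (hd : ∀ n, K.dist r (R n) = n) (i j : ℕ) :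
    K.Adj (R i) (R j) ↔ (j = i + 1 ∨ i = j + 1) := by
  constructor
  · intro h
    have h1 := dist_le_succ_of_adj (r := r) hK h
    have h2 := dist_le_succ_of_adj (r := r) hK h.symm
    rw [hd, hd] at h1 h2
    have : i ≠ j := by rintro rfl; exact h.ne rfl
    omega
  · rintro (rfl | rfl)
    exacts [hR i, (hR j).symm]

lemma geodesic_injective {R : ℕ → V} (hd : ∀ n, K.dist r (R n) = n) : Function.Injective R := by
  intro i j h
  rw [← hd i, ← hd j, h]

end Geodesics

/-! ### Constructing subdivisions -/

/-- Subdivisions, as induced subgraphs, from paths given by functions and for one orientation of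
each edge. -/
lemma exists_subdivision {A : Type v} {F : SimpleGraph A} {E : Set (Sym2 A)}
    (Rel : A → A → Prop) (hF : ∀ a b, F.Adj a b ↔ Rel a b ∨ Rel b a)
    (hasymm : ∀ a b, Rel a b → ¬ Rel b a) {S : Set V} {br : A → V}
    (hbr : Function.Injective br) (l : A → A → ℕ) (g : A → A → ℕ → V)
    (h0 : ∀ a b, Rel a b → g a b 0 = br a) (h1 : ∀ a b, Rel a b → g a b (l a b) = br b)
    (hlink : ∀ a b, Rel a b → IsLink G S (l a b) (g a b))
    (hinj : ∀ a b, Rel a b → ∀ i ≤ l a b, ∀ j ≤ l a b, g a b i = g a b j → i = j)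
    (hlen : ∀ a b, Rel a b → s(a, b) ∉ E → l a b = 1)
    (hbm : ∀ a b, Rel a b → ∀ i ≤ l a b, ∀ c, g a b i = br c → c = a ∨ c = b)
    (hind : ∀ a b c d, Rel a b → Rel c d → (a, b) ≠ (c, d) →
      ∀ i ≤ l a b, ∀ j ≤ l c d, g a b i = g c d j → ∃ x, g a b i = br x)
    (hbS : ∀ a, br a ∈ S)
    (hv : ∀ w ∈ S, (∃ c, w = br c) ∨ ∃ a b, Rel a b ∧ ∃ i ≤ l a b, g a b i = w)
    (he : ∀ w ∈ S, ∀ w' ∈ S, G.Adj w w' → ∃ a b, Rel a b ∧ ∃ i < l a b,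
      (g a b i = w ∧ g a b (i + 1) = w') ∨ (g a b i = w' ∧ g a b (i + 1) = w)) :
    Nonempty (Subdivision F E (G.induce S)) := by
  classical
  have hp := fun a b (h : Rel a b) =>
    (hlink a b h).exists_induce_walk (h0 a b h) (h1 a b h) (hbS a) (hbS b)
  choose p hsup hedge hpl hpp using hp
  have hrel : ∀ a b, F.Adj a b → ¬ Rel a b → Rel b a := fun a b h h' =>
    ((hF a b).1 h).resolve_left h'
  -- An edge taken against its orientation receives the reversed path, which makes `path_symm` hold.
  set q : ∀ a b, F.Adj a b → (G.induce S).Walk ⟨br a, hbS a⟩ ⟨br b, hbS b⟩ := fun a b h =>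
    if hr : Rel a b then p a b hr else (p b a (hrel a b h hr)).reverse with hq
  have hq1 : ∀ a b h (hr : Rel a b), q a b h = p a b hr := fun a b h hr => by
    simp only [hq, dif_pos hr]
  have hq2 : ∀ a b h (hr : Rel b a), q a b h = (p b a hr).reverse := fun a b h hr => by
    simp only [hq, dif_neg (hasymm b a hr)]
  have key : ∀ a b (h : F.Adj a b), ∃ c d, ∃ hr : Rel c d, s(a, b) = s(c, d) ∧
      (∀ w, w ∈ (q a b h).support ↔ w ∈ (p c d hr).support) ∧
      (∀ e, e ∈ (q a b h).edges ↔ e ∈ (p c d hr).edges) ∧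
      (q a b h).length = (p c d hr).length ∧ ((p c d hr).IsPath → (q a b h).IsPath) := by
    intro a b h
    rcases (hF a b).1 h with hr | hr
    · exact ⟨a, b, hr, rfl, by simp [hq1 a b h hr], by simp [hq1 a b h hr],
        by simp [hq1 a b h hr], by simp [hq1 a b h hr]⟩
    · exact ⟨b, a, hr, Sym2.eq_swap, by simp [hq2 a b h hr], by simp [hq2 a b h hr],
        by simp [hq2 a b h hr], by simp [hq2 a b h hr]⟩
  refine ⟨⟨⟨fun a => ⟨br a, hbS a⟩, fun a b h => hbr (congrArg Subtype.val h)⟩, q,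
    ?_, ?_, ?_, ?_, ?_, ?_, ?_⟩⟩
  · intro a b h
    rcases (hF a b).1 h with hr | hr
    · rw [hq1 a b h hr, hq2 b a h.symm hr]
    · rw [hq2 a b h hr, hq1 b a h.symm hr, Walk.reverse_reverse]
  · intro a b h
    obtain ⟨c, d, hr, -, -, -, -, hk⟩ := key a b h
    exact hk (hpp c d hr (hinj c d hr))
  · intro a b h hE
    obtain ⟨c, d, hr, hs, -, -, hk, -⟩ := key a b h
    rw [hk, hpl, hlen c d hr (hs ▸ hE)]
  · intro a b h c hc
    obtain ⟨a', b', hr, hs, hk, -⟩ := key a b h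
    obtain ⟨i, hi, e⟩ := (hsup _ _ hr _).1 ((hk _).1 hc)
    have := hbm a' b' hr i hi c e
    rcases Sym2.eq_iff.1 hs with ⟨rfl, rfl⟩ | ⟨rfl, rfl⟩
    · exact this
    · exact this.symm
  · intro a b h c d h' hne w hw hw'
    obtain ⟨a', b', hr, hs, hk, -⟩ := key a b h
    obtain ⟨c', d', hr', hs', hk', -⟩ := key c d h'
    obtain ⟨i, hi, e⟩ := (hsup _ _ hr _).1 ((hk _).1 hw)
    obtain ⟨j, hj, e'⟩ := (hsup _ _ hr' _).1 ((hk' _).1 hw')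
    obtain ⟨x, hx⟩ := hind a' b' c' d' hr hr' (fun e => hne (by
      rw [hs, hs', (Prod.mk.inj e).1, (Prod.mk.inj e).2])) i hi j hj (e.trans e'.symm)
    exact ⟨x, Subtype.ext (e.symm.trans hx)⟩
  · rintro ⟨w, hw⟩
    rcases hv w hw with ⟨c, rfl⟩ | ⟨a, b, hr, i, hi, e⟩
    · exact .inl ⟨c, rfl⟩
    · have hab : F.Adj a b := (hF a b).2 (.inl hr)
      refine .inr ⟨a, b, hab, ?_⟩
      rw [hq1 a b hab hr, hsup]
      exact ⟨i, hi, e⟩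
  · rintro ⟨w, hw⟩ ⟨w', hw'⟩ hadj
    obtain ⟨a, b, hr, i, hi, e⟩ := he w hw w' hw' hadj
    have hab : F.Adj a b := (hF a b).2 (.inl hr)
    refine ⟨a, b, hab, ?_⟩
    rw [hq1 a b hab hr, hedge]
    exact ⟨i, hi, e⟩

/-! ### Rays with legs -/

/-- An induced ray. -/
def IsRay (G : SimpleGraph V) (P : ℕ → V) : Prop :=
  Function.Injective P ∧ ∀ i j, G.Adj (P i) (P j) ↔ (j = i + 1 ∨ i = j + 1)

/-- Disjoint induced paths with no edges between different ones. -/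
structure Legs (G : SimpleGraph V) (s : ℕ → ℕ) (f : ℕ → ℕ → V) : Prop where
  path : ∀ k, IsInducedPath G (s k) (f k)
  ne : ∀ k l, k ≠ l → ∀ i ≤ s k, ∀ j ≤ s l, f k i ≠ f l j
  nadj : ∀ k l, k ≠ l → ∀ i ≤ s k, ∀ j ≤ s l, ¬ G.Adj (f k i) (f l j)

/-- Each leg is disjoint from the ray `P`, and only its first vertex has neighbours on `P`; the
first one is `P (n k)` and the last one is `P (w k)`. -/
structure Raw (G : SimpleGraph V) (P : ℕ → V) (n w s : ℕ → ℕ) (f : ℕ → ℕ → V) : Prop where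
  ne : ∀ k, ∀ i ≤ s k, ∀ m, f k i ≠ P m
  adj : ∀ k, ∀ i ≤ s k, ∀ m, G.Adj (f k i) (P m) → i = 0 ∧ n k ≤ m ∧ m ≤ w k
  left : ∀ k, G.Adj (f k 0) (P (n k))
  right : ∀ k, G.Adj (f k 0) (P (w k))
  gap : ∀ k, w k + 1 < n (k + 1)

/-- Each leg is disjoint from the ray `P`, and only its first vertex has neighbours on `P`, which
are two consecutive vertices. -/
structure Off (G : SimpleGraph V) (P : ℕ → V) (n s : ℕ → ℕ) (f : ℕ → ℕ → V) : Prop where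
  ne : ∀ k, ∀ i ≤ s k, ∀ m, f k i ≠ P m
  adj : ∀ k, ∀ i ≤ s k, ∀ m, G.Adj (f k i) (P m) ↔ i = 0 ∧ (m = n k ∨ m = n k + 1)
  gap : ∀ k, n k + 1 < n (k + 1)

/-- The legs start on the ray `P`, and there are no other vertices of `P` or edges to `P`. -/
structure On (G : SimpleGraph V) (P : ℕ → V) (n s : ℕ → ℕ) (f : ℕ → ℕ → V) : Prop where
  eq : ∀ k, ∀ i ≤ s k, ∀ m, f k i = P m ↔ i = 0 ∧ m = n k
  adj : ∀ k, ∀ i ≤ s k, 1 ≤ i → ∀ m, G.Adj (f k i) (P m) → i = 1 ∧ m = n k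
  gap : ∀ k, n k < n (k + 1)

lemma strictMono_add_of_gap {n : ℕ → ℕ} {c : ℕ} (h : ∀ k, n k + c < n (k + 1)) {k l : ℕ}
    (hkl : k < l) : n k + c < n l := by
  induction l, hkl using Nat.le_induction with
  | base => exact h k
  | succ l _ ih => have := h l; omega

lemma gap_comp {n : ℕ → ℕ} {c : ℕ} (h : ∀ k, n k + c < n (k + 1)) {φ : ℕ → ℕ}
    (hφ : StrictMono φ) (k : ℕ) : n (φ k) + c < n (φ (k + 1)) :=
  strictMono_add_of_gap h (hφ (Nat.lt_succ_self k))

lemma Raw.le {P : ℕ → V} {n w s : ℕ → ℕ} {f : ℕ → ℕ → V} (h : Raw G P n w s f) (k : ℕ) :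
    n k ≤ w k := (h.adj k 0 (Nat.zero_le _) _ (h.left k)).2.2

lemma Raw.far {P : ℕ → V} {n w s : ℕ → ℕ} {f : ℕ → ℕ → V} (h : Raw G P n w s f) {k l : ℕ}
    (hkl : k < l) : w k + 1 < n l := by
  induction l, hkl using Nat.le_induction with
  | base => exact h.gap k
  | succ l _ ih => have := h.gap l; have := h.le l; omega

lemma Legs.comp {s : ℕ → ℕ} {f : ℕ → ℕ → V} (h : Legs G s f) {φ : ℕ → ℕ} (hφ : StrictMono φ) :
    Legs G (fun k => s (φ k)) (fun k => f (φ k)) :=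
  ⟨fun _ => h.path _, fun _ _ hkl => h.ne _ _ (hφ.injective.ne hkl),
    fun _ _ hkl => h.nadj _ _ (hφ.injective.ne hkl)⟩

lemma Raw.comp {P : ℕ → V} {n w s : ℕ → ℕ} {f : ℕ → ℕ → V} (h : Raw G P n w s f) {φ : ℕ → ℕ}
    (hφ : StrictMono φ) :
    Raw G P (fun k => n (φ k)) (fun k => w (φ k)) (fun k => s (φ k)) (fun k => f (φ k)) :=
  ⟨fun _ => h.ne _, fun _ => h.adj _, fun _ => h.left _, fun _ => h.right _, fun k => by
    have := h.far (hφ (Nat.lt_succ_self k)); exact this⟩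

/-- Any attachment of the next leg bounds the attachments of the present one, so there is a last
attachment as well as a first. -/
lemma exists_raw {P : ℕ → V} {s : ℕ → ℕ} {f : ℕ → ℕ → V}
    (hne : ∀ k, ∀ i ≤ s k, ∀ m, f k i ≠ P m)
    (hadj : ∀ k, ∀ i ≤ s k, ∀ m, G.Adj (f k i) (P m) → i = 0)
    (hex : ∀ k, ∃ m, G.Adj (f k 0) (P m))
    (hgap : ∀ k m m', G.Adj (f k 0) (P m) → G.Adj (f (k + 1) 0) (P m') → m + 1 < m') :
    ∃ n w, Raw G P n w s f := by
  classical
  have hmax : ∀ k, ∃ w, G.Adj (f k 0) (P w) ∧ ∀ m, G.Adj (f k 0) (P m) → m ≤ w := by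
    intro k
    obtain ⟨m', hm'⟩ := hex (k + 1)
    have hb : ∀ m, G.Adj (f k 0) (P m) → m ≤ m' := fun m hm => by
      have := hgap k m m' hm hm'; omega
    obtain ⟨m, hm⟩ := hex k
    exact ⟨Nat.findGreatest (fun m => G.Adj (f k 0) (P m)) m',
      Nat.findGreatest_spec (P := fun m => G.Adj (f k 0) (P m)) (hb m hm) hm,
      fun a ha => Nat.le_findGreatest (hb a ha) ha⟩
  choose w hw hw' using hmax
  refine ⟨fun k => Nat.find (hex k), w, hne, fun k i hi m e => ?_, fun k => Nat.find_spec (hex k),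
    hw, fun k => hgap k _ _ (hw k) (Nat.find_spec (hex (k + 1)))⟩
  obtain rfl := hadj k i hi m e
  exact ⟨rfl, Nat.find_min' _ e, hw' k m e⟩

lemma Off.comp {P : ℕ → V} {n s : ℕ → ℕ} {f : ℕ → ℕ → V} (h : Off G P n s f) {φ : ℕ → ℕ}
    (hφ : StrictMono φ) : Off G P (fun k => n (φ k)) (fun k => s (φ k)) (fun k => f (φ k)) :=
  ⟨fun _ => h.ne _, fun _ => h.adj _, gap_comp h.gap hφ⟩

lemma On.comp {P : ℕ → V} {n s : ℕ → ℕ} {f : ℕ → ℕ → V} (h : On G P n s f) {φ : ℕ → ℕ}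
    (hφ : StrictMono φ) : On G P (fun k => n (φ k)) (fun k => s (φ k)) (fun k => f (φ k)) :=
  ⟨fun _ => h.eq _, fun _ => h.adj _, gap_comp (c := 0) h.gap hφ⟩

/-- The sequence that starts with `a` and continues with `f`. -/
def consFn (a : V) (f : ℕ → V) : ℕ → V := fun i => Nat.casesOn i a f

@[simp] lemma consFn_zero (a : V) (f : ℕ → V) : consFn a f 0 = a := rfl

@[simp] lemma consFn_succ (a : V) (f : ℕ → V) (i : ℕ) : consFn a f (i + 1) = f i := rfl

/-- Legs with one neighbour on the ray are extended to the ray. -/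
lemma Raw.on_consFn {P : ℕ → V} {n w s : ℕ → ℕ} {f : ℕ → ℕ → V} (hP : IsRay G P)
    (hL : Legs G s f) (h : Raw G P n w s f) (hw : ∀ k, w k = n k) :
    On G P n (fun k => s k + 1) (fun k => consFn (P (n k)) (f k)) ∧
      Legs G (fun k => s k + 1) (fun k => consFn (P (n k)) (f k)) := by
  have hadj : ∀ k, ∀ i ≤ s k, ∀ m, G.Adj (f k i) (P m) → i = 0 ∧ m = n k := by
    intro k i hi m hm
    have := h.adj k i hi m hm
    have := hw k
    omega
  have hfar' : ∀ k l, k ≠ l → n l ≠ n k ∧ n l ≠ n k + 1 ∧ n k ≠ n l + 1 := by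
    intro k l hkl
    have := hw k
    have := hw l
    rcases lt_or_gt_of_ne hkl with h' | h'
    · have := h.far h'; omega
    · have := h.far h'; omega
  refine ⟨⟨?_, ?_, fun k => by have := h.gap k; have := hw k; omega⟩, ?_, ?_, ?_⟩
  · rintro k (_ | i) hi m
    · simpa using ⟨fun e => (hP.1 e).symm, fun e => by rw [e]⟩
    · simpa using h.ne _ i (by omega) m
  · rintro k (_ | i) hi h1 m hm
    · omega
    · obtain ⟨rfl, rfl⟩ := hadj k i (by omega) m hm
      exact ⟨rfl, rfl⟩
  · intro k
    refine ⟨?_, ?_⟩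
    · rintro (_ | i) hi (_ | j) hj e
      · rfl
      · exact absurd e.symm (h.ne _ j (by omega) _)
      · exact absurd e (h.ne _ i (by omega) _)
      · rw [(hL.path k).1 i (by omega) j (by omega) e]
    · rintro (_ | i) hi (_ | j) hj
      · simp
      · simp only [consFn_zero, consFn_succ]
        constructor
        · intro e; left; rw [(hadj k j (by omega) _ e.symm).1]
        · rintro (e | e)
          · obtain rfl : j = 0 := by omega
            exact (h.left k).symm
          · omega
      · simp only [consFn_zero, consFn_succ]
        constructor
        · intro e; right; rw [(hadj k i (by omega) _ e).1]
        · rintro (e | e)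
          · omega
          · obtain rfl : i = 0 := by omega
            exact h.left k
      · simp only [consFn_succ]
        rw [(hL.path k).2 i (by omega) j (by omega)]
        omega
  · rintro k l hkl (_ | i) hi (_ | j) hj
    · exact fun e => (hfar' k l hkl).1 (hP.1 e).symm
    · exact fun e => h.ne _ j (by omega) _ e.symm
    · exact h.ne _ i (by omega) _
    · exact hL.ne _ _ hkl i (by omega) j (by omega)
  · rintro k l hkl (_ | i) hi (_ | j) hj
    · simp only [consFn_zero, hP.2]
      have := hfar' k l hkl
      omega
    · exact fun e => (hfar' k l hkl).1 (hadj l j (by omega) _ e.symm).2.symm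
    · exact fun e => (hfar' k l hkl).1 (hadj k i (by omega) _ e).2
    · exact hL.nadj _ _ hkl i (by omega) j (by omega)

lemma Raw.off {P : ℕ → V} {n w s : ℕ → ℕ} {f : ℕ → ℕ → V} (h : Raw G P n w s f)
    (hw : ∀ k, w k = n k + 1) : Off G P n s f := by
  refine ⟨h.ne, fun k i hi m => ⟨fun hm => ?_, ?_⟩, fun k => ?_⟩
  · have := h.adj k i hi m hm
    have := hw k
    omega
  · rintro ⟨rfl, rfl | rfl⟩
    exacts [h.left k, hw k ▸ h.right k]
  · have := h.gap k
    have := hw k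
    omega

/-- A ray obtained from a sequence by skipping terms. -/
lemma exists_isRay_of_subset {g : ℕ → V} {T : Set ℕ} (hT : T.Infinite) (hg : InjOn g T)
    (hadj : ∀ a ∈ T, ∀ b ∈ T, a < b → (G.Adj (g a) (g b) ↔ ∀ c ∈ T, a < c → b ≤ c)) :
    ∃ e : ℕ → ℕ, StrictMono e ∧ range e = T ∧ IsRay G (g ∘ e) := by
  classical
  have : Infinite T := hT.to_subtype
  set e := Nat.orderEmbeddingOfSet T with he
  have hr : range e = T := Nat.orderEmbeddingOfSet_range T
  have hmem : ∀ i, e i ∈ T := fun i => hr ▸ mem_range_self i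
  have key : ∀ i j, i < j → (G.Adj (g (e i)) (g (e j)) ↔ j = i + 1) := by
    intro i j hij
    rw [hadj _ (hmem i) _ (hmem j) (e.strictMono hij)]
    constructor
    · intro h
      have := e.le_iff_le.1 (h _ (hmem (i + 1)) (e.strictMono (Nat.lt_succ_self i)))
      omega
    · rintro rfl c hc hlt
      rw [← hr] at hc
      obtain ⟨l, rfl⟩ := hc
      exact e.monotone (e.lt_iff_lt.1 hlt)
  refine ⟨e, e.strictMono, hr, fun i j h => e.injective (hg (hmem i) (hmem j) h), fun i j => ?_⟩
  rcases lt_trichotomy i j with h | rfl | h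
  · simp only [Function.comp, key i j h]
    omega
  · simp
  · simp only [Function.comp]
    rw [G.adj_comm, key j i h]
    omega

/-- Rerouting a ray through the first vertices of the legs. -/
lemma Raw.reroute {P : ℕ → V} {n w s : ℕ → ℕ} {f : ℕ → ℕ → V} (hP : IsRay G P)
    (hL : Legs G s f) (h : Raw G P n w s f) (hw : ∀ k, n k + 2 ≤ w k) :
    ∃ n' P', IsRay G P' ∧ On G P' n' s f ∧
      ∀ m, (∃ i, P' m = P i) ∨ ∃ k, m = n' k ∧ P' m = f k 0 := by
  classical
  -- The positions strictly between `n k` and `w k` are given up, except `n k + 1`, which is kept as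
  -- the place for the vertex `f k 0`.
  set T : Set ℕ := {m | ∀ k, m ≤ n k + 1 ∨ w k ≤ m} with hT
  have hsep : ∀ k l, k ≠ l → w k + 1 < n l ∨ w l + 1 < n k := by
    intro k l hkl
    rcases lt_or_gt_of_ne hkl with h' | h'
    exacts [.inl (h.far h'), .inr (h.far h')]
  have hTn : ∀ k, n k ∈ T ∧ n k + 1 ∈ T ∧ w k ∈ T := by
    intro k
    refine ⟨fun l => ?_, fun l => ?_, fun l => ?_⟩ <;>
    · have := h.le k
      have := h.le l
      by_cases hkl : k = l
      · subst hkl; omega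
      · have := hsep k l hkl
        omega
  set g : ℕ → V := fun m => if hm : ∃ k, m = n k + 1 then f hm.choose 0 else P m with hg
  have hcen : ∀ k, g (n k + 1) = f k 0 := by
    intro k
    have hex : ∃ l, n k + 1 = n l + 1 := ⟨k, rfl⟩
    have h3 := hex.choose_spec
    have : hex.choose = k := by
      by_contra hne
      have := hsep _ _ hne
      have := h.le k
      have := h.le hex.choose
      omega
    simp only [hg]
    rw [dif_pos hex, this]
  have hcase : ∀ m, (∃ k, m = n k + 1 ∧ g m = f k 0) ∨
      ((∀ k, m ≠ n k + 1) ∧ g m = P m) := by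
    intro m
    by_cases hm : ∃ k, m = n k + 1
    · obtain ⟨k, rfl⟩ := hm
      exact .inl ⟨k, rfl, hcen k⟩
    · refine .inr ⟨fun k e => hm ⟨k, e⟩, ?_⟩
      simp only [hg]
      rw [dif_neg hm]
  have hinj : Function.Injective g := by
    intro a b e
    rcases hcase a with ⟨k, rfl, ea⟩ | ⟨ha, ea⟩ <;> rcases hcase b with ⟨l, rfl, eb⟩ | ⟨hb, eb⟩
      <;> rw [ea, eb] at e
    · by_contra hne
      exact hL.ne k l (by rintro rfl; exact hne rfl) 0 (by omega) 0 (by omega) e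
    · exact absurd e (h.ne _ 0 (by omega) _)
    · exact absurd e.symm (h.ne _ 0 (by omega) _)
    · exact hP.1 e
  have hTinf : T.Infinite := by
    refine Set.infinite_of_injective_forall_mem (f := n) (StrictMono.injective
      (strictMono_nat_of_lt_succ fun k => ?_)) fun k => (hTn k).1
    have := h.gap k
    have := h.le k
    omega
  -- Adjacency is compared with consecutiveness in `T`: the neighbours of `f k 0` at kept positions
  -- are just `P (n k)` and `P (w k)`, and all its other neighbours on `P` lie in the part given up.
  have hadj : ∀ a ∈ T, ∀ b ∈ T, a < b → (G.Adj (g a) (g b) ↔ ∀ c ∈ T, a < c → b ≤ c) := by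
    intro a ha b hb hab
    rcases hcase a with ⟨k, rfl, ea⟩ | ⟨ha', ea⟩ <;>
      rcases hcase b with ⟨l, rfl, eb⟩ | ⟨hb', eb⟩ <;> rw [ea, eb]
    · have hkl : k ≠ l := by rintro rfl; omega
      refine iff_of_false (hL.nadj k l hkl 0 (by omega) 0 (by omega)) fun hc => ?_
      have := hc (w k) (hTn k).2.2 (by have := hw k; omega)
      have := hsep k l hkl
      have := h.le l
      omega
    · have hbw : w k ≤ b := by have := hb k; omega
      constructor
      · intro e c hc hlt
        have := (h.adj k 0 (by omega) _ e).2.2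
        have := hc k
        omega
      · intro hc
        have := hc (w k) (hTn k).2.2 (by have := hw k; omega)
        obtain rfl : b = w k := by omega
        exact h.right k
    · constructor
      · intro e c hc hlt
        have := (h.adj l 0 (by omega) _ e.symm).2.1
        omega
      · intro hc
        have : n l ≤ a := by
          by_contra hlt
          have := hc (n l) (hTn l).1 (by omega)
          omega
        obtain rfl : a = n l := by omega
        exact (h.left l).symm
    · rw [hP.2]
      constructor
      · intro e c hc hlt
        omega
      · intro hc
        left
        by_contra hne
        have hmem : a + 1 ∈ T := by
          intro k
          have := ha k
          have := ha' k
          omega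
        have := hc _ hmem (by omega)
        omega
  obtain ⟨e, he, her, hray⟩ := exists_isRay_of_subset hTinf hinj.injOn hadj
  have hex : ∀ k, ∃ m, e m = n k + 1 := fun k => by
    have := (hTn k).2.1
    rwa [← her] at this
  choose n' hn' using hex
  refine ⟨n', g ∘ e, hray, ⟨fun k i hi m => ?_, fun k i hi h1 m e' => ?_, fun k => ?_⟩,
    fun m => ?_⟩
  · constructor
    · intro e'
      rcases hcase (e m) with ⟨l, hl, em⟩ | ⟨hm, em⟩ <;> rw [Function.comp, em] at e'
      · by_cases hkl : k = l
        · subst hkl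
          exact ⟨(hL.path _).1 i hi 0 (by omega) e', he.injective (hl.trans (hn' k).symm)⟩
        · exact absurd e' (hL.ne _ _ hkl i hi 0 (by omega))
      · exact absurd e' (h.ne _ i hi _)
    · rintro ⟨rfl, rfl⟩
      rw [Function.comp, hn', hcen]
  · rcases hcase (e m) with ⟨l, hl, em⟩ | ⟨hm, em⟩ <;> rw [Function.comp, em] at e'
    · by_cases hkl : k = l
      · subst hkl
        have := ((hL.path _).2 i hi 0 (by omega)).1 e'
        exact ⟨by omega, he.injective (hl.trans (hn' k).symm)⟩
      · exact absurd e' (hL.nadj _ _ hkl i hi 0 (by omega))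
    · have := h.adj _ i hi _ e'
      omega
  · rw [← he.lt_iff_lt, hn', hn']
    have := h.gap k
    have := h.le k
    omega
  · rcases hcase (e m) with ⟨l, hl, em⟩ | ⟨hm, em⟩
    exacts [.inr ⟨l, he.injective (hl.trans (hn' l).symm), em⟩, .inl ⟨_, em⟩]

/-- Rerouting a ray through the first vertices of legs, or extending the legs to the ray, or
passing to a subsequence, gives legs of one of the forms `On` and `Off`. -/
lemma Raw.normalize {P : ℕ → V} {n w s : ℕ → ℕ} {f : ℕ → ℕ → V} (hP : IsRay G P)
    (hL : Legs G s f) (h : Raw G P n w s f) : ∃ φ : ℕ → ℕ, StrictMono φ ∧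
    ((∃ n', On G P n' (fun k => s (φ k) + 1) (fun k => consFn (P (n' k)) (f (φ k))) ∧
        Legs G (fun k => s (φ k) + 1) (fun k => consFn (P (n' k)) (f (φ k)))) ∨
      (∃ n', Off G P n' (fun k => s (φ k)) (fun k => f (φ k))) ∨
      (∃ n' P', IsRay G P' ∧ On G P' n' (fun k => s (φ k)) (fun k => f (φ k)) ∧
        ∀ m, (∃ i, P' m = P i) ∨ ∃ k, m = n' k ∧ P' m = f (φ k) 0)) := by
  -- One of the three shapes of the span occurs infinitely often, and all other legs are dropped.
  have htri : ∀ k, w k = n k ∨ (w k = n k + 1 ∨ n k + 2 ≤ w k) := fun k => by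
    have := h.le k
    omega
  rcases exists_subseq_or htri with ⟨φ, hφ, h1⟩ | ⟨φ, hφ, h1⟩
  · exact ⟨φ, hφ, .inl ⟨_, (h.comp hφ).on_consFn hP (hL.comp hφ) h1⟩⟩
  rcases exists_subseq_or h1 with ⟨ψ, hψ, h2⟩ | ⟨ψ, hψ, h2⟩
  · exact ⟨φ ∘ ψ, hφ.comp hψ, .inr (.inl ⟨_, (h.comp (hφ.comp hψ)).off h2⟩)⟩
  · exact ⟨φ ∘ ψ, hφ.comp hψ, .inr (.inr ((h.comp (hφ.comp hψ)).reroute hP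
      (hL.comp (hφ.comp hψ)) h2))⟩

lemma exists_index_of_le {n : ℕ → ℕ} (h : ∀ k, n k < n (k + 1)) {m : ℕ} (hm : n 0 ≤ m) :
    ∃ k, n k ≤ m ∧ m < n (k + 1) := by
  have hmono : StrictMono n := strictMono_nat_of_lt_succ h
  have hex : ∃ k, m < n (k + 1) := ⟨m, (hmono.id_le (m + 1)).trans_lt' (Nat.lt_succ_self m)⟩
  classical
  refine ⟨Nat.find hex, ?_, Nat.find_spec hex⟩
  rcases Nat.eq_zero_or_pos (Nat.find hex) with h0 | h0
  · rwa [h0]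
  · have := Nat.find_min hex (m := Nat.find hex - 1) (by omega)
    rw [show Nat.find hex - 1 + 1 = Nat.find hex by omega] at this
    omega

lemma IsRay.link {R : ℕ → V} (hR : IsRay G R) {S : Set V} {a t : ℕ}
    (h : ∀ i ≤ t, R (a + i) ∈ S) : IsLink G S t (fun i => R (a + i)) :=
  ⟨h, fun i _ => (hR.2 _ _).2 (.inl (by omega))⟩

/-! ### Infinite fans -/

/-- The relation that orients the edges of the infinite fan. -/
def fanRel (x y : Option ℕ) : Prop :=
  (x = none ∧ ∃ i, y = some i) ∨ (∃ i, x = some i ∧ y = some (i + 1))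

/-- The branch vertices are `v` and the feet `R (n k)`. Feet may be consecutive on the ray and legs
may be single vertices, so `hna` excludes only edges away from the feet; edges at the feet are
governed by `hon`. -/
lemma exists_fan {v : V} {R : ℕ → V} {n s : ℕ → ℕ} {f : ℕ → ℕ → V} (hR : IsRay G R)
    (hvR : ∀ m, v ≠ R m) (hvf : ∀ k, ∀ i ≤ s k, f k i ≠ v)
    (hpath : ∀ k, IsInducedPath G (s k) (f k))
    (hne : ∀ k l, k ≠ l → ∀ i ≤ s k, ∀ j ≤ s l, f k i ≠ f l j)
    (hna : ∀ k l, k ≠ l → ∀ i ≤ s k, ∀ j ≤ s l, 1 ≤ i → 1 ≤ j → ¬ G.Adj (f k i) (f l j))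
    (hon : On G R n s f) (hv : ∀ k, ∀ i ≤ s k, G.Adj v (f k i) ↔ i = s k)
    (hvR' : ∀ m, G.Adj v (R m) → ∃ k, m = n k ∧ s k = 0) :
    ∃ S : Set V, IsFan (G.induce S) := by
  -- The ray is cut at its first foot, since the rim must begin with a branch vertex.
  set S : Set V := {w | w = v ∨ (∃ m, n 0 ≤ m ∧ R m = w) ∨ ∃ k, ∃ i ≤ s k, f k i = w} with hS
  have hmono : StrictMono n := strictMono_nat_of_lt_succ hon.gap
  have hf0 : ∀ k, f k 0 = R (n k) := fun k => (hon.eq k 0 (by omega) _).2 ⟨rfl, rfl⟩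
  set br : Option ℕ → V := fun x => x.elim v (fun i => R (n i)) with hbr
  have bn : br none = v := rfl
  have bs : ∀ k, br (some k) = R (n k) := fun k => rfl
  set l : Option ℕ → Option ℕ → ℕ := fun x y =>
    x.elim (y.elim 0 fun k => s k + 1) (fun k => n (k + 1) - n k) with hl
  -- A spoke is oriented from the apex to the rim, so it runs through its leg backwards.
  set g : Option ℕ → Option ℕ → ℕ → V := fun x y =>
    x.elim (y.elim (fun _ => v) fun k => consFn v (fun i => f k (s k - i)))
      (fun k i => R (n k + i)) with hg
  have ls : ∀ k, l none (some k) = s k + 1 := fun k => rfl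
  have lr : ∀ k y, l (some k) y = n (k + 1) - n k := fun k y => rfl
  have gs : ∀ k, g none (some k) = consFn v (fun i => f k (s k - i)) := fun k => rfl
  have gr : ∀ k y i, g (some k) y i = R (n k + i) := fun k y i => rfl
  have hgap := hon.gap
  have hbranch : ∀ k, ∀ i ≤ s k, ∀ c, f k i = br c → c = some k ∧ i = 0 := by
    rintro k i hi (_ | c) e
    · exact absurd e (hvf k i hi)
    · rw [bs] at e
      obtain ⟨h1, h2⟩ := (hon.eq k i hi _).1 e
      exact ⟨by rw [hmono.injective h2], h1⟩
  refine ⟨S, exists_subdivision (G := G) (br := br) fanRel ?_ ?_ ?_ l g ?_ ?_ ?_ ?_ ?_ ?_ ?_ ?_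
    ?_ ?_⟩
  · intro a b
    simp only [infFan, fromRel_adj, fanRel]
    constructor
    · exact fun h => h.2
    · refine fun h => ⟨?_, h⟩
      rintro rfl
      rcases h with (⟨rfl, i, h⟩ | ⟨i, rfl, h⟩) | (⟨rfl, i, h⟩ | ⟨i, rfl, h⟩) <;> simp at h
  · rintro a b (⟨rfl, i, rfl⟩ | ⟨i, rfl, rfl⟩) (⟨h, j, h'⟩ | ⟨j, h, h'⟩) <;>
      simp only [reduceCtorEq, Option.some.injEq] at h h'
    omega
  · rintro (_ | a) (_ | b) h
    · rfl
    · exact absurd h (hvR _)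
    · exact absurd h.symm (hvR _)
    · rw [hmono.injective (hR.1 h)]
  · rintro a b (⟨rfl, i, rfl⟩ | ⟨i, rfl, rfl⟩)
    · rfl
    · simp [gr, bs]
  · rintro a b (⟨rfl, k, rfl⟩ | ⟨k, rfl, rfl⟩)
    · rw [ls, gs, bs]; simp [hf0]
    · have := hgap k
      rw [lr, gr, bs, show n k + (n (k + 1) - n k) = n (k + 1) by omega]
  · rintro a b (⟨rfl, k, rfl⟩ | ⟨k, rfl, rfl⟩)
    · rw [ls, gs]
      refine ⟨?_, ?_⟩
      · rintro (_ | i) hi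
        · exact .inl rfl
        · exact .inr (.inr ⟨k, _, Nat.sub_le _ _, rfl⟩)
      · rintro (_ | i) hi
        · exact (hv k _ (Nat.sub_le _ _)).2 (Nat.sub_zero _)
        · simp only [consFn_succ]
          exact ((hpath k).2 _ (by omega) _ (by omega)).2 (.inr (by omega))
    · refine hR.link fun i _ => .inr (.inl ⟨_, ?_, rfl⟩)
      have := hmono.monotone (Nat.zero_le k)
      omega
  · rintro a b (⟨rfl, k, rfl⟩ | ⟨k, rfl, rfl⟩)
    · rw [ls, gs]
      rintro (_ | i) hi (_ | j) hj e
      · rfl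
      · exact absurd e.symm (hvf k _ (Nat.sub_le _ _))
      · exact absurd e (hvf k _ (Nat.sub_le _ _))
      · have := (hpath k).1 _ (Nat.sub_le _ _) _ (Nat.sub_le _ _) e
        omega
    · intro i _ j _ e
      rw [gr, gr] at e
      have := hR.1 e
      omega
  · exact fun a b _ h => absurd (mem_univ _) h
  · rintro a b (⟨rfl, k, rfl⟩ | ⟨k, rfl, rfl⟩)
    · rw [ls, gs]
      rintro (_ | i) hi c e
      · rcases c with _ | c
        · exact .inl rfl
        · exact absurd e (hvR _)
      · exact .inr (hbranch k _ (Nat.sub_le _ _) c e).1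
    · rintro i hi (_ | c) e
      · exact absurd e.symm (hvR _)
      · rw [gr, bs] at e
        rw [lr] at hi
        have h1 := hR.1 e
        have h2 := hgap k
        have h3 : k ≤ c := by rw [← hmono.le_iff_le]; omega
        have h4 : c ≤ k + 1 := by rw [← hmono.le_iff_le]; omega
        rcases Nat.eq_or_lt_of_le h3 with h | h
        · exact .inl (by rw [h])
        · exact .inr (by rw [show c = k + 1 by omega])
  · have hsr : ∀ k k', ∀ i ≤ l none (some k), ∀ j, g none (some k) i = g (some k') (some (k' + 1)) j →
        ∃ x, g none (some k) i = br x := by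
      intro k k' i hi j e
      rcases i with _ | i
      · exact ⟨none, rfl⟩
      · rw [gr] at e
        obtain ⟨h1, h2⟩ := (hon.eq k _ (Nat.sub_le _ _) _).1 e
        exact ⟨some k, by rw [e, h2, bs]⟩
    rintro a b c d (⟨rfl, k, rfl⟩ | ⟨k, rfl, rfl⟩) (⟨rfl, k', rfl⟩ | ⟨k', rfl, rfl⟩) hneq i hi j hj e
    · rcases i with _ | i
      · exact ⟨none, rfl⟩
      · rcases j with _ | j
        · exact absurd e (hvf k _ (Nat.sub_le _ _))
        · refine absurd e (hne k k' ?_ _ (Nat.sub_le _ _) _ (Nat.sub_le _ _))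
          rintro rfl
          exact hneq rfl
    · exact hsr k k' i hi j e
    · rw [e]
      exact hsr k' k j hj i e.symm
    · rw [gr, gr] at e
      rw [lr] at hi hj
      have h1 := hR.1 e
      have h2 := hgap k
      have h2' := hgap k'
      rcases lt_trichotomy k k' with h | h | h
      · have h3 := hmono.monotone (show k + 1 ≤ k' from h)
        exact ⟨some (k + 1), by rw [gr, bs, show n k + i = n (k + 1) by omega]⟩
      · subst h; exact absurd rfl hneq
      · have h3 := hmono.monotone (show k' + 1 ≤ k from h)
        exact ⟨some k, by rw [gr, bs, show n k + i = n k by omega]⟩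
  · rintro (_ | k)
    · exact .inl rfl
    · exact .inr (.inl ⟨n k, hmono.monotone (Nat.zero_le k), rfl⟩)
  · rintro w (rfl | ⟨m, hm, rfl⟩ | ⟨k, i, hi, rfl⟩)
    · exact .inl ⟨none, rfl⟩
    · obtain ⟨k, hk1, hk2⟩ := exists_index_of_le hgap hm
      refine .inr ⟨some k, some (k + 1), .inr ⟨k, rfl, rfl⟩, m - n k, ?_, ?_⟩
      · rw [lr]; omega
      · rw [gr, show n k + (m - n k) = m by omega]
    · refine .inr ⟨none, some k, .inl ⟨rfl, k, rfl⟩, s k - i + 1, ?_, ?_⟩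
      · rw [ls]; omega
      · rw [gs, consFn_succ, show s k - (s k - i) = i by omega]
  · have hrr : ∀ m m', n 0 ≤ m → m' = m + 1 → ∃ a b, fanRel a b ∧ ∃ i < l a b,
        g a b i = R m ∧ g a b (i + 1) = R m' := by
      rintro m m' hm rfl
      obtain ⟨k, hk1, hk2⟩ := exists_index_of_le hgap hm
      refine ⟨some k, some (k + 1), .inr ⟨k, rfl, rfl⟩, m - n k, ?_, ?_, ?_⟩
      · rw [lr]; omega
      · rw [gr, show n k + (m - n k) = m by omega]
      · rw [gr, show n k + (m - n k + 1) = m + 1 by omega]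
    have hff : ∀ k i, i + 1 ≤ s k → ∃ a b, fanRel a b ∧ ∃ j < l a b,
        g a b j = f k (i + 1) ∧ g a b (j + 1) = f k i := by
      intro k i hi
      refine ⟨none, some k, .inl ⟨rfl, k, rfl⟩, s k - (i + 1) + 1, ?_, ?_, ?_⟩
      · rw [ls]; omega
      · rw [gs, consFn_succ, show s k - (s k - (i + 1)) = i + 1 by omega]
      · rw [gs, consFn_succ, show s k - (s k - (i + 1) + 1) = i by omega]
    have hvs : ∀ k, ∃ a b, fanRel a b ∧ ∃ j < l a b,
        g a b j = v ∧ g a b (j + 1) = f k (s k) :=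
      fun k => ⟨none, some k, .inl ⟨rfl, k, rfl⟩, 0, by rw [ls]; omega, rfl, rfl⟩
    have fwd : ∀ {w w' : V}, (∃ a b, fanRel a b ∧ ∃ i < l a b,
        g a b i = w ∧ g a b (i + 1) = w') → ∃ a b, fanRel a b ∧ ∃ i < l a b,
        (g a b i = w ∧ g a b (i + 1) = w') ∨ (g a b i = w' ∧ g a b (i + 1) = w) := by
      rintro w w' ⟨a, b, h1, i, h2, h3⟩
      exact ⟨a, b, h1, i, h2, .inl h3⟩
    have bwd : ∀ {w w' : V}, (∃ a b, fanRel a b ∧ ∃ i < l a b,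
        g a b i = w' ∧ g a b (i + 1) = w) → ∃ a b, fanRel a b ∧ ∃ i < l a b,
        (g a b i = w ∧ g a b (i + 1) = w') ∨ (g a b i = w' ∧ g a b (i + 1) = w) := by
      rintro w w' ⟨a, b, h1, i, h2, h3⟩
      exact ⟨a, b, h1, i, h2, .inr h3⟩
    have hvf' : ∀ k i, i ≤ s k → G.Adj v (f k i) → ∃ a b, fanRel a b ∧ ∃ j < l a b,
        g a b j = v ∧ g a b (j + 1) = f k i := by
      intro k i hi e
      rw [(hv k i hi).1 e]
      exact hvs k
    have hvm : ∀ m, G.Adj v (R m) → ∃ a b, fanRel a b ∧ ∃ j < l a b,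
        g a b j = v ∧ g a b (j + 1) = R m := by
      intro m e
      obtain ⟨k, rfl, hk⟩ := hvR' m e
      rw [← hf0]
      have := hvs k
      rwa [hk] at this
    have hrf : ∀ m k i, n 0 ≤ m → i ≤ s k → G.Adj (R m) (f k i) →
        ∃ a b, fanRel a b ∧ ∃ j < l a b, (g a b j = R m ∧ g a b (j + 1) = f k i) ∨
          (g a b j = f k i ∧ g a b (j + 1) = R m) := by
      intro m k i hm hi e
      rcases Nat.eq_zero_or_pos i with rfl | hi0
      · have hk := hmono.monotone (Nat.zero_le k)
        rw [hf0, hR.2] at e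
        rw [hf0]
        rcases e with e | e
        · exact fwd (hrr m _ hm e)
        · exact bwd (hrr _ _ hk e)
      · obtain ⟨rfl, rfl⟩ := hon.adj k i hi hi0 m e.symm
        rw [← hf0]
        exact bwd (hff k 0 hi)
    rintro w (rfl | ⟨m, hm, rfl⟩ | ⟨k, i, hi, rfl⟩) w' (rfl | ⟨m', hm', rfl⟩ | ⟨k', i', hi', rfl⟩) e
    · exact absurd e G.irrefl
    · exact fwd (hvm _ e)
    · exact fwd (hvf' _ _ hi' e)
    · exact bwd (hvm _ e.symm)
    · rcases (hR.2 _ _).1 e with e | e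
      · exact fwd (hrr _ _ hm e)
      · exact bwd (hrr _ _ hm' e)
    · exact hrf m k' i' hm hi' e
    · exact bwd (hvf' _ _ hi e.symm)
    · obtain ⟨a, b, h1, j, h2, h3⟩ := hrf m' k i hm' hi e.symm
      exact ⟨a, b, h1, j, h2, h3.symm⟩
    · by_cases hkk : k = k'
      · subst hkk
        rcases ((hpath k).2 i hi i' hi').1 e with rfl | rfl
        · exact bwd (hff k i hi')
        · exact fwd (hff k i' hi)
      · rcases Nat.eq_zero_or_pos i with rfl | hi0
        · rw [hf0] at e ⊢
          exact hrf _ k' i' (hmono.monotone (Nat.zero_le k)) hi' e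
        · rcases Nat.eq_zero_or_pos i' with rfl | hi0'
          · rw [hf0] at e ⊢
            obtain ⟨a, b, h1, j, h2, h3⟩ :=
              hrf _ k i (hmono.monotone (Nat.zero_le k')) hi e.symm
            exact ⟨a, b, h1, j, h2, h3.symm⟩
          · exact absurd e (hna k k' hkk i hi i' hi' hi0 hi0')

/-! ### Infinite `Δ`-fans -/

/-- The relation that orients the edges of the infinite `Δ`-fan. -/
def deltaFanRel (x y : DeltaFanVertex) : Prop :=
  (x = .apex ∧ ∃ i, y = .mid i) ∨
    (∃ i, x = .mid i ∧ (y = .rim (2 * i) ∨ y = .rim (2 * i + 1))) ∨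
    (∃ k, x = .rim k ∧ y = .rim (k + 1))

/-- The first vertex of each leg forms a triangle with its two consecutive neighbours on the ray.
The rest of the leg subdivides the edge to the apex, and the ray between two triangles subdivides a
free rim edge. -/
lemma exists_deltaFan {v : V} {R : ℕ → V} {n s : ℕ → ℕ} {f : ℕ → ℕ → V} (hR : IsRay G R)
    (hvR : ∀ m, v ≠ R m) (hvf : ∀ k, ∀ i ≤ s k, f k i ≠ v) (hL : Legs G s f)
    (hoff : Off G R n s f) (hv : ∀ k, ∀ i ≤ s k, G.Adj v (f k i) ↔ i = s k)
    (hvR' : ∀ m, ¬ G.Adj v (R m)) :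
    ∃ S : Set V, IsDeltaFan (G.induce S) := by
  set S : Set V := {w | w = v ∨ (∃ m, n 0 ≤ m ∧ R m = w) ∨ ∃ k, ∃ i ≤ s k, f k i = w} with hS
  -- Positions of the rim branch vertices: the `k`-th triangle uses `n k` and `n k + 1`, numbered `2
  -- * k` and `2 * k + 1`.
  set ρ : ℕ → ℕ := fun j => n (j / 2) + j % 2 with hρ
  have ρ0 : ∀ k, ρ (2 * k) = n k := fun k => by simp [hρ]
  have ρ1 : ∀ k, ρ (2 * k + 1) = n k + 1 := fun k => by
    simp only [hρ]
    rw [show (2 * k + 1) / 2 = k by omega, show (2 * k + 1) % 2 = 1 by omega]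
  have hgap : ∀ j, ρ j < ρ (j + 1) := by
    intro j
    rcases Nat.even_or_odd' j with ⟨k, rfl | rfl⟩
    · rw [ρ0, ρ1]; omega
    · rw [ρ1, show 2 * k + 1 + 1 = 2 * (k + 1) by ring, ρ0]
      exact hoff.gap k
  have hmono : StrictMono ρ := strictMono_nat_of_lt_succ hgap
  have hρ00 : ρ 0 = n 0 := ρ0 0
  have hle : ∀ j, n 0 ≤ ρ j := fun j => hρ00 ▸ hmono.monotone (Nat.zero_le j)
  set br : DeltaFanVertex → V := fun x =>
    match x with
    | .apex => v
    | .mid k => f k 0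
    | .rim j => R (ρ j) with hbr
  set l : DeltaFanVertex → DeltaFanVertex → ℕ := fun x y =>
    match x, y with
    | .apex, .mid k => s k + 1
    | .rim j, .rim _ => ρ (j + 1) - ρ j
    | _, _ => 1 with hl
  set g : DeltaFanVertex → DeltaFanVertex → ℕ → V := fun x y =>
    match x, y with
    | .apex, .mid k => consFn v (fun i => f k (s k - i))
    | .rim j, .rim _ => fun i => R (ρ j + i)
    | .mid k, .rim j => consFn (f k 0) (fun _ => R (ρ j))
    | _, _ => fun _ => v with hg
  have ls : ∀ k, l .apex (.mid k) = s k + 1 := fun k => rfl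
  have lr : ∀ j j', l (.rim j) (.rim j') = ρ (j + 1) - ρ j := fun j j' => rfl
  have lm : ∀ k j, l (.mid k) (.rim j) = 1 := fun k j => rfl
  have gs : ∀ k, g .apex (.mid k) = consFn v (fun i => f k (s k - i)) := fun k => rfl
  have gr : ∀ j j' i, g (.rim j) (.rim j') i = R (ρ j + i) := fun j j' i => rfl
  have gm : ∀ k j, g (.mid k) (.rim j) = consFn (f k 0) (fun _ => R (ρ j)) := fun k j => rfl
  have hmid : ∀ k j, j = 2 * k ∨ j = 2 * k + 1 → G.Adj (f k 0) (R (ρ j)) := by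
    rintro k j (rfl | rfl)
    · exact (hoff.adj k 0 (by omega) _).2 ⟨rfl, .inl (ρ0 k)⟩
    · exact (hoff.adj k 0 (by omega) _).2 ⟨rfl, .inr (ρ1 k)⟩
  have hcases : ∀ a b, deltaFanRel a b → (∃ k, a = .apex ∧ b = .mid k) ∨
      (∃ k j, a = .mid k ∧ b = .rim j ∧ (j = 2 * k ∨ j = 2 * k + 1)) ∨
      (∃ k, a = .rim k ∧ b = .rim (k + 1)) := by
    rintro a b (⟨rfl, i, rfl⟩ | ⟨i, rfl, h⟩ | ⟨k, rfl, rfl⟩)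
    · exact .inl ⟨i, rfl, rfl⟩
    · rcases h with rfl | rfl
      · exact .inr (.inl ⟨i, _, rfl, rfl, .inl rfl⟩)
      · exact .inr (.inl ⟨i, _, rfl, rfl, .inr rfl⟩)
    · exact .inr (.inr ⟨k, rfl, rfl⟩)
  have hmr : ∀ k j, j = 2 * k ∨ j = 2 * k + 1 → deltaFanRel (.mid k) (.rim j) := by
    rintro k j (rfl | rfl)
    exacts [.inr (.inl ⟨k, rfl, .inl rfl⟩), .inr (.inl ⟨k, rfl, .inr rfl⟩)]
  have hbranch : ∀ k, ∀ i ≤ s k, ∀ c, f k i = br c → c = .mid k ∧ i = 0 := by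
    rintro k i hi (_ | c | c) e
    · exact absurd e (hvf k i hi)
    · by_cases hkc : k = c
      · subst hkc
        exact ⟨rfl, (hL.path k).1 i hi 0 (by omega) e⟩
      · exact absurd e (hL.ne k c hkc i hi 0 (by omega))
    · exact absurd e (hoff.ne k i hi _)
  refine ⟨S, exists_subdivision (G := G) (br := br) deltaFanRel ?_ ?_ ?_ l g ?_ ?_ ?_ ?_ ?_ ?_ ?_
    ?_ ?_ ?_⟩
  · intro a b
    simp only [infDeltaFan, fromRel_adj]
    constructor
    · exact fun h => h.2
    · refine fun h => ⟨?_, h⟩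
      rintro rfl
      rcases or_self_iff.1 h with h
      rcases hcases _ _ h with ⟨k, rfl, h⟩ | ⟨k, j, rfl, h, -⟩ | ⟨k, rfl, h⟩ <;> simp at h
  · intro a b h h'
    rcases hcases _ _ h with ⟨k, rfl, rfl⟩ | ⟨k, j, rfl, rfl, -⟩ | ⟨k, rfl, rfl⟩ <;>
      rcases hcases _ _ h' with ⟨k', h1, h2⟩ | ⟨k', j', h1, h2, -⟩ | ⟨k', h1, h2⟩ <;>
      simp only [reduceCtorEq, DeltaFanVertex.rim.injEq] at h1 h2
    omega
  · rintro (_ | a | a) (_ | b | b) h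
    · rfl
    · exact absurd h.symm (hvf b 0 (by omega))
    · exact absurd h (hvR _)
    · exact absurd h (hvf a 0 (by omega))
    · exact (hbranch a 0 (by omega) (.mid b) h).1.symm
    · exact absurd h (hoff.ne _ 0 (by omega) _)
    · exact absurd h.symm (hvR _)
    · exact absurd h.symm (hoff.ne _ 0 (by omega) _)
    · rw [hmono.injective (hR.1 h)]
  · intro a b h
    rcases hcases _ _ h with ⟨k, rfl, rfl⟩ | ⟨k, j, rfl, rfl, -⟩ | ⟨k, rfl, rfl⟩ <;> rfl
  · intro a b h
    rcases hcases _ _ h with ⟨k, rfl, rfl⟩ | ⟨k, j, rfl, rfl, -⟩ | ⟨k, rfl, rfl⟩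
    · rw [ls, gs]; simp [hbr]
    · rfl
    · have := hgap k
      rw [lr k (k + 1), gr k (k + 1), show ρ k + (ρ (k + 1) - ρ k) = ρ (k + 1) by omega]
  · intro a b h
    rcases hcases _ _ h with ⟨k, rfl, rfl⟩ | ⟨k, j, rfl, rfl, hkj⟩ | ⟨k, rfl, rfl⟩
    · rw [ls, gs]
      refine ⟨?_, ?_⟩
      · rintro (_ | i) hi
        · exact .inl rfl
        · exact .inr (.inr ⟨k, _, Nat.sub_le _ _, rfl⟩)
      · rintro (_ | i) hi
        · exact (hv k _ (Nat.sub_le _ _)).2 (Nat.sub_zero _)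
        · simp only [consFn_succ]
          exact ((hL.path k).2 _ (by omega) _ (by omega)).2 (.inr (by omega))
    · rw [lm k j, gm k j]
      refine ⟨?_, ?_⟩
      · rintro (_ | i) hi
        · exact .inr (.inr ⟨k, 0, by omega, rfl⟩)
        · exact .inr (.inl ⟨_, hle j, rfl⟩)
      · rintro (_ | i) hi
        · exact hmid k j hkj
        · omega
    · refine hR.link fun i _ => .inr (.inl ⟨_, ?_, rfl⟩)
      have := hle k
      omega
  · intro a b h
    rcases hcases _ _ h with ⟨k, rfl, rfl⟩ | ⟨k, j, rfl, rfl, hkj⟩ | ⟨k, rfl, rfl⟩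
    · rw [ls, gs]
      rintro (_ | i) hi (_ | j) hj e
      · rfl
      · exact absurd e.symm (hvf k _ (Nat.sub_le _ _))
      · exact absurd e (hvf k _ (Nat.sub_le _ _))
      · have := (hL.path k).1 _ (Nat.sub_le _ _) _ (Nat.sub_le _ _) e
        omega
    · rw [lm k j, gm k j]
      rintro (_ | i) hi (_ | i') hi' e
      · rfl
      · exact absurd e (hoff.ne k 0 (by omega) _)
      · exact absurd e.symm (hoff.ne k 0 (by omega) _)
      · omega
    · intro i _ j _ e
      rw [gr k (k + 1), gr k (k + 1)] at e
      have := hR.1 e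
      omega
  · intro a b h hE
    rcases hcases _ _ h with ⟨k, rfl, rfl⟩ | ⟨k, j, rfl, rfl, hkj⟩ | ⟨k, rfl, rfl⟩
    · exact absurd (.inl ⟨k, rfl⟩) hE
    · rfl
    · rcases Nat.even_or_odd' k with ⟨c, rfl | rfl⟩
      · rw [lr (2 * c) (2 * c + 1), ρ0, ρ1]; omega
      · exact absurd (.inr ⟨c, rfl⟩) hE
  · intro a b h
    rcases hcases _ _ h with ⟨k, rfl, rfl⟩ | ⟨k, j, rfl, rfl, hkj⟩ | ⟨k, rfl, rfl⟩
    · rw [ls, gs]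
      rintro (_ | i) hi c e
      · rcases c with _ | c | c
        · exact .inl rfl
        · exact absurd e.symm (hvf c 0 (by omega))
        · exact absurd e (hvR _)
      · exact .inr (hbranch k _ (Nat.sub_le _ _) c e).1
    · rw [lm k j, gm k j]
      rintro (_ | i) hi c e
      · exact .inl (hbranch k _ (by omega) c e).1
      · rcases c with _ | c | c
        · exact absurd e.symm (hvR _)
        · exact absurd e.symm (hoff.ne c 0 (by omega) _)
        · exact .inr (by rw [hmono.injective (hR.1 e)])
    · rintro i hi c e
      rcases c with _ | c | c
      · exact absurd e.symm (hvR _)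
      · exact absurd e.symm (hoff.ne c 0 (by omega) _)
      · rw [gr k (k + 1)] at e
        rw [lr k (k + 1)] at hi
        have h1 := hR.1 e
        have h2 := hgap k
        have h3 : k ≤ c := by rw [← hmono.le_iff_le]; omega
        have h4 : c ≤ k + 1 := by rw [← hmono.le_iff_le]; omega
        rcases Nat.eq_or_lt_of_le h3 with h | h
        · exact .inl (by rw [h])
        · exact .inr (by rw [show c = k + 1 by omega])
  · have hs : ∀ k i, i ≤ s k + 1 → ∀ w, (∀ c ≤ s k, f k c = w → ∃ x, w = br x) →
        g .apex (.mid k) i = w → ∃ x, w = br x := by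
      rintro k (_ | i) hi w hw e
      · exact ⟨.apex, e.symm⟩
      · exact hw _ (Nat.sub_le _ _) e
    have hm : ∀ k j i, ∃ x, g (.mid k) (.rim j) i = br x := by
      rintro k j (_ | i)
      exacts [⟨.mid k, rfl⟩, ⟨.rim j, rfl⟩]
    intro a b c d h h' hneq i hi j hj e
    rcases hcases _ _ h with ⟨k, rfl, rfl⟩ | ⟨k, p, rfl, rfl, hkj⟩ | ⟨k, rfl, rfl⟩ <;>
      rcases hcases _ _ h' with ⟨k', rfl, rfl⟩ | ⟨k', p', rfl, rfl, hkj'⟩ | ⟨k', rfl, rfl⟩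
    · refine hs k i hi _ (fun c hc ec => ?_) rfl
      rcases j with _ | j
      · exact ⟨.apex, e⟩
      · refine absurd (ec.trans e) (hL.ne k k' ?_ c hc _ (Nat.sub_le _ _))
        rintro rfl
        exact hneq rfl
    · rw [e]; exact hm _ _ _
    · refine hs k i hi _ (fun c hc ec => ?_) rfl
      exact absurd (ec.trans e) (hoff.ne k c hc _)
    · exact hm _ _ _
    · exact hm _ _ _
    · exact hm _ _ _
    · rw [e]
      refine hs k' j hj _ (fun c hc ec => ?_) rfl
      exact absurd (ec.trans e.symm) (hoff.ne k' c hc _)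
    · rw [e]; exact hm _ _ _
    · rw [gr k (k + 1), gr k' (k' + 1)] at e
      rw [lr k (k + 1)] at hi
      rw [lr k' (k' + 1)] at hj
      have h1 := hR.1 e
      have h2 := hgap k
      have h2' := hgap k'
      rcases lt_trichotomy k k' with h | h | h
      · have h3 := hmono.monotone (show k + 1 ≤ k' from h)
        exact ⟨.rim (k + 1), by rw [gr k (k + 1), show ρ k + i = ρ (k + 1) by omega]⟩
      · subst h; exact absurd rfl hneq
      · have h3 := hmono.monotone (show k' + 1 ≤ k from h)
        exact ⟨.rim k, by rw [gr k (k + 1), show ρ k + i = ρ k by omega]⟩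
  · rintro (_ | k | k)
    · exact .inl rfl
    · exact .inr (.inr ⟨k, 0, by omega, rfl⟩)
    · exact .inr (.inl ⟨ρ k, hle k, rfl⟩)
  · rintro w (rfl | ⟨m, hm, rfl⟩ | ⟨k, i, hi, rfl⟩)
    · exact .inl ⟨.apex, rfl⟩
    · obtain ⟨k, hk1, hk2⟩ := exists_index_of_le hgap (hρ00 ▸ hm)
      refine .inr ⟨.rim k, .rim (k + 1), .inr (.inr ⟨k, rfl, rfl⟩), m - ρ k, ?_, ?_⟩
      · rw [lr k (k + 1)]; omega
      · rw [gr k (k + 1), show ρ k + (m - ρ k) = m by omega]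
    · refine .inr ⟨.apex, .mid k, .inl ⟨rfl, k, rfl⟩, s k - i + 1, ?_, ?_⟩
      · rw [ls]; omega
      · rw [gs, consFn_succ, show s k - (s k - i) = i by omega]
  · have hrr : ∀ m m', n 0 ≤ m → m' = m + 1 → ∃ a b, deltaFanRel a b ∧ ∃ i < l a b,
        g a b i = R m ∧ g a b (i + 1) = R m' := by
      rintro m m' hm rfl
      obtain ⟨k, hk1, hk2⟩ := exists_index_of_le hgap (hρ00 ▸ hm)
      refine ⟨.rim k, .rim (k + 1), .inr (.inr ⟨k, rfl, rfl⟩), m - ρ k, ?_, ?_, ?_⟩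
      · rw [lr k (k + 1)]; omega
      · rw [gr k (k + 1), show ρ k + (m - ρ k) = m by omega]
      · rw [gr k (k + 1), show ρ k + (m - ρ k + 1) = m + 1 by omega]
    have hff : ∀ k i, i + 1 ≤ s k → ∃ a b, deltaFanRel a b ∧ ∃ j < l a b,
        g a b j = f k (i + 1) ∧ g a b (j + 1) = f k i := by
      intro k i hi
      refine ⟨.apex, .mid k, .inl ⟨rfl, k, rfl⟩, s k - (i + 1) + 1, ?_, ?_, ?_⟩
      · rw [ls]; omega
      · rw [gs, consFn_succ, show s k - (s k - (i + 1)) = i + 1 by omega]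
      · rw [gs, consFn_succ, show s k - (s k - (i + 1) + 1) = i by omega]
    have hvf' : ∀ k i, i ≤ s k → G.Adj v (f k i) → ∃ a b, deltaFanRel a b ∧ ∃ j < l a b,
        g a b j = v ∧ g a b (j + 1) = f k i := by
      intro k i hi e
      rw [(hv k i hi).1 e]
      exact ⟨.apex, .mid k, .inl ⟨rfl, k, rfl⟩, 0, by rw [ls]; omega, rfl, rfl⟩
    have hfr : ∀ m k i, i ≤ s k → G.Adj (f k i) (R m) → ∃ a b, deltaFanRel a b ∧ ∃ j < l a b,
        g a b j = f k i ∧ g a b (j + 1) = R m := by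
      intro m k i hi e
      obtain ⟨rfl, h⟩ := (hoff.adj k i hi m).1 e
      rcases h with rfl | rfl
      · exact ⟨.mid k, .rim (2 * k), hmr _ _ (.inl rfl), 0, Nat.zero_lt_one, rfl,
          by rw [gm k, consFn_succ, ρ0]⟩
      · exact ⟨.mid k, .rim (2 * k + 1), hmr _ _ (.inr rfl), 0, Nat.zero_lt_one, rfl,
          by rw [gm k, consFn_succ, ρ1]⟩
    have fwd : ∀ {w w' : V}, (∃ a b, deltaFanRel a b ∧ ∃ i < l a b,
        g a b i = w ∧ g a b (i + 1) = w') → ∃ a b, deltaFanRel a b ∧ ∃ i < l a b,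
        (g a b i = w ∧ g a b (i + 1) = w') ∨ (g a b i = w' ∧ g a b (i + 1) = w) := by
      rintro w w' ⟨a, b, h1, i, h2, h3⟩
      exact ⟨a, b, h1, i, h2, .inl h3⟩
    have bwd : ∀ {w w' : V}, (∃ a b, deltaFanRel a b ∧ ∃ i < l a b,
        g a b i = w' ∧ g a b (i + 1) = w) → ∃ a b, deltaFanRel a b ∧ ∃ i < l a b,
        (g a b i = w ∧ g a b (i + 1) = w') ∨ (g a b i = w' ∧ g a b (i + 1) = w) := by
      rintro w w' ⟨a, b, h1, i, h2, h3⟩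
      exact ⟨a, b, h1, i, h2, .inr h3⟩
    rintro w (rfl | ⟨m, hm, rfl⟩ | ⟨k, i, hi, rfl⟩) w' (rfl | ⟨m', hm', rfl⟩ | ⟨k', i', hi', rfl⟩) e
    · exact absurd e G.irrefl
    · exact absurd e (hvR' _)
    · exact fwd (hvf' _ _ hi' e)
    · exact absurd e.symm (hvR' _)
    · rcases (hR.2 _ _).1 e with e | e
      · exact fwd (hrr _ _ hm e)
      · exact bwd (hrr _ _ hm' e)
    · exact bwd (hfr _ _ _ hi' e.symm)
    · exact bwd (hvf' _ _ hi e.symm)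
    · exact fwd (hfr _ _ _ hi e)
    · by_cases hkk : k = k'
      · subst hkk
        rcases ((hL.path k).2 i hi i' hi').1 e with rfl | rfl
        · exact bwd (hff k i hi')
        · exact fwd (hff k i' hi)
      · exact absurd e (hL.nadj k k' hkk i hi i' hi')

/-! ### Graphs with a vertex of infinite degree -/

lemma exists_subseq_of_infinite {N : ℕ} {p : ℕ → ℕ → Prop}
    (h : {j | ∃ n ≤ N, p n j}.Infinite) : ∃ n ≤ N, ∃ φ : ℕ → ℕ, StrictMono φ ∧ ∀ k, p n (φ k) := by
  obtain ⟨n, hn, h2⟩ : ∃ n ≤ N, {j | p n j}.Infinite := by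
    by_contra hc
    push Not at hc
    refine h (((Set.finite_Iic N).biUnion fun n hn => hc n hn).subset ?_)
    rintro j ⟨n, hn, hj⟩
    exact mem_biUnion (show n ∈ Iic N from hn) hj
  exact ⟨n, hn, extraction_of_frequently_atTop (Nat.frequently_atTop_iff_infinite.2 h2)⟩

/-- The distance from `r` in `G - v`. -/
noncomputable def levelAvoiding (G : SimpleGraph V) (v : V) (r : {y | y ≠ v}) (y : V) : ℕ :=
  open Classical in if h : y ≠ v then (G.induce {y | y ≠ v}).dist r ⟨y, h⟩ else 0

lemma levelAvoiding_val {v : V} {r : {y | y ≠ v}} (y : {y | y ≠ v}) :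
    levelAvoiding G v r y.1 = (G.induce {y | y ≠ v}).dist r y := by
  simp only [levelAvoiding]
  rw [dif_pos (show y.1 ≠ v from y.2)]

lemma levelAvoiding_le {v : V} {r : {y | y ≠ v}} (hK : (G.induce {y | y ≠ v}).Connected)
    {a b : V} (ha : a ≠ v) (hb : b ≠ v) (h : G.Adj a b) :
    levelAvoiding G v r b ≤ levelAvoiding G v r a + 1 := by
  rw [levelAvoiding_val ⟨a, ha⟩, levelAvoiding_val ⟨b, hb⟩]
  exact dist_le_succ_of_adj hK h

/-- Without their first vertex `x`, the geodesics are links between `x` and `v`. If each has edges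
to finitely many others, there is a theta graph. Otherwise some vertex at position `n` of one
geodesic has neighbours on infinitely many others, and initial segments of these form a bundle of
bounded length. -/
lemma exists_of_star {v : V} (hK : (G.induce {y | y ≠ v}).Connected) {r x : {y | y ≠ v}}
    {s : ℕ → ℕ} {g : ℕ → ℕ → {y | y ≠ v}}
    (hg : ∀ j, 1 ≤ s j ∧ g j 0 = x ∧ g j (s j) ∈ {u : {y | y ≠ v} | G.Adj v u.1} ∧
        IsLink (G.induce {y | y ≠ v}) univ (s j) (g j) ∧
        ∀ i ≤ s j, (G.induce {y | y ≠ v}).dist r (g j i) = (G.induce {y | y ≠ v}).dist r x + i)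
    (hd : ∀ j j', j < j' → ∀ i i', 1 ≤ i → i ≤ s j → 1 ≤ i' → i' ≤ s j' → g j i ≠ g j' i') :
    ∃ S : Set V, IsKInf (G.induce S) ∨ IsTheta (G.induce S) := by
  by_contra hno
  set I : ℕ → Set V := fun j => {z | ∃ i ≤ s j, 1 ≤ i ∧ (g j i).1 = z} with hI
  have hd' : ∀ i j, i < j → Disjoint (I i) (I j) := by
    intro i j hij
    rw [Set.disjoint_left]
    rintro z ⟨a, ha, ha1, rfl⟩ ⟨b, hb, hb1, e⟩
    exact hd i j hij a b ha1 ha hb1 hb (Subtype.ext e.symm)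
  have hx : ∀ j, x.1 ∉ I j := by
    rintro j ⟨i, hi, hi1, e⟩
    have h1 := (hg j).2.2.2.2 i hi
    rw [Subtype.ext e] at h1
    omega
  have hv : ∀ j, v ∉ I j := by
    rintro j ⟨i, hi, hi1, e⟩
    exact (g j i).2 e
  have hl : ∀ j, IsLink G (I j) (s j - 1) (fun i => (g j (i + 1)).1) := by
    intro j
    have := (hg j).1
    exact ⟨fun i hi => ⟨i + 1, by omega, by omega, rfl⟩,
      fun i hi => (hg j).2.2.2.1.2 (i + 1) (by omega)⟩
  have h0 : ∀ j, G.Adj x.1 (g j 1).1 := by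
    intro j
    have := (hg j).2.2.2.1.2 0 (hg j).1
    rw [(hg j).2.1] at this
    exact this
  refine hno ((exists_theta_of_links_of_finite x.2 hd' hx hv (fun j => ?_) fun i => ?_).imp
    fun S h => .inr h)
  · have h1 := (hg j).1
    refine ⟨_, _, h0 j, ?_, (hl j).joined (i := 0) (j := s j - 1) (by omega) le_rfl⟩
    rw [show s j - 1 + 1 = s j by omega]
    exact (hg j).2.2.1
  · by_contra hinf
    have h1 : {j | ∃ n ≤ s i, 1 ≤ n ∧ i < j ∧ ∃ m ≤ s j, 1 ≤ m ∧
        G.Adj (g i n).1 (g j m).1}.Infinite := by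
      refine Set.Infinite.mono ?_ (Set.Infinite.sdiff hinf (Set.finite_Iic i))
      rintro j ⟨⟨_, ⟨n, hn, hn1, rfl⟩, _, ⟨m, hm, hm1, rfl⟩, hadj⟩, hij⟩
      exact ⟨n, hn, hn1, not_le.1 hij, m, hm, hm1, hadj⟩
    obtain ⟨n, hn, φ, hφ, hp⟩ := exists_subseq_of_infinite h1
    have hn1 := (hp 0).1
    choose m hm hm1 hadj using fun k => (hp k).2.2
    have hzi : (g i n).1 ∈ I i := ⟨n, hn, hn1, rfl⟩
    refine hno (exists_kInf_or_theta_of_bundle (G := G) n (x := x.1) (y := (g i n).1)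
      (fun e => hx i (e ▸ hzi)) ⟨fun k => I (φ k), fun a b hab => hd' _ _ (hφ hab),
        fun k => hx _, fun k h => Set.disjoint_left.1 (hd' i (φ k) (hp k).2.1) hzi h, fun k =>
        ⟨m k - 1, ?_, fun a => (g (φ k) (a + 1)).1, ⟨fun a ha => (hl _).1 a ?_,
          fun a ha => (hl _).2 a ?_⟩, h0 _, ?_⟩⟩)
    -- An edge raises the distance from `r` by at most one, so the neighbour sits at position at
    -- most `n + 1`. As the link begins at position 1, its length is at most `n`.
    · have h2 := levelAvoiding_le (r := r) hK (g i n).2 (g (φ k) (m k)).2 (hadj k)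
      rw [levelAvoiding_val, levelAvoiding_val, (hg i).2.2.2.2 n hn,
        (hg (φ k)).2.2.2.2 _ (hm k)] at h2
      omega
    · have := hm k; omega
    · have := hm k; omega
    · have := hm1 k
      change G.Adj (g i n).1 (g (φ k) (m k - 1 + 1)).1
      rw [show m k - 1 + 1 = m k by omega]
      exact hadj k

/-- All legs are single vertices of the ray. Every neighbour of `v` on the ray must be a foot,
because the subgraph is induced; hence the enumeration by `Nat.nth`. -/
lemma exists_fan_of_frequently {v : V} {R : ℕ → V} (hR : IsRay G R) (hvR : ∀ m, v ≠ R m)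
    (h : ∃ᶠ m in atTop, G.Adj v (R m)) : ∃ S : Set V, IsFan (G.induce S) := by
  have hinf := Nat.frequently_atTop_iff_infinite.1 h
  set n : ℕ → ℕ := Nat.nth (fun m => G.Adj v (R m)) with hn
  have hmono : StrictMono n := Nat.nth_strictMono hinf
  have hmem : ∀ k, G.Adj v (R (n k)) := fun k => Nat.nth_mem_of_infinite hinf k
  refine exists_fan (v := v) (R := R) (n := n) (s := fun _ => 0) (f := fun k _ => R (n k)) hR hvR
    (fun k i _ => (hvR _).symm) (fun k => ⟨fun i hi j hj _ => by omega, fun i hi j hj => ?_⟩)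
    (fun k l hkl i _ j _ e => hkl (hmono.injective (hR.1 e)))
    (fun k l _ i hi _ _ h1 _ => by omega) ⟨fun k i hi m => ?_, fun k i hi h1 => by omega,
      fun k => hmono (Nat.lt_succ_self k)⟩ (fun k i hi => ?_) (fun m hm => ?_)
  · simp only [SimpleGraph.irrefl, false_iff]
    omega
  · constructor
    · exact fun e => ⟨by omega, (hR.1 e).symm⟩
    · rintro ⟨-, rfl⟩; rfl
  · exact ⟨fun _ => by omega, fun _ => hmem k⟩
  · have : m ∈ range n := by
      rw [hn, Nat.range_nth_of_infinite hinf]; exact hm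
    obtain ⟨k, rfl⟩ := this
    exact ⟨k, rfl, rfl⟩

/-- If `v` has finitely many neighbours on the ray, then beyond them a leg arises from a geodesic
that starts on the ray and ends at a neighbour of `v`: the part after its last vertex on the ray
contains an induced path with only one end seen by the ray and only the other seen by `v`. Edges of
`G - v` change the distance from `r` by at most one, so legs in separated ranges of levels neither
meet nor touch, and they attach far apart. -/
lemma exists_of_comb {v : V} (hK : (G.induce {y | y ≠ v}).Connected) {r : {y | y ≠ v}}
    {R : ℕ → {y | y ≠ v}} (hadj : ∀ n, (G.induce {y | y ≠ v}).Adj (R n) (R (n + 1)))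
    (hdist : ∀ n, (G.induce {y | y ≠ v}).dist r (R n) = n)
    (hdesc : ∀ n, (desc (G.induce {y | y ≠ v}) r {u | G.Adj v u.1} (R n)).Infinite) :
    ∃ S : Set V, IsFan (G.induce S) ∨ IsDeltaFan (G.induce S) := by
  set lev := levelAvoiding G v r with hlev
  set R' : ℕ → V := fun m => (R m).1 with hR'
  have hRay : IsRay G R' :=
    ⟨Subtype.val_injective.comp (geodesic_injective hdist), geodesic_adj_iff hK hadj hdist⟩
  have hvR : ∀ m, v ≠ R' m := fun m e => (R m).2 e.symm
  have hlR : ∀ m, lev (R' m) = m := fun m => by rw [hlev, levelAvoiding_val, hdist]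
  by_cases hfreq : ∃ᶠ m in atTop, G.Adj v (R' m)
  · exact (exists_fan_of_frequently hRay hvR hfreq).imp fun S h => .inl h
  rw [not_frequently, eventually_atTop] at hfreq
  obtain ⟨N, hN⟩ := hfreq
  set Good : ℕ → ℕ × (ℕ → V) → Prop := fun M p => IsInducedPath G p.1 p.2 ∧
    (∀ i ≤ p.1, p.2 i ≠ v ∧ (∀ m, p.2 i ≠ R' m) ∧ M ≤ lev (p.2 i) ∧
      (∀ m, G.Adj (p.2 i) (R' m) → i = 0) ∧ (G.Adj v (p.2 i) ↔ i = p.1)) ∧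
    ∃ m, G.Adj (p.2 0) (R' m) with hGood
  have hleg : ∀ M, N ≤ M → ∃ p, Good M p := by
    intro M hM
    obtain ⟨u, hu⟩ := (hdesc M).nonempty
    obtain ⟨s, g, hl, hg0, hgs, hgd, -⟩ := exists_geodesic hK hu
    have hgl : ∀ i ≤ s, lev (g i).1 = M + i := by
      intro i hi
      rw [hlev, levelAvoiding_val, hgd i hi, hdist]
    -- Here `d` counts from the far end, so the least `d` marks the last vertex of the geodesic on
    -- the ray.
    have hex : ∃ d, d ≤ s ∧ ∃ m, (g (s - d)).1 = R' m :=
      ⟨s, le_rfl, M, by rw [Nat.sub_self, hg0]⟩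
    classical
    obtain ⟨hds, m0, hm0⟩ := Nat.find_spec hex
    have hmin : ∀ d < Nat.find hex, d ≤ s → ∀ m, (g (s - d)).1 ≠ R' m :=
      fun d hd hds m e => Nat.find_min hex hd ⟨hds, m, e⟩
    generalize Nat.find hex = d at *
    -- If the geodesic ended on the ray, its end would be a neighbour of `v` at a position at least
    -- `N`.
    have hd0 : d ≠ 0 := by
      rintro rfl
      rw [Nat.sub_zero] at hm0
      have h1 := hlR m0
      rw [← hm0, hgl s le_rfl] at h1
      have h2 := hu.1
      rw [← hgs] at h2
      have h2 : G.Adj v (g s).1 := h2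
      rw [hm0] at h2
      exact hN m0 (by omega) h2
    set I : Set V := {y | y ≠ v ∧ (∀ m, y ≠ R' m) ∧ M ≤ lev y} with hI
    have hlink : IsLink G I (d - 1) (fun i => (g (s - d + 1 + i)).1) := by
      refine ⟨fun i hi => ⟨(g _).2, fun m => ?_, ?_⟩, fun i hi => ?_⟩
      · have := hmin (d - 1 - i) (by omega) (by omega) m
        rwa [show s - (d - 1 - i) = s - d + 1 + i by omega] at this
      · rw [hgl _ (by omega)]; omega
      · exact hl.2 (s - d + 1 + i) (by omega)
    obtain ⟨s', f', h1, h2, h3, h4, h5, h6, -⟩ := exists_shortest_link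
      (A := {y | ∃ m, G.Adj y (R' m)}) (B := {y | G.Adj v y}) hlink
      ⟨m0, by rw [← hm0]; exact (hl.2 (s - d) (by omega)).symm⟩
      (by
        change G.Adj v (g (s - d + 1 + (d - 1))).1
        rw [show s - d + 1 + (d - 1) = s by omega, hgs]
        exact hu.1)
    exact ⟨(s', f'), h2, fun i hi => ⟨(h1.1 i hi).1, (h1.1 i hi).2.1, (h1.1 i hi).2.2,
      fun m hm => h5 i hi ⟨m, hm⟩, fun h => h6 i hi h, fun h => by subst h; exact h4⟩, h3⟩
  -- The level of a leg's first vertex differs by at most one from the position of each attachment.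
  -- Hence a distance of 4 between levels keeps attachments of different legs at least two apart.
  -- Similarly, levels of at least `N + 1` force attachments at positions at least `N`.
  obtain ⟨F, hF, hFF⟩ := exists_seq_of_forall_finset_exists (Good (N + 1))
    (fun p q => ∀ i ≤ p.1, ∀ j ≤ q.1, lev (p.2 i) + 4 ≤ lev (q.2 j)) (by
      intro T hT
      have hfin : (⋃ p ∈ T, (fun i => lev (p.2 i)) '' Set.Iic p.1).Finite :=
        T.finite_toSet.biUnion fun p _ => (Set.finite_Iic _).image _
      obtain ⟨B, hB⟩ := hfin.bddAbove
      obtain ⟨q, hq⟩ := hleg (N + 1 + (B + 4)) (by omega)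
      refine ⟨q, ⟨hq.1, fun i hi => ?_, hq.2.2⟩, fun p hp i hi j hj => ?_⟩
      · obtain ⟨a1, a2, a3, a4⟩ := hq.2.1 i hi
        exact ⟨a1, a2, by omega, a4⟩
      · have h1 : lev (p.2 i) ≤ B := hB (mem_biUnion hp ⟨i, hi, rfl⟩)
        have h2 := (hq.2.1 j hj).2.2.1
        omega)
  set s : ℕ → ℕ := fun k => (F k).1 with hs
  set f : ℕ → ℕ → V := fun k => (F k).2 with hf
  have hlow : ∀ k, ∀ i ≤ s k, N + 1 ≤ lev (f k i) := fun k i hi => ((hF k).2.1 i hi).2.2.1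
  have hfv : ∀ k, ∀ i ≤ s k, f k i ≠ v := fun k i hi => ((hF k).2.1 i hi).1
  have hfR : ∀ k, ∀ i ≤ s k, ∀ m, f k i ≠ R' m := fun k i hi => ((hF k).2.1 i hi).2.1
  have hf0 : ∀ k, ∀ i ≤ s k, ∀ m, G.Adj (f k i) (R' m) → i = 0 :=
    fun k i hi => ((hF k).2.1 i hi).2.2.2.1
  have hfs : ∀ k, ∀ i ≤ s k, (G.Adj v (f k i) ↔ i = s k) :=
    fun k i hi => ((hF k).2.1 i hi).2.2.2.2
  have hsep : ∀ k l, k < l → ∀ i ≤ s k, ∀ j ≤ s l, lev (f k i) + 4 ≤ lev (f l j) := hFF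
  have hL : Legs G s f := by
    refine ⟨fun k => (hF k).1, fun k l hkl i hi j hj e => ?_, fun k l hkl i hi j hj e => ?_⟩
    · rcases lt_or_gt_of_ne hkl with h | h
      · have := hsep k l h i hi j hj
        rw [e] at this; omega
      · have := hsep l k h j hj i hi
        rw [e] at this; omega
    · have h1 := levelAvoiding_le (r := r) hK (hfv k i hi) (hfv l j hj) e
      have h2 := levelAvoiding_le (r := r) hK (hfv l j hj) (hfv k i hi) e.symm
      rw [← hlev] at h1 h2
      rcases lt_or_gt_of_ne hkl with h | h
      · have := hsep k l h i hi j hj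
        omega
      · have := hsep l k h j hj i hi
        omega
  set P : ℕ → V := fun m => R' (N + m) with hP
  have hPray : IsRay G P := by
    refine ⟨fun a b e => ?_, fun a b => ?_⟩
    · have := hRay.1 e; omega
    · rw [hP, hRay.2]; omega
  have hatt : ∀ k, ∀ m, G.Adj (f k 0) (R' m) → lev (f k 0) ≤ m + 1 ∧ m ≤ lev (f k 0) + 1 := by
    intro k m e
    have h1 := levelAvoiding_le (r := r) hK (hfv k 0 (by omega)) (R m).2 e
    have h2 := levelAvoiding_le (r := r) hK (R m).2 (hfv k 0 (by omega)) e.symm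
    have h3 := hlR m
    simp only [hR'] at h3
    rw [← hlev, h3] at h1 h2
    exact ⟨h2, h1⟩
  obtain ⟨n, w, hraw⟩ : ∃ n w, Raw G P n w s f := by
    refine exists_raw (fun k i hi m => hfR k i hi _) (fun k i hi m => hf0 k i hi _) (fun k => ?_)
      fun k m m' e e' => ?_
    · obtain ⟨m, hm⟩ := (hF k).2.2
      have := hatt k _ hm
      have := hlow k 0 (by omega)
      exact ⟨m - N, by simp only [hP]; rwa [show N + (m - N) = m by omega]⟩
    · have := hatt k _ e
      have := hatt (k + 1) _ e'
      have := hsep k (k + 1) (by omega) 0 (by omega) 0 (by omega)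
      omega
  have hvP : ∀ m, ¬ G.Adj v (P m) := fun m => hN _ (by omega)
  have hvP' : ∀ m, v ≠ P m := fun m => hvR _
  obtain ⟨φ, hφ, ⟨n', hon, hL'⟩ | ⟨n', hoff⟩ | ⟨n', P', hP', hon, hPP⟩⟩ := hraw.normalize hPray hL
  · refine (exists_fan (v := v) hPray hvP' ?_ hL'.path hL'.ne
      (fun k l hkl i hi j hj _ _ => hL'.nadj k l hkl i hi j hj) hon ?_
      (fun m hm => absurd hm (hvP m))).imp fun S h => .inl h
    · rintro k (_ | i) hi
      · exact (hvP' _).symm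
      · exact hfv _ i (by omega)
    · rintro k (_ | i) hi
      · simpa using hvP _
      · rw [consFn_succ, hfs _ i (by omega)]
        omega
  · exact (exists_deltaFan (v := v) hPray hvP' (fun k => hfv _) (hL.comp hφ) hoff
      (fun k => hfs _) hvP).imp fun S h => .inr h
  -- The rerouted ray may contain neighbours of `v`, but only where a leg is a single vertex, which
  -- `exists_fan` allows.
  · refine (exists_fan (v := v) hP' (fun m e => ?_) (fun k => hfv _) (hL.comp hφ).path
      (hL.comp hφ).ne (fun k l hkl i hi j hj _ _ => (hL.comp hφ).nadj k l hkl i hi j hj) hon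
      (fun k => hfs _) (fun m e => ?_)).imp fun S h => .inl h
    · rcases hPP m with ⟨i, h⟩ | ⟨k, -, h⟩
      · exact hvP' i (e.trans h)
      · exact hfv _ 0 (by omega) (e.trans h).symm
    · rcases hPP m with ⟨i, h⟩ | ⟨k, rfl, h⟩
      · exact absurd (h ▸ e) (hvP i)
      · rw [h] at e
        exact ⟨k, rfl, ((hfs _ 0 (by omega)).1 e).symm⟩

theorem exists_of_infinite_degree (hG : TwoConnected G) {v : V}
    (hv : (G.neighborSet v).Infinite) :
    ∃ S : Set V, IsKInf (G.induce S) ∨ IsTheta (G.induce S) ∨ IsFan (G.induce S) ∨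
      IsDeltaFan (G.induce S) := by
  have hK : (G.induce {y | y ≠ v}).Connected := hG v
  have hU : {u : {y | y ≠ v} | G.Adj v u.1}.Infinite := by
    refine Set.Infinite.of_image Subtype.val (hv.mono ?_)
    intro u hu
    exact ⟨⟨u, (G.ne_of_adj hu).symm⟩, hu, rfl⟩
  obtain ⟨r, -⟩ := hU.nonempty
  rcases exists_star_or_comb hK r hU with ⟨x, s, g, hg, hd⟩ | ⟨R, -, h1, h2, h3⟩
  · obtain ⟨S, h | h⟩ := exists_of_star hK hg hd
    exacts [⟨S, .inl h⟩, ⟨S, .inr (.inl h)⟩]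
  · obtain ⟨S, h | h⟩ := exists_of_comb hK h1 h2 h3
    exacts [⟨S, .inr (.inr (.inl h))⟩, ⟨S, .inr (.inr (.inr h))⟩]

/-! ### Recognizing ladders built from ties -/

section TieLadders

variable {W : Type u} {H : SimpleGraph W}

lemma supp_eq_of_closed {F : SimpleGraph W} {K : Set W} (J : F.ConnectedComponent)
    (hcl : ∀ w ∈ K, ∀ w', F.Adj w w' → w' ∈ K) (hconn : ∀ w ∈ K, ∀ w' ∈ K, F.Reachable w w')
    {w : W} (hw : w ∈ K) (hwJ : w ∈ J.supp) : J.supp = K := by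
  have hcl' : ∀ a b, F.Reachable a b → a ∈ K → b ∈ K := by
    rintro a b ⟨p⟩
    induction p with
    | nil => exact id
    | cons h _ ih => exact fun ha => ih (hcl _ ha _ h)
  ext x
  rw [ConnectedComponent.mem_supp_iff] at hwJ ⊢
  constructor
  · intro hx
    rw [← hwJ] at hx
    exact hcl' w x (ConnectedComponent.exact hx).symm hw
  · intro hx
    rw [← hwJ]
    exact ConnectedComponent.sound (hconn x hx w hw)

/-- Being closed and connected away from the rail edges, the sets `K k` are components, and by
`hrest` all other components are single ray vertices. No two ties cross because the attachments come
in the same order on both rays. -/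
lemma isTieLadder_of_sets {P Q : InducedRay H} (hd : DisjointRays P Q) {K : ℕ → Set W}
    {A B : ℕ → Set ℕ} (hKA : ∀ k i, P i ∈ K k ↔ i ∈ A k) (hKB : ∀ k j, Q j ∈ K k ↔ j ∈ B k)
    (hA : ∀ k, (A k).Nonempty) (hB : ∀ k, (B k).Nonempty)
    (hAlt : ∀ k l, k < l → ∀ a ∈ A k, ∀ b ∈ A l, a < b)
    (hBlt : ∀ k l, k < l → ∀ a ∈ B k, ∀ b ∈ B l, a < b)
    (hA0 : 0 ∈ A 0) (hB0 : 0 ∈ B 0)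
    (hcl : ∀ k, ∀ w ∈ K k, ∀ w', (offRays P Q).Adj w w' → w' ∈ K k)
    (hconn : ∀ k, ∀ w ∈ K k, ∀ w' ∈ K k, (offRays P Q).Reachable w w')
    (hrest : ∀ w, (∃ k, w ∈ K k) ∨
      ((∃ i, w = P i) ∨ ∃ j, w = Q j) ∧ ∀ w', ¬ (offRays P Q).Adj w w')
    {T : (offRays P Q).ConnectedComponent → Prop}
    (hT : ∀ k (J : (offRays P Q).ConnectedComponent), J.supp = K k → T J) :
    IsTieLadder P Q T := by
  have hsupp : ∀ k (J : (offRays P Q).ConnectedComponent) w, w ∈ K k → w ∈ J.supp →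
      J.supp = K k := fun k J w hw hwJ => supp_eq_of_closed J (hcl k) (hconn k) hw hwJ
  have htie : ∀ k (J : (offRays P Q).ConnectedComponent), J.supp = K k → IsTie P Q J := by
    intro k J hJ
    obtain ⟨a, ha⟩ := hA k
    obtain ⟨b, hb⟩ := hB k
    exact ⟨⟨a, show P a ∈ J.supp by rw [hJ]; exact (hKA k a).2 ha⟩,
      ⟨b, show Q b ∈ J.supp by rw [hJ]; exact (hKB k b).2 hb⟩⟩
  have hcomp : ∀ J : (offRays P Q).ConnectedComponent, (∃ k, J.supp = K k) ∨
      (∃ i, J.supp = {P i}) ∨ (∃ j, J.supp = {Q j}) := by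
    intro J
    obtain ⟨w, hw⟩ := J.nonempty_supp
    rcases hrest w with ⟨k, hk⟩ | ⟨h, hno⟩
    · exact .inl ⟨k, hsupp k J w hk hw⟩
    · have : J.supp = {w} := by
        refine supp_eq_of_closed J ?_ ?_ (mem_singleton w) hw
        · rintro a rfl b hb
          exact absurd hb (hno b)
        · rintro a rfl b rfl
          exact .refl _
      rcases h with ⟨i, rfl⟩ | ⟨j, rfl⟩
      exacts [.inr (.inl ⟨i, this⟩), .inr (.inr ⟨j, this⟩)]
  have htie' : ∀ J : (offRays P Q).ConnectedComponent, IsTie P Q J → ∃ k, J.supp = K k := by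
    rintro J ⟨⟨i, hi⟩, ⟨j, hj⟩⟩
    have hi : P i ∈ J.supp := hi
    have hj : Q j ∈ J.supp := hj
    rcases hcomp J with h | ⟨i', h⟩ | ⟨j', h⟩
    · exact h
    · rw [h] at hj
      exact absurd hj.symm (hd _ _)
    · rw [h] at hi
      exact absurd hi (hd _ _)
  have hex : ∀ k, ∃ J : (offRays P Q).ConnectedComponent, J.supp = K k := by
    intro k
    obtain ⟨a, ha⟩ := hA k
    exact ⟨(offRays P Q).connectedComponentMk (P a), hsupp k _ (P a) ((hKA k a).2 ha) rfl⟩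
  have hKinj : ∀ k l, K k = K l → k = l := by
    intro k l h
    obtain ⟨a, ha⟩ := hA k
    have ha' : a ∈ A l := (hKA l a).1 (h ▸ (hKA k a).2 ha)
    rcases lt_trichotomy k l with h' | h' | h'
    · exact absurd (hAlt k l h' a ha a ha') (lt_irrefl _)
    · exact h'
    · exact absurd (hAlt l k h' a ha' a ha) (lt_irrefl _)
  refine ⟨hd, fun J => ?_, ?_, ?_, ?_⟩
  · rcases hcomp J with ⟨k, h⟩ | h | h
    · exact .inr (.inr ⟨htie k J h, hT k J h⟩)
    · exact .inl h
    · exact .inr (.inl h)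
  · obtain ⟨J, hJ⟩ := hex 0
    exact ⟨J, htie 0 J hJ, hT 0 J hJ, hJ ▸ (hKA 0 0).2 hA0, hJ ▸ (hKB 0 0).2 hB0⟩
  · choose J hJ using hex
    refine Set.infinite_of_injective_forall_mem (f := J) (fun k l h => ?_)
      (fun k => ⟨htie k _ (hJ k), hT k _ (hJ k)⟩)
    exact hKinj k l (by rw [← hJ k, ← hJ l, h])
  · intro J J' h h' hne hcr
    obtain ⟨k, hk⟩ := htie' J h
    obtain ⟨l, hl⟩ := htie' J' h'
    have hkl : k ≠ l := by
      rintro rfl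
      exact hne (ConnectedComponent.supp_injective (hk.trans hl.symm))
    have e1 : attachP P Q J = A k := by ext i; rw [← hKA k i, ← hk]; rfl
    have e2 : attachP P Q J' = A l := by ext i; rw [← hKA l i, ← hl]; rfl
    have e3 : attachQ P Q J = B k := by ext i; rw [← hKB k i, ← hk]; rfl
    have e4 : attachQ P Q J' = B l := by ext i; rw [← hKB l i, ← hl]; rfl
    rw [TiesCross, e1, e2, e3, e4] at hcr
    obtain ⟨a, ha⟩ := hA k
    obtain ⟨a', ha'⟩ := hA l
    obtain ⟨b, hb⟩ := hB k
    obtain ⟨b', hb'⟩ := hB l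
    rcases lt_or_gt_of_ne hkl with h | h
    · have h1 := hAlt k l h a ha a' ha'
      have h2 := hBlt k l h b hb b' hb'
      rcases hcr with ⟨-, h3⟩ | ⟨h3, -⟩
      · have := h3 b hb b' hb'; omega
      · have := h3 a ha a' ha'; omega
    · have h1 := hAlt l k h a' ha' a ha
      have h2 := hBlt l k h b' hb' b hb
      rcases hcr with ⟨h3, -⟩ | ⟨-, h3⟩
      · have := h3 a ha a' ha'; omega
      · have := h3 b hb b' hb'; omega

/-- The common features of the forms `On` and `Off` of legs at a ray; `A k` is the set of
positions of the vertices of attachment of the `k`-th leg, and `off` tells that the form is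
`Off`. -/
structure Attached (H : SimpleGraph W) (P : ℕ → W) (s : ℕ → ℕ) (f : ℕ → ℕ → W)
    (A : ℕ → Set ℕ) (off : Prop) : Prop where
  eq : ∀ k, ∀ i ≤ s k, ∀ m, f k i = P m → i = 0 ∧ m ∈ A k ∧ ¬ off
  adj : ∀ k, ∀ i ≤ s k, ∀ m, H.Adj (f k i) (P m) → (i = 0 ∧ m ∈ A k ∧ off) ∨
    (∃ m', f k i = P m') ∨ (i = 1 ∧ P m = f k 0)
  att : ∀ k, ∀ a ∈ A k, (f k 0 = P a ∧ ¬ off) ∨ (off ∧ H.Adj (f k 0) (P a))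
  lt : ∀ k l, k < l → ∀ a ∈ A k, ∀ b ∈ A l, a < b
  nonempty : ∀ k, (A k).Nonempty

lemma On.attached {P : ℕ → W} {n s : ℕ → ℕ} {f : ℕ → ℕ → W} (h : On H P n s f) :
    Attached H P s f (fun k => {n k}) False := by
  refine ⟨fun k i hi m e => ?_, fun k i hi m e => ?_, fun k a ha => ?_,
    fun k l hkl a ha b hb => ?_, fun k => ⟨n k, rfl⟩⟩
  · obtain ⟨h1, h2⟩ := (h.eq k i hi m).1 e
    exact ⟨h1, h2, id⟩
  · rcases Nat.eq_zero_or_pos i with rfl | hi0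
    · exact .inr (.inl ⟨n k, (h.eq k 0 hi _).2 ⟨rfl, rfl⟩⟩)
    · obtain ⟨h1, rfl⟩ := h.adj k i hi hi0 m e
      exact .inr (.inr ⟨h1, ((h.eq k 0 (by omega) _).2 ⟨rfl, rfl⟩).symm⟩)
  · exact .inl ⟨(h.eq k 0 (by omega) a).2 ⟨rfl, ha⟩, id⟩
  · rw [mem_singleton_iff] at ha hb
    subst ha hb
    exact strictMono_nat_of_lt_succ h.gap hkl

lemma Off.attached {P : ℕ → W} {n s : ℕ → ℕ} {f : ℕ → ℕ → W} (h : Off H P n s f) :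
    Attached H P s f (fun k => {n k, n k + 1}) True := by
  refine ⟨fun k i hi m e => ?_, fun k i hi m e => ?_, fun k a ha => ?_,
    fun k l hkl a ha b hb => ?_, fun k => ⟨n k, .inl rfl⟩⟩
  · exact absurd e (h.ne k i hi m)
  · obtain ⟨h1, h2⟩ := (h.adj k i hi m).1 e
    exact .inl ⟨h1, h2, trivial⟩
  · exact .inr ⟨trivial, (h.adj k 0 (by omega) a).2 ⟨rfl, ha⟩⟩
  · have := strictMono_add_of_gap h.gap hkl
    rcases ha with rfl | rfl <;> rcases hb with rfl | rfl <;> omega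

/-- The reversed legs. -/
def revLegs (s : ℕ → ℕ) (f : ℕ → ℕ → W) : ℕ → ℕ → W := fun k i => f k (s k - i)

lemma revLegs_sub {s : ℕ → ℕ} {f : ℕ → ℕ → W} {k i : ℕ} (hi : i ≤ s k) :
    revLegs s f k (s k - i) = f k i := by
  rw [revLegs, Nat.sub_sub_self hi]

lemma Legs.rev {s : ℕ → ℕ} {f : ℕ → ℕ → W} (h : Legs H s f) : Legs H s (revLegs s f) := by
  refine ⟨fun k => ⟨fun i hi j hj e => ?_, fun i hi j hj => ?_⟩, fun k l hkl i hi j hj => ?_,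
    fun k l hkl i hi j hj => ?_⟩
  · have := (h.path k).1 _ (Nat.sub_le _ _) _ (Nat.sub_le _ _) e
    omega
  · rw [revLegs, revLegs, (h.path k).2 _ (Nat.sub_le _ _) _ (Nat.sub_le _ _)]
    omega
  · exact h.ne k l hkl _ (Nat.sub_le _ _) _ (Nat.sub_le _ _)
  · exact h.nadj k l hkl _ (Nat.sub_le _ _) _ (Nat.sub_le _ _)

section

variable {P Q : InducedRay H} {s : ℕ → ℕ} {f : ℕ → ℕ → W} {A B : ℕ → Set ℕ} {off off' : Prop}

/-- The edge `w w'` belongs to the `k`-th tie. -/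
def TieEdge (P Q : InducedRay H) (s : ℕ → ℕ) (f : ℕ → ℕ → W) (A B : ℕ → Set ℕ) (off off' : Prop)
    (k : ℕ) (w w' : W) : Prop :=
  (∃ i < s k, s(w, w') = s(f k i, f k (i + 1))) ∨
    (off ∧ ∃ a ∈ A k, s(w, w') = s(f k 0, P a)) ∨
    (off' ∧ ∃ b ∈ B k, s(w, w') = s(f k (s k), Q b))

/-- The vertices of the `k`-th tie. -/
def tieSet (P Q : InducedRay H) (s : ℕ → ℕ) (f : ℕ → ℕ → W) (A B : ℕ → Set ℕ) (k : ℕ) : Set W :=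
  {w | (∃ i ≤ s k, f k i = w) ∨ (∃ a ∈ A k, P a = w) ∨ ∃ b ∈ B k, Q b = w}

lemma TieEdge.symm {k : ℕ} {w w' : W} (h : TieEdge P Q s f A B off off' k w w') :
    TieEdge P Q s f A B off off' k w' w := by
  rw [TieEdge, Sym2.eq_swap (a := w') (b := w)]
  exact h

lemma TieEdge.mem {k : ℕ} {w w' : W} (h : TieEdge P Q s f A B off off' k w w') :
    w ∈ tieSet P Q s f A B k := by
  rcases h with ⟨i, hi, e⟩ | ⟨-, a, ha, e⟩ | ⟨-, b, hb, e⟩ <;>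
    rcases Sym2.eq_iff.1 e with ⟨rfl, -⟩ | ⟨rfl, -⟩
  · exact .inl ⟨i, by omega, rfl⟩
  · exact .inl ⟨i + 1, by omega, rfl⟩
  · exact .inl ⟨0, by omega, rfl⟩
  · exact .inr (.inl ⟨a, ha, rfl⟩)
  · exact .inl ⟨s k, le_rfl, rfl⟩
  · exact .inr (.inr ⟨b, hb, rfl⟩)

lemma offRays_adj {w w' : W} : (offRays P Q).Adj w w' ↔ H.Adj w w' ∧
    (∀ i, s(w, w') ≠ s(P i, P (i + 1))) ∧ ∀ j, s(w, w') ≠ s(Q j, Q (j + 1)) := by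
  rw [offRays, deleteEdges_adj]
  simp only [mem_union, mem_ofPred_eq, not_or, not_exists, ne_eq]

lemma InducedRay.adj_iff (P : InducedRay H) (i j : ℕ) :
    H.Adj (P i) (P j) ↔ (j = i + 1 ∨ i = j + 1) := P.map_rel_iff'

/-- The graph consists of the rays `P` and `Q` and of the legs, which join them. -/
structure TieSystem (P Q : InducedRay H) (s : ℕ → ℕ) (f : ℕ → ℕ → W) (A B : ℕ → Set ℕ)
    (off off' : Prop) : Prop where
  disj : DisjointRays P Q
  legs : Legs H s f
  left : Attached H P s f A off
  right : Attached H Q s (revLegs s f) B off'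
  cross : ∀ i j, H.Adj (P i) (Q j) → ∃ k, s k = 1 ∧ P i = f k 0 ∧ Q j = f k 1
  cover : ∀ w, (∃ i, w = P i) ∨ (∃ j, w = Q j) ∨ ∃ k, ∃ i ≤ s k, w = f k i

lemma Attached.not_ray_edge (hl : Attached H P s f A off) {k i : ℕ} (hi : i ≤ s k)
    (hi0 : 1 ≤ i ∨ off) {w : W} (j : ℕ) : s(f k i, w) ≠ s(P j, P (j + 1)) := by
  intro e
  have : ∃ m, f k i = P m := by
    rcases Sym2.eq_iff.1 e with ⟨e, -⟩ | ⟨e, -⟩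
    exacts [⟨_, e⟩, ⟨_, e⟩]
  obtain ⟨m, hm⟩ := this
  obtain ⟨h1, -, h2⟩ := hl.eq k i hi m hm
  rcases hi0 with h | h
  · omega
  · exact h2 h

lemma TieSystem.right_eq (h : TieSystem P Q s f A B off off') {k i : ℕ} (hi : i ≤ s k) {m : ℕ}
    (e : f k i = Q m) : i = s k ∧ m ∈ B k ∧ ¬ off' := by
  have := h.right.eq k (s k - i) (Nat.sub_le _ _) m (by rw [revLegs_sub hi, e])
  exact ⟨by omega, this.2⟩

lemma TieSystem.right_adj (h : TieSystem P Q s f A B off off') {k i : ℕ} (hi : i ≤ s k) {m : ℕ}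
    (e : H.Adj (f k i) (Q m)) : (i = s k ∧ m ∈ B k ∧ off') ∨ (∃ m', f k i = Q m') ∨
      (i + 1 = s k ∧ Q m = f k (s k)) := by
  have := h.right.adj k (s k - i) (Nat.sub_le _ _) m (by rwa [revLegs_sub hi])
  rw [revLegs_sub hi] at this
  rcases this with ⟨h1, h2⟩ | h1 | ⟨h1, h2⟩
  · exact .inl ⟨by omega, h2⟩
  · exact .inr (.inl h1)
  · exact .inr (.inr ⟨by omega, h2⟩)

lemma TieSystem.right_att (h : TieSystem P Q s f A B off off') {k b : ℕ} (hb : b ∈ B k) :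
    (f k (s k) = Q b ∧ ¬ off') ∨ (off' ∧ H.Adj (f k (s k)) (Q b)) := h.right.att k b hb

lemma TieSystem.leg_adj (h : TieSystem P Q s f A B off off') {k i : ℕ} (hi : i < s k) :
    (offRays P Q).Adj (f k i) (f k (i + 1)) := by
  refine offRays_adj.2 ⟨((h.legs.path k).2 i (by omega) (i + 1) hi).2 (.inl rfl), fun j => ?_,
    fun j => ?_⟩
  · rw [Sym2.eq_swap]
    exact h.left.not_ray_edge hi (.inl (by omega)) j
  · rw [← revLegs_sub (f := f) (show i ≤ s k by omega)]
    exact h.right.not_ray_edge (Nat.sub_le _ _) (.inl (by omega)) j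

lemma TieSystem.left_adj (h : TieSystem P Q s f A B off off') {k a : ℕ} (ha : a ∈ A k)
    (ho : off) : (offRays P Q).Adj (f k 0) (P a) := by
  refine offRays_adj.2 ⟨?_, fun j => h.left.not_ray_edge (by omega) (.inr ho) j, fun j e => ?_⟩
  · rcases h.left.att k a ha with ⟨-, h1⟩ | h1
    exacts [absurd ho h1, h1.2]
  · rcases Sym2.eq_iff.1 e with ⟨-, e⟩ | ⟨-, e⟩
    exacts [h.disj _ _ e, h.disj _ _ e]

lemma TieSystem.right_adj' (h : TieSystem P Q s f A B off off') {k b : ℕ} (hb : b ∈ B k)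
    (ho : off') : (offRays P Q).Adj (f k (s k)) (Q b) := by
  refine offRays_adj.2 ⟨?_, fun j e => ?_, fun j =>
    h.right.not_ray_edge (k := k) (i := 0) (by omega) (.inr ho) j⟩
  · rcases h.right_att hb with ⟨-, h1⟩ | h1
    exacts [absurd ho h1, h1.2]
  · rcases Sym2.eq_iff.1 e with ⟨-, e⟩ | ⟨-, e⟩
    exacts [h.disj _ _ e.symm, h.disj _ _ e.symm]

lemma TieSystem.reachable (h : TieSystem P Q s f A B off off') {k : ℕ} {w : W}
    (hw : w ∈ tieSet P Q s f A B k) : (offRays P Q).Reachable (f k 0) w := by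
  have hf : ∀ i ≤ s k, (offRays P Q).Reachable (f k 0) (f k i) := by
    intro i
    induction i with
    | zero => exact fun _ => .refl _
    | succ i ih => exact fun hi => (ih (by omega)).trans (h.leg_adj (by omega)).reachable
  rcases hw with ⟨i, hi, rfl⟩ | ⟨a, ha, rfl⟩ | ⟨b, hb, rfl⟩
  · exact hf i hi
  · rcases h.left.att k a ha with ⟨h1, -⟩ | ⟨h1, -⟩
    · rw [h1]
    · exact (h.left_adj ha h1).reachable
  · rcases h.right_att hb with ⟨h1, -⟩ | ⟨h1, -⟩
    · rw [← h1]; exact hf _ le_rfl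
    · exact (hf _ le_rfl).trans (h.right_adj' hb h1).reachable

/-- The ends of the edge are distributed among `P`, `Q` and the legs. The classes overlap, since a
leg may start on a ray; then an edge between a leg and a ray could join two vertices of that ray,
which is impossible for an edge off the rails. -/
lemma TieSystem.exists_tieEdge (h : TieSystem P Q s f A B off off') {w w' : W}
    (hadj : (offRays P Q).Adj w w') : ∃ k, TieEdge P Q s f A B off off' k w w' := by
  obtain ⟨hH, hnP, hnQ⟩ := offRays_adj.1 hadj
  have hPP : ∀ i j, w = P i → w' = P j → False := by
    rintro i j rfl rfl
    rcases (P.adj_iff i j).1 hH with rfl | rfl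
    exacts [hnP _ rfl, hnP _ Sym2.eq_swap]
  have hQQ : ∀ i j, w = Q i → w' = Q j → False := by
    rintro i j rfl rfl
    rcases (Q.adj_iff i j).1 hH with rfl | rfl
    exacts [hnQ _ rfl, hnQ _ Sym2.eq_swap]
  have hPQ : ∀ i j (x y : W), H.Adj x y → x = P i → y = Q j →
      ∃ k, TieEdge P Q s f A B off off' k x y := by
    rintro i j x y hxy rfl rfl
    obtain ⟨k, hk, h1, h2⟩ := h.cross i j hxy
    exact ⟨k, .inl ⟨0, by omega, by rw [h1, h2]⟩⟩
  have hfP : ∀ k i, i ≤ s k → ∀ m (x y : W), H.Adj x y → (∀ i j, x = P i → y = P j → False) →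
      x = f k i → y = P m → ∃ k, TieEdge P Q s f A B off off' k x y := by
    rintro k i hi m x y hxy hno rfl rfl
    rcases h.left.adj k i hi m hxy with ⟨rfl, h2, h3⟩ | ⟨m', hm'⟩ | ⟨rfl, h1⟩
    · exact ⟨k, .inr (.inl ⟨h3, m, h2, rfl⟩)⟩
    · exact (hno m' m hm' rfl).elim
    · exact ⟨k, .inl ⟨0, by omega, by rw [h1, Sym2.eq_swap]⟩⟩
  have hfQ : ∀ k i, i ≤ s k → ∀ m (x y : W), H.Adj x y → (∀ i j, x = Q i → y = Q j → False) →
      x = f k i → y = Q m → ∃ k, TieEdge P Q s f A B off off' k x y := by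
    rintro k i hi m x y hxy hno rfl rfl
    rcases h.right_adj hi hxy with ⟨rfl, h2, h3⟩ | ⟨m', hm'⟩ | ⟨h0, h1⟩
    · exact ⟨k, .inr (.inr ⟨h3, m, h2, rfl⟩)⟩
    · exact (hno m' m hm' rfl).elim
    · exact ⟨k, .inl ⟨i, by omega, by rw [h1, h0]⟩⟩
  rcases h.cover w with ⟨i, hw⟩ | ⟨i, hw⟩ | ⟨k, i, hi, hw⟩ <;>
    rcases h.cover w' with ⟨j, hw'⟩ | ⟨j, hw'⟩ | ⟨l, j, hj, hw'⟩
  · exact (hPP i j hw hw').elim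
  · exact hPQ i j w w' hH hw hw'
  · obtain ⟨k, hk⟩ := hfP l j hj i w' w hH.symm (fun a b h1 h2 => hPP b a h2 h1) hw' hw
    exact ⟨k, hk.symm⟩
  · obtain ⟨k, hk⟩ := hPQ j i w' w hH.symm hw' hw
    exact ⟨k, hk.symm⟩
  · exact (hQQ i j hw hw').elim
  · obtain ⟨k, hk⟩ := hfQ l j hj i w' w hH.symm (fun a b h1 h2 => hQQ b a h2 h1) hw' hw
    exact ⟨k, hk.symm⟩
  · exact hfP k i hi j w w' hH hPP hw hw'
  · exact hfQ k i hi j w w' hH hQQ hw hw'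
  · subst hw hw'
    by_cases hkl : k = l
    · subst hkl
      rcases ((h.legs.path k).2 i hi j hj).1 hH with rfl | rfl
      · exact ⟨k, .inl ⟨i, by omega, rfl⟩⟩
      · exact ⟨k, .inl ⟨j, by omega, Sym2.eq_swap⟩⟩
    · exact absurd hH (h.legs.nadj k l hkl i hi j hj)

lemma TieSystem.P_mem_iff (h : TieSystem P Q s f A B off off') (k i : ℕ) :
    P i ∈ tieSet P Q s f A B k ↔ i ∈ A k := by
  constructor
  · rintro (⟨j, hj, e⟩ | ⟨a, ha, e⟩ | ⟨b, hb, e⟩)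
    · exact (h.left.eq k j hj i e).2.1
    · rwa [← P.injective e]
    · exact absurd e.symm (h.disj _ _)
  · exact fun hi => .inr (.inl ⟨i, hi, rfl⟩)

lemma TieSystem.Q_mem_iff (h : TieSystem P Q s f A B off off') (k i : ℕ) :
    Q i ∈ tieSet P Q s f A B k ↔ i ∈ B k := by
  constructor
  · rintro (⟨j, hj, e⟩ | ⟨a, ha, e⟩ | ⟨b, hb, e⟩)
    · exact (h.right_eq hj e).2.1
    · exact absurd e (h.disj _ _)
    · rwa [← Q.injective e]
  · exact fun hi => .inr (.inr ⟨i, hi, rfl⟩)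

lemma Attached.eq_of_mem (hl : Attached H P s f A off) {k l a : ℕ} (hk : a ∈ A k)
    (hl' : a ∈ A l) : k = l := by
  rcases lt_trichotomy k l with h | h | h
  · exact absurd (hl.lt k l h a hk a hl') (lt_irrefl _)
  · exact h
  · exact absurd (hl.lt l k h a hl' a hk) (lt_irrefl _)

lemma TieSystem.eq_of_mem (h : TieSystem P Q s f A B off off') {k l : ℕ} {w : W}
    (hk : w ∈ tieSet P Q s f A B k) (hl : w ∈ tieSet P Q s f A B l) : k = l := by
  rcases h.cover w with ⟨i, rfl⟩ | ⟨i, rfl⟩ | ⟨m, i, hi, rfl⟩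
  · rw [h.P_mem_iff] at hk hl
    exact h.left.eq_of_mem hk hl
  · rw [h.Q_mem_iff] at hk hl
    exact h.right.eq_of_mem hk hl
  · have key : ∀ k, f m i ∈ tieSet P Q s f A B k → m = k := by
      intro k hk
      by_contra hne
      rcases hk with ⟨j, hj, e⟩ | ⟨a, ha, e⟩ | ⟨b, hb, e⟩
      · exact h.legs.ne m k hne i hi j hj e.symm
      · exact hne (h.left.eq_of_mem (h.left.eq m i hi a e.symm).2.1 ha)
      · exact hne (h.right.eq_of_mem (h.right_eq hi e.symm).2.1 hb)
    rw [← key k hk, ← key l hl]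

lemma TieSystem.tieEdge_of_mem (h : TieSystem P Q s f A B off off') {k : ℕ} {w w' : W}
    (hw : w ∈ tieSet P Q s f A B k) (hadj : (offRays P Q).Adj w w') :
    TieEdge P Q s f A B off off' k w w' := by
  obtain ⟨l, hl⟩ := h.exists_tieEdge hadj
  obtain rfl := h.eq_of_mem hw hl.mem
  exact hl

lemma TieSystem.isTieLadder (h : TieSystem P Q s f A B off off') (hA : 0 ∈ A 0) (hB : 0 ∈ B 0)
    {T : (offRays P Q).ConnectedComponent → Prop}
    (hT : ∀ k (J : (offRays P Q).ConnectedComponent), J.supp = tieSet P Q s f A B k → T J) :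
    IsTieLadder P Q T := by
  refine isTieLadder_of_sets h.disj h.P_mem_iff h.Q_mem_iff h.left.nonempty h.right.nonempty
    h.left.lt h.right.lt hA hB (fun k w hw w' hadj => (h.tieEdge_of_mem hw hadj).symm.mem)
    (fun k w hw w' hw' => (h.reachable hw).symm.trans (h.reachable hw')) (fun w => ?_) hT
  by_cases hw : ∃ k, w ∈ tieSet P Q s f A B k
  · exact .inl hw
  · refine .inr ⟨?_, fun w' hadj => ?_⟩
    · rcases h.cover w with h1 | h1 | ⟨k, i, hi, e⟩
      · exact .inl h1
      · exact .inr h1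
      · exact absurd ⟨k, .inl ⟨i, hi, e.symm⟩⟩ hw
    · obtain ⟨k, hk⟩ := h.exists_tieEdge hadj
      exact hw ⟨k, hk.mem⟩

lemma TieSystem.leg_walk (h : TieSystem P Q s f A B off off') (k : ℕ) {a b : W}
    (ha : f k 0 = a) (hb : f k (s k) = b) :
    ∃ p : (offRays P Q).Walk a b, (∀ x, x ∈ p.support ↔ ∃ i ≤ s k, f k i = x) ∧
      (∀ e, e ∈ p.edges ↔ ∃ i < s k, e = s(f k i, f k (i + 1))) ∧ p.IsPath := by
  obtain ⟨p, h1, h2, -, h3⟩ := IsLink.exists_walk' (G := offRays P Q) (I := univ) (s := s k)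
    (f := f k) ⟨fun _ _ => trivial, fun i hi => h.leg_adj hi⟩ ha hb
  exact ⟨p, h1, h2, h3 (h.legs.path k).1⟩

lemma attachP_eq {J : (offRays P Q).ConnectedComponent} (h : TieSystem P Q s f A B off off')
    {k : ℕ} (hJ : J.supp = tieSet P Q s f A B k) : attachP P Q J = A k := by
  ext i
  rw [← h.P_mem_iff, ← hJ]
  rfl

lemma attachQ_eq {J : (offRays P Q).ConnectedComponent} (h : TieSystem P Q s f A B off off')
    {k : ℕ} (hJ : J.supp = tieSet P Q s f A B k) : attachQ P Q J = B k := by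
  ext i
  rw [← h.Q_mem_iff, ← hJ]
  rfl

lemma TieSystem.isLadder {n m : ℕ → ℕ}
    (h : TieSystem P Q s f (fun k => {n k}) (fun k => {m k}) False False)
    (hn : n 0 = 0) (hm : m 0 = 0) : IsLadder H := by
  refine ⟨P, Q, h.isTieLadder (mem_singleton_iff.2 hn.symm) (mem_singleton_iff.2 hm.symm)
    fun k J hJ => ?_⟩
  have e1 : f k 0 = P (n k) := by simpa using h.left.att k (n k) rfl
  have e2 : f k (s k) = Q (m k) := by simpa using h.right_att (k := k) (b := m k) rfl
  obtain ⟨r, h1, h2, h3⟩ := h.leg_walk k e1 e2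
  refine ⟨n k, m k, r, attachP_eq h hJ, attachQ_eq h hJ, h3, fun w => ?_, fun w w' hw hadj => ?_⟩
  · rw [hJ, h1]
    constructor
    · rintro (h | ⟨a, rfl, rfl⟩ | ⟨b, rfl, rfl⟩)
      exacts [h, ⟨0, by omega, e1⟩, ⟨s k, le_rfl, e2⟩]
    · exact .inl
  · rw [hJ] at hw
    rw [h2]
    rcases h.tieEdge_of_mem hw hadj with h | ⟨h, -⟩ | ⟨h, -⟩
    exacts [h, h.elim, h.elim]

lemma TieSystem.isTieLadder_typeY {n m : ℕ → ℕ}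
    (h : TieSystem P Q s f (fun k => {n k, n k + 1}) (fun k => {m k}) True False)
    (hs : ∀ k, 1 ≤ s k) (hn : n 0 = 0) (hm : m 0 = 0) : IsTieLadder P Q (IsTypeY P Q) := by
  refine h.isTieLadder (.inl hn.symm) (mem_singleton_iff.2 hm.symm) fun k J hJ => ?_
  have e2 : f k (s k) = Q (m k) := by simpa using h.right_att (k := k) (b := m k) rfl
  obtain ⟨r, h1, h2, h3⟩ := h.leg_walk k rfl e2
  have a0 := h.left_adj (k := k) (a := n k) (.inl rfl) trivial
  have a1 := h.left_adj (k := k) (a := n k + 1) (.inr rfl) trivial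
  refine ⟨n k, m k, f k 0, r, attachP_eq h hJ, attachQ_eq h hJ, fun i e => ?_, fun i e => ?_,
    a0, a1, h3, fun w => ?_, fun w w' hw hadj => ?_⟩
  · exact (h.left.eq k 0 (by omega) i e).2.2 trivial
  · have := (h.right_eq (by omega) e).1
    have := hs k
    omega
  · rw [hJ, h1]
    constructor
    · rintro (h | ⟨a, rfl | rfl, rfl⟩ | ⟨b, rfl, rfl⟩)
      exacts [.inr (.inr h), .inl rfl, .inr (.inl rfl), .inr (.inr ⟨s k, le_rfl, e2⟩)]
    · rintro (rfl | rfl | h)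
      exacts [.inr (.inl ⟨_, .inl rfl, rfl⟩), .inr (.inl ⟨_, .inr rfl, rfl⟩), .inl h]
  · rw [hJ] at hw
    rw [h2]
    rcases h.tieEdge_of_mem hw hadj with h | ⟨-, a, rfl | rfl, h⟩ | ⟨h, -⟩
    exacts [.inr (.inr h), .inl h, .inr (.inl h), h.elim]

lemma TieSystem.isTieLadder_typeLambda {n m : ℕ → ℕ}
    (h : TieSystem P Q s f (fun k => {n k}) (fun k => {m k, m k + 1}) False True)
    (hs : ∀ k, 1 ≤ s k) (hn : n 0 = 0) (hm : m 0 = 0) : IsTieLadder P Q (IsTypeLambda P Q) := by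
  refine h.isTieLadder (mem_singleton_iff.2 hn.symm) (.inl hm.symm) fun k J hJ => ?_
  have e1 : f k 0 = P (n k) := by simpa using h.left.att k (n k) rfl
  obtain ⟨r, h1, h2, h3⟩ := h.leg_walk k e1 rfl
  have a0 := h.right_adj' (k := k) (b := m k) (.inl rfl) trivial
  have a1 := h.right_adj' (k := k) (b := m k + 1) (.inr rfl) trivial
  refine ⟨n k, m k, f k (s k), r.reverse, attachP_eq h hJ, attachQ_eq h hJ, fun i e => ?_,
    fun i e => ?_, a0, a1, h3.reverse, fun w => ?_, fun w w' hw hadj => ?_⟩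
  · have := (h.left.eq k _ le_rfl i e).1
    have := hs k
    omega
  · exact (h.right_eq le_rfl e).2.2 trivial
  · rw [hJ, Walk.support_reverse, List.mem_reverse, h1]
    constructor
    · rintro (h | ⟨a, rfl, rfl⟩ | ⟨b, rfl | rfl, rfl⟩)
      exacts [.inr (.inr h), .inr (.inr ⟨0, by omega, e1⟩), .inl rfl, .inr (.inl rfl)]
    · rintro (rfl | rfl | h)
      exacts [.inr (.inr ⟨_, .inl rfl, rfl⟩), .inr (.inr ⟨_, .inr rfl, rfl⟩), .inl h]
  · rw [hJ] at hw
    rw [Walk.edges_reverse, List.mem_reverse, h2]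
    rcases h.tieEdge_of_mem hw hadj with h | ⟨h, -⟩ | ⟨-, b, rfl | rfl, h⟩
    exacts [.inr (.inr h), h.elim, .inl h, .inr (.inl h)]

lemma TieSystem.isNablaDeltaLadder {n m : ℕ → ℕ}
    (h : TieSystem P Q s f (fun k => {n k, n k + 1}) (fun k => {m k, m k + 1}) True True)
    (hn : n 0 = 0) (hm : m 0 = 0) : IsNablaDeltaLadder H := by
  refine ⟨P, Q, h.isTieLadder (.inl hn.symm) (.inl hm.symm) fun k J hJ => ?_⟩
  obtain ⟨r, h1, h2, h3⟩ := h.leg_walk k rfl rfl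
  have a0 := h.left_adj (k := k) (a := n k) (.inl rfl) trivial
  have a1 := h.left_adj (k := k) (a := n k + 1) (.inr rfl) trivial
  have b0 := h.right_adj' (k := k) (b := m k) (.inl rfl) trivial
  have b1 := h.right_adj' (k := k) (b := m k + 1) (.inr rfl) trivial
  refine ⟨n k, m k, f k 0, f k (s k), r, attachP_eq h hJ, attachQ_eq h hJ,
    fun i e => (h.left.eq k _ (by omega) i e).2.2 trivial,
    fun i e => (h.right_eq (by omega) e).2.2 trivial,
    fun i e => (h.left.eq k _ le_rfl i e).2.2 trivial,
    fun i e => (h.right_eq le_rfl e).2.2 trivial,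
    a0, a1, b0, b1, h3, fun w => ?_, fun w w' hw hadj => ?_⟩
  · rw [hJ, h1]
    constructor
    · rintro (h | ⟨a, rfl | rfl, rfl⟩ | ⟨b, rfl | rfl, rfl⟩)
      exacts [.inr (.inr (.inr (.inr h))), .inl rfl, .inr (.inl rfl), .inr (.inr (.inl rfl)),
        .inr (.inr (.inr (.inl rfl)))]
    · rintro (rfl | rfl | rfl | rfl | h)
      exacts [.inr (.inl ⟨_, .inl rfl, rfl⟩), .inr (.inl ⟨_, .inr rfl, rfl⟩),
        .inr (.inr ⟨_, .inl rfl, rfl⟩), .inr (.inr ⟨_, .inr rfl, rfl⟩), .inl h]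
  · rw [hJ] at hw
    rw [h2]
    rcases h.tieEdge_of_mem hw hadj with h | ⟨-, a, rfl | rfl, h⟩ | ⟨-, b, rfl | rfl, h⟩
    exacts [.inr (.inr (.inr (.inr h))), .inl h, .inr (.inl h), .inr (.inr (.inl h)),
      .inr (.inr (.inr (.inl h)))]

end

end TieLadders

/-! ### Ladders as induced subgraphs -/

/-- An induced ray inside `S`, as an induced ray of the subgraph induced by `S`. -/
def IsRay.toInducedRay {P : ℕ → V} (hP : IsRay G P) {S : Set V} (hS : ∀ i, P i ∈ S) :
    InducedRay (G.induce S) where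
  toFun i := ⟨P i, hS i⟩
  inj' _ _ h := hP.1 (congrArg Subtype.val h)
  map_rel_iff' {i j} := hP.2 i j

lemma IsRay.shift {P : ℕ → V} (hP : IsRay G P) (c : ℕ) : IsRay G (fun i => P (c + i)) :=
  ⟨fun i j h => by have := hP.1 h; omega, fun i j => by rw [hP.2]; omega⟩

lemma On.shift {P : ℕ → V} {n s : ℕ → ℕ} {f : ℕ → ℕ → V} (h : On G P n s f) {c : ℕ}
    (hc : c ≤ n 0) : On G (fun i => P (c + i)) (fun k => n k - c) s f := by
  have hn : ∀ k, c ≤ n k := fun k =>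
    hc.trans ((strictMono_nat_of_lt_succ h.gap).monotone (Nat.zero_le k))
  refine ⟨fun k i hi m => ?_, fun k i hi h1 m e => ?_, fun k => ?_⟩
  · rw [h.eq k i hi]
    have := hn k
    omega
  · have := h.adj k i hi h1 _ e
    omega
  · have := h.gap k
    have := hn k
    omega

lemma Off.shift {P : ℕ → V} {n s : ℕ → ℕ} {f : ℕ → ℕ → V} (h : Off G P n s f) {c : ℕ}
    (hc : c ≤ n 0) : Off G (fun i => P (c + i)) (fun k => n k - c) s f := by
  have hn : ∀ k, c ≤ n k := fun k => hc.trans ((strictMono_nat_of_lt_succ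
    (fun k => by have := h.gap k; omega)).monotone (Nat.zero_le k))
  refine ⟨fun k i hi m => h.ne k i hi _, fun k i hi m => ?_, fun k => ?_⟩
  · rw [h.adj k i hi]
    have := hn k
    omega
  · have := h.gap k
    have := hn k
    omega

section Lift

variable {S : Set V} {P : ℕ → V} {n s : ℕ → ℕ} {f : ℕ → ℕ → V} {P' : ℕ → S} {f' : ℕ → ℕ → S}

lemma Legs.lift (h : Legs G s f) (hf : ∀ k i, i ≤ s k → (f' k i : V) = f k i) :
    Legs (G.induce S) s f' := by
  refine ⟨fun k => ⟨fun i hi j hj e => ?_, fun i hi j hj => ?_⟩, fun k l hkl i hi j hj e => ?_,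
    fun k l hkl i hi j hj => ?_⟩
  · exact (h.path k).1 i hi j hj (by rw [← hf k i hi, ← hf k j hj, e])
  · rw [comap_adj, Function.Embedding.subtype_apply, Function.Embedding.subtype_apply,
      hf k i hi, hf k j hj, (h.path k).2 i hi j hj]
  · exact h.ne k l hkl i hi j hj (by rw [← hf k i hi, ← hf l j hj, e])
  · rw [comap_adj, Function.Embedding.subtype_apply, Function.Embedding.subtype_apply,
      hf k i hi, hf l j hj]
    exact h.nadj k l hkl i hi j hj

lemma On.lift (h : On G P n s f) (hf : ∀ k i, i ≤ s k → (f' k i : V) = f k i)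
    (hP : ∀ i, (P' i : V) = P i) : On (G.induce S) P' n s f' := by
  refine ⟨fun k i hi m => ?_, fun k i hi h1 m e => ?_, h.gap⟩
  · rw [Subtype.ext_iff, hf k i hi, hP, h.eq k i hi]
  · rw [comap_adj, Function.Embedding.subtype_apply, Function.Embedding.subtype_apply,
      hf k i hi, hP] at e
    exact h.adj k i hi h1 m e

lemma Off.lift (h : Off G P n s f) (hf : ∀ k i, i ≤ s k → (f' k i : V) = f k i)
    (hP : ∀ i, (P' i : V) = P i) : Off (G.induce S) P' n s f' := by
  refine ⟨fun k i hi m e => ?_, fun k i hi m => ?_, h.gap⟩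
  · exact h.ne k i hi m (by rw [← hf k i hi, ← hP, e])
  · rw [comap_adj, Function.Embedding.subtype_apply, Function.Embedding.subtype_apply,
      hf k i hi, hP, h.adj k i hi]

end Lift

/-- The form of the legs at the two rays decides the family: `On` at both gives type `I`, `Off` at
`P` alone type `Y`, `Off` at `Q` alone type `λ`, and `Off` at both type `Y`-`λ`. -/
lemma exists_ladder_of_initial {P Q : ℕ → V} (hP : IsRay G P) (hQ : IsRay G Q)
    (hPQ : ∀ i j, P i ≠ Q j) {n m s : ℕ → ℕ} {f : ℕ → ℕ → V} (hL : Legs G s f)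
    (h1 : On G P n s f ∨ Off G P n s f)
    (h2 : On G Q m s (revLegs s f) ∨ Off G Q m s (revLegs s f))
    (hc : ∀ i j, G.Adj (P i) (Q j) → ∃ k, s k = 1 ∧ P i = f k 0 ∧ Q j = f k 1)
    (hn : n 0 = 0) (hm : m 0 = 0) : ∃ S : Set V,
    IsLadder (G.induce S) ∨ IsDeltaLadder (G.induce S) ∨ IsNablaDeltaLadder (G.induce S) := by
  classical
  set S : Set V := {w | (∃ i, w = P i) ∨ (∃ j, w = Q j) ∨ ∃ k, ∃ i ≤ s k, w = f k i} with hS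
  have hPS : ∀ i, P i ∈ S := fun i => .inl ⟨i, rfl⟩
  have hQS : ∀ i, Q i ∈ S := fun i => .inr (.inl ⟨i, rfl⟩)
  have hfS : ∀ k i, i ≤ s k → f k i ∈ S := fun k i hi => .inr (.inr ⟨k, i, hi, rfl⟩)
  -- The default value can occur only beyond the end of a leg.
  set f' : ℕ → ℕ → S := fun k i => if h : f k i ∈ S then ⟨f k i, h⟩ else ⟨P 0, hPS 0⟩ with hf'
  have hf : ∀ k i, i ≤ s k → (f' k i : V) = f k i := fun k i hi => by
    simp only [hf', dif_pos (hfS k i hi)]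
  have hfr : ∀ k i, i ≤ s k → (((revLegs s f' : ℕ → ℕ → S) k i : S) : V) = revLegs s f k i := fun k i hi =>
    hf k _ (Nat.sub_le _ _)
  set P' := hP.toInducedRay hPS with hP'
  set Q' := hQ.toInducedRay hQS with hQ'
  have hPv : ∀ i, (P' i : V) = P i := fun _ => rfl
  have hQv : ∀ i, (Q' i : V) = Q i := fun _ => rfl
  have hsys : ∀ {A B : ℕ → Set ℕ} {off off' : Prop},
      Attached (G.induce S) P' s f' A off → Attached (G.induce S) Q' s (revLegs s f') B off' →
      TieSystem P' Q' s f' A B off off' := by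
    intro A B off off' hA hB
    refine ⟨fun i j e => hPQ i j (congrArg Subtype.val e), hL.lift hf, hA, hB, fun i j e => ?_,
      fun w => ?_⟩
    · obtain ⟨k, h1, h2, h3⟩ := hc i j e
      exact ⟨k, h1, Subtype.ext (by rw [hPv, h2, hf k 0 (by omega)]),
        Subtype.ext (by rw [hQv, h3, hf k 1 (by omega)])⟩
    · rcases w.2 with ⟨i, h⟩ | ⟨i, h⟩ | ⟨k, i, hi, h⟩
      · exact .inl ⟨i, Subtype.ext h⟩
      · exact .inr (.inl ⟨i, Subtype.ext h⟩)
      · exact .inr (.inr ⟨k, i, hi, Subtype.ext (h.trans (hf k i hi).symm)⟩)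
  refine ⟨S, ?_⟩
  rcases h1 with h1 | h1 <;> rcases h2 with h2 | h2
  · exact .inl ((hsys (h1.lift hf hPv).attached (h2.lift hfr hQv).attached).isLadder hn hm)
  · refine .inr (.inl ⟨P', Q', .inr ((hsys (h1.lift hf hPv).attached
      (h2.lift hfr hQv).attached).isTieLadder_typeLambda (fun k => ?_) hn hm)⟩)
    -- A one-vertex leg would be a vertex of `P` with a neighbour on `Q`. By `hc` this edge is a leg
    -- of length one, and disjointness makes it the same leg. The mirror case below is analogous.
    by_contra hs
    have hs : s k = 0 := by omega
    have e1 : f k 0 = P (n k) := (h1.eq k 0 (by omega) _).2 ⟨rfl, rfl⟩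
    have e2 := (h2.adj k 0 (by omega) (m k)).2 ⟨rfl, .inl rfl⟩
    rw [revLegs, hs, e1] at e2
    obtain ⟨l, hl, e3, -⟩ := hc _ _ e2
    have : k = l := by
      by_contra hne
      exact hL.ne k l hne 0 (by omega) 0 (by omega) (e1.trans e3)
    subst this
    omega
  · refine .inr (.inl ⟨P', Q', .inl ((hsys (h1.lift hf hPv).attached
      (h2.lift hfr hQv).attached).isTieLadder_typeY (fun k => ?_) hn hm)⟩)
    by_contra hs
    have hs : s k = 0 := by omega
    have e1 : f k 0 = Q (m k) := by
      have := (h2.eq k 0 (by omega) _).2 ⟨rfl, rfl⟩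
      rwa [revLegs, hs] at this
    have e2 := (h1.adj k 0 (by omega) (n k)).2 ⟨rfl, .inl rfl⟩
    rw [e1] at e2
    obtain ⟨l, hl, -, e3⟩ := hc _ _ e2.symm
    have : k = l := by
      by_contra hne
      exact hL.ne k l hne 0 (by omega) 1 (by omega) (e1.trans e3)
    subst this
    omega
  · exact .inr (.inr
      ((hsys (h1.lift hf hPv).attached (h2.lift hfr hQv).attached).isNablaDeltaLadder hn hm))

/-- Two disjoint rays and infinitely many legs between them induce a ladder. -/
lemma exists_ladder {P Q : ℕ → V} (hP : IsRay G P) (hQ : IsRay G Q)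
    (hPQ : ∀ i j, P i ≠ Q j) {n m s : ℕ → ℕ} {f : ℕ → ℕ → V} (hL : Legs G s f)
    (h1 : On G P n s f ∨ Off G P n s f)
    (h2 : On G Q m s (revLegs s f) ∨ Off G Q m s (revLegs s f))
    (hc : ∀ i j, G.Adj (P i) (Q j) → ∃ k, s k = 1 ∧ P i = f k 0 ∧ Q j = f k 1) : ∃ S : Set V,
    IsLadder (G.induce S) ∨ IsDeltaLadder (G.induce S) ∨ IsNablaDeltaLadder (G.induce S) :=
  -- Cutting both rays at the first attachments of leg 0 makes it the tie at the initial vertices.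
  exists_ladder_of_initial (hP.shift (n 0)) (hQ.shift (m 0)) (fun _ _ => hPQ _ _) hL
    (h1.imp (On.shift · le_rfl) (Off.shift · le_rfl))
    (h2.imp (On.shift · le_rfl) (Off.shift · le_rfl)) (fun _ _ => hc _ _)
    (Nat.sub_self _) (Nat.sub_self _)

/-! ### Clean ladders -/

/-- All crosses between the sequences `A` and `B` are degenerate. -/
def CrossesDegenerate (G : SimpleGraph V) (A B : ℕ → V) : Prop :=
  ∀ i j i' j', G.Adj (A i) (B j) → G.Adj (A i') (B j') → i < i' → j' < j → i' = i + 1 ∧ j = j' + 1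

/-- Both rays are cut at the ends of some edge between them. Local finiteness makes the edges reach
arbitrarily far on both rays at once, so infinitely many of them are disjoint, and these witness the
common end. -/
lemma exists_cleanLadder (hlf : ∀ w, (G.neighborSet w).Finite) {A B : ℕ → V} (hA : IsRay G A)
    (hB : IsRay G B) (hAB : ∀ i j, A i ≠ B j)
    (hinf : ∀ N, ∃ i, N ≤ i ∧ ∃ j, G.Adj (A i) (B j)) (hc : CrossesDegenerate G A B) :
    ∃ S : Set V, IsCleanLadder (G.induce S) := by
  obtain ⟨a, -, b, hab⟩ := hinf 0
  set A' : ℕ → V := fun i => A (a + i) with hA'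
  set B' : ℕ → V := fun i => B (b + i) with hB'
  set S : Set V := {w | (∃ i, w = A' i) ∨ ∃ j, w = B' j} with hS
  have hAS : ∀ i, A' i ∈ S := fun i => .inl ⟨i, rfl⟩
  have hBS : ∀ i, B' i ∈ S := fun i => .inr ⟨i, rfl⟩
  have hlfS : ∀ w : S, ((G.induce S).neighborSet w).Finite := fun w =>
    Set.Finite.of_finite_image ((hlf w).subset (by rintro _ ⟨x, hx, rfl⟩; exact hx))
      Subtype.val_injective.injOn
  have hnext : ∀ N, ∃ i j, N ≤ i ∧ N ≤ j ∧ G.Adj (A' i) (B' j) := by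
    intro N
    -- Only finitely many vertices of `A` see the beginning of `B`; an edge from beyond them ends
    -- far out on `B`.
    have hfin : (⋃ j ∈ Finset.range (b + N), {i | G.Adj (A i) (B j)}).Finite := by
      refine Set.Finite.biUnion (Finset.finite_toSet _) fun j _ => ?_
      refine Set.Finite.of_finite_image ((hlf (B j)).subset ?_) (f := A) hA.1.injOn
      rintro _ ⟨i, hi, rfl⟩
      exact hi.symm
    obtain ⟨M, hM⟩ := hfin.bddAbove
    obtain ⟨i, hi, j, hij⟩ := hinf (a + N + M + 1)
    have hj : b + N ≤ j := by
      by_contra hj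
      have := hM (Set.mem_biUnion (Finset.mem_coe.2 (Finset.mem_range.2 (by omega))) hij)
      omega
    refine ⟨i - a, j - b, by omega, by omega, ?_⟩
    simp only [hA', hB']
    rwa [show a + (i - a) = i by omega, show b + (j - b) = j by omega]
  choose I J hI hJ hIJ using hnext
  set N : ℕ → ℕ := fun k => Nat.rec 0 (fun _ N => I N + J N + 1) k with hN
  have hN1 : ∀ k, N (k + 1) = I (N k) + J (N k) + 1 := fun _ => rfl
  have hlt : StrictMono (fun k => I (N k)) ∧ StrictMono (fun k => J (N k)) := by
    constructor <;> refine strictMono_nat_of_lt_succ fun k => ?_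
    · have := hI (N (k + 1)); have := hN1 k; omega
    · have := hJ (N (k + 1)); have := hN1 k; omega
  have hA1 := (hA.shift a)
  have hB1 := (hB.shift b)
  refine ⟨S, hA1.toInducedRay hAS, hB1.toInducedRay hBS, ⟨hlfS, ?_, ?_, ?_, hab⟩, ?_⟩
  · exact fun i j e => hAB _ _ (congrArg Subtype.val e)
  · rintro ⟨w, ⟨i, h⟩ | ⟨i, h⟩⟩
    exacts [.inl ⟨i, Subtype.ext h⟩, .inr ⟨i, Subtype.ext h⟩]
  · have hadj : ∀ k, (G.induce S).Adj (hA1.toInducedRay hAS (I (N k)))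
        (hB1.toInducedRay hBS (J (N k))) := fun k => hIJ (N k)
    refine ⟨fun k => I (N k), fun k => J (N k), fun k => (hadj k).toWalk, fun k =>
      Walk.IsPath.of_adj (hadj k), ?_⟩
    intro k l hkl w hw hw'
    simp only [Adj.toWalk, Walk.support_cons, Walk.support_nil, List.mem_cons, List.not_mem_nil,
      or_false] at hw hw'
    rcases hw with rfl | rfl <;> rcases hw' with h | h
    · exact hkl (hlt.1.injective ((hA1.toInducedRay hAS).injective h))
    · exact hAB _ _ (congrArg Subtype.val h)
    · exact hAB _ _ (congrArg Subtype.val h).symm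
    · exact hkl (hlt.2.injective ((hB1.toInducedRay hBS).injective h))
  · rintro i j i' j' ⟨h1, h2, h3, h4⟩
    have := hc (a + i) (b + j) (a + i') (b + j') h1 h2 (by omega) (by omega)
    omega

/-! ### Normalizing legs at both ends -/

section Extend

variable {P : ℕ → V} {n w s : ℕ → ℕ} {f g : ℕ → ℕ → V}

/-- This and its two companions serve when a leg is lengthened at one end to reach a ray, which must
not disturb its form at the other ray. -/
lemma Raw.extend (h : Raw G P n w s f) (hg : ∀ k, ∀ i ≤ s k, g k i = f k i)
    (hne : ∀ k m, g k (s k + 1) ≠ P m) (hna : ∀ k m, ¬ G.Adj (g k (s k + 1)) (P m)) :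
    Raw G P n w (fun k => s k + 1) g := by
  refine ⟨fun k i hi m => ?_, fun k i hi m => ?_, fun k => ?_, fun k => ?_, h.gap⟩
  · rcases Nat.le_succ_iff.1 hi with hi | rfl
    exacts [hg k i hi ▸ h.ne k i hi m, hne k m]
  · rcases Nat.le_succ_iff.1 hi with hi | rfl
    exacts [hg k i hi ▸ h.adj k i hi m, fun e => absurd e (hna k m)]
  · rw [hg k 0 (by omega)]
    exact h.left k
  · rw [hg k 0 (by omega)]
    exact h.right k

lemma Off.extend (h : Off G P n s f) (hg : ∀ k, ∀ i ≤ s k, g k i = f k i)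
    (hne : ∀ k m, g k (s k + 1) ≠ P m) (hna : ∀ k m, ¬ G.Adj (g k (s k + 1)) (P m)) :
    Off G P n (fun k => s k + 1) g := by
  refine ⟨fun k i hi m => ?_, fun k i hi m => ?_, h.gap⟩
  · rcases Nat.le_succ_iff.1 hi with hi | rfl
    exacts [hg k i hi ▸ h.ne k i hi m, hne k m]
  · rcases Nat.le_succ_iff.1 hi with hi | rfl
    exacts [hg k i hi ▸ h.adj k i hi m, iff_of_false (hna k m) (by omega)]

lemma On.extend (h : On G P n s f) (hg : ∀ k, ∀ i ≤ s k, g k i = f k i)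
    (hne : ∀ k m, g k (s k + 1) ≠ P m) (hna : ∀ k m, ¬ G.Adj (g k (s k + 1)) (P m)) :
    On G P n (fun k => s k + 1) g := by
  refine ⟨fun k i hi m => ?_, fun k i hi => ?_, h.gap⟩
  · rcases Nat.le_succ_iff.1 hi with hi | rfl
    exacts [hg k i hi ▸ h.eq k i hi m, iff_of_false (hne k m) (by omega)]
  · rcases Nat.le_succ_iff.1 hi with hi | rfl
    exacts [hg k i hi ▸ h.adj k i hi, fun _ m e => absurd e (hna k m)]

lemma On.congr (h : On G P n s f) (hg : ∀ k, ∀ i ≤ s k, g k i = f k i) : On G P n s g :=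
  ⟨fun k i hi => by rw [hg k i hi]; exact h.eq k i hi,
    fun k i hi => by rw [hg k i hi]; exact h.adj k i hi, h.gap⟩

lemma Off.congr (h : Off G P n s f) (hg : ∀ k, ∀ i ≤ s k, g k i = f k i) : Off G P n s g :=
  ⟨fun k i hi => by rw [hg k i hi]; exact h.ne k i hi,
    fun k i hi => by rw [hg k i hi]; exact h.adj k i hi, h.gap⟩

lemma revLegs_revLegs {k i : ℕ} (hi : i ≤ s k) : revLegs s (revLegs s f) k i = f k i := by
  rw [revLegs, revLegs_sub hi]

end Extend

lemma revLegs_consFn {a : ℕ → V} {s : ℕ → ℕ} {f : ℕ → ℕ → V} {k i : ℕ} (hi : i ≤ s k) :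
    revLegs (fun k => s k + 1) (fun k => consFn (a k) (f k)) k i = revLegs s f k i := by
  simp only [revLegs]
  rw [show s k + 1 - i = (s k - i) + 1 by omega, consFn_succ]

lemma revLegs_consFn_last {a : ℕ → V} {s : ℕ → ℕ} {f : ℕ → ℕ → V} {k : ℕ} :
    revLegs (fun k => s k + 1) (fun k => consFn (a k) (f k)) k (s k + 1) = a k := by
  simp only [revLegs]
  rw [Nat.sub_self, consFn_zero]

/-- `G` has an induced subgraph that is a ladder of one of the four kinds. -/
def HasLadder (G : SimpleGraph V) : Prop :=
  ∃ S : Set V, IsCleanLadder (G.induce S) ∨ IsLadder (G.induce S) ∨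
    IsDeltaLadder (G.induce S) ∨ IsNablaDeltaLadder (G.induce S)

/-- The `k`-th contact vertex sees only the window from `m k` to `w k` of `Q`. The windows are
disjoint and in order, so there are no crosses at all. -/
lemma hasLadder_of_contacts (hlf : ∀ w, (G.neighborSet w).Finite) {P Q : ℕ → V} (hP : IsRay G P)
    (hQ : IsRay G Q) (hPQ : ∀ i j, P i ≠ Q j) {n m w : ℕ → ℕ} (hn : ∀ k, n k < n (k + 1))
    (hm : ∀ k l, k < l → w k < m l) (hex : ∀ k, ∃ j, G.Adj (P (n k)) (Q j))
    (h : ∀ i j, G.Adj (P i) (Q j) → ∃ k, i = n k ∧ m k ≤ j ∧ j ≤ w k) : HasLadder G := by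
  have hn' := strictMono_nat_of_lt_succ hn
  obtain ⟨S, hS⟩ := exists_cleanLadder hlf hP hQ hPQ
    (fun N => ⟨n N, hn'.id_le N, hex N⟩) (by
      intro i j i' j' h1 h2 h3 h4
      obtain ⟨k, rfl, hk⟩ := h i j h1
      obtain ⟨l, rfl, hl⟩ := h i' j' h2
      have := hm _ _ (hn'.lt_iff_lt.1 h3)
      omega)
  exact ⟨S, .inl hS⟩

lemma hasLadder_of_ladder (h : ∃ S : Set V,
    IsLadder (G.induce S) ∨ IsDeltaLadder (G.induce S) ∨ IsNablaDeltaLadder (G.induce S)) :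
    HasLadder G :=
  h.imp fun _ h => .inr h

/-- The case of legs in normal form at the second ray. -/
lemma hasLadder_of_raw_right (hlf : ∀ w, (G.neighborSet w).Finite) {P Q : ℕ → V}
    (hP : IsRay G P) (hQ : IsRay G Q) (hPQ : ∀ i j, P i ≠ Q j)
    (hno : ∀ i j, ¬ G.Adj (P i) (Q j)) {n m w s : ℕ → ℕ} {f : ℕ → ℕ → V} (hL : Legs G s f)
    (h1 : Raw G P n w s f)
    (h2 : (On G Q m s (revLegs s f) ∧ ∀ k, 1 ≤ s k) ∨
      Off G Q m s (revLegs s f) ∧ ((∀ k, s k = 0) ∨ ∀ k, 1 ≤ s k)) : HasLadder G := by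
  obtain ⟨φ, hφ, ⟨n', hOn, hLc⟩ | ⟨n', hOff⟩ | ⟨n', P', hP', hOn, hPP⟩⟩ := h1.normalize hP hL
  · have hlast : ∀ k j, revLegs (fun k => s (φ k) + 1)
        (fun k => consFn (P (n' k)) (f (φ k))) k (s (φ k) + 1) ≠ Q j := fun k j => by
      rw [revLegs_consFn_last (s := fun k => s (φ k)) (f := fun k => f (φ k))]
      exact hPQ _ _
    have hlast' : ∀ k j, ¬ G.Adj (revLegs (fun k => s (φ k) + 1)
        (fun k => consFn (P (n' k)) (f (φ k))) k (s (φ k) + 1)) (Q j) := fun k j => by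
      rw [revLegs_consFn_last (s := fun k => s (φ k)) (f := fun k => f (φ k))]
      exact hno _ _
    have hg : ∀ k, ∀ i ≤ s (φ k), revLegs (fun k => s (φ k) + 1)
        (fun k => consFn (P (n' k)) (f (φ k))) k i = revLegs s f (φ k) i := fun k i hi =>
      revLegs_consFn (s := fun k => s (φ k)) (f := fun k => f (φ k)) hi
    refine hasLadder_of_ladder (exists_ladder hP hQ hPQ hLc (.inl hOn) ?_
      (m := fun k => m (φ k)) fun i j e => absurd e (hno i j))
    rcases h2 with ⟨h2, -⟩ | ⟨h2, -⟩
    · exact .inl ((h2.comp hφ).extend hg hlast hlast')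
    · exact .inr ((h2.comp hφ).extend hg hlast hlast')
  · refine hasLadder_of_ladder (exists_ladder hP hQ hPQ (hL.comp hφ) (.inr hOff) ?_
      (m := fun k => m (φ k)) fun i j e => absurd e (hno i j))
    rcases h2 with ⟨h2, -⟩ | ⟨h2, -⟩
    exacts [.inl (h2.comp hφ), .inr (h2.comp hφ)]
  -- The rerouted ray contains the first vertices of the legs, so it may have neighbours on `Q`: for
  -- a leg that ends on `Q` this happens only if the leg is a single edge, for a leg that ends off
  -- `Q` only if it is a single vertex.
  · have hend : ∀ k, revLegs s f k (s k) = f k 0 := fun k => by rw [revLegs, Nat.sub_self]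
    rcases h2 with ⟨h2, hs⟩ | ⟨h2, hs⟩
    · have hP'Q : ∀ i j, P' i ≠ Q j := by
        intro i j e
        rcases hPP i with ⟨i', e'⟩ | ⟨k, -, e'⟩
        · exact hPQ i' j (e'.symm.trans e)
        · have := ((h2.eq (φ k) _ le_rfl j).1 ((hend _).trans (e'.symm.trans e))).1
          have := hs (φ k)
          omega
      refine hasLadder_of_ladder (exists_ladder hP' hQ hP'Q (hL.comp hφ) (.inl hOn)
        (.inl (h2.comp hφ)) fun i j e => ?_)
      rcases hPP i with ⟨i', e'⟩ | ⟨k, hk, e'⟩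
      · exact absurd (e' ▸ e) (hno i' j)
      · rw [e', ← hend] at e
        obtain ⟨h3, rfl⟩ := h2.adj (φ k) _ le_rfl (hs _) j e
        refine ⟨k, h3, e', ?_⟩
        have := (h2.eq (φ k) 0 (by omega) _).2 ⟨rfl, rfl⟩
        rw [revLegs, Nat.sub_zero, h3] at this
        exact this.symm
    · have hP'Q : ∀ i j, P' i ≠ Q j := by
        intro i j e
        rcases hPP i with ⟨i', e'⟩ | ⟨k, -, e'⟩
        · exact hPQ i' j (e'.symm.trans e)
        · exact h2.ne (φ k) _ le_rfl j ((hend _).trans (e'.symm.trans e))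
      have hedge : ∀ i j, G.Adj (P' i) (Q j) → ∃ k, i = n' k ∧ s (φ k) = 0 ∧
          (j = m (φ k) ∨ j = m (φ k) + 1) := by
        intro i j e
        rcases hPP i with ⟨i', e'⟩ | ⟨k, hk, e'⟩
        · exact absurd (e' ▸ e) (hno i' j)
        · rw [e', ← hend] at e
          exact ⟨k, hk, (h2.adj (φ k) _ le_rfl j).1 e⟩
      -- Single-vertex legs have been absorbed by the rerouted ray, and what remains is a clean
      -- ladder; longer legs still form ties.
      rcases hs with hs | hs
      · refine hasLadder_of_contacts hlf hP' hQ hP'Q hOn.gap (m := fun k => m (φ k))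
          (w := fun k => m (φ k) + 1)
          (fun k l hkl => strictMono_add_of_gap (h2.comp hφ).gap hkl) (fun k => ⟨m (φ k), ?_⟩) fun i j e => ?_
        · rw [← (hOn.eq k 0 (by omega) (n' k)).2 ⟨rfl, rfl⟩]
          have := (h2.adj (φ k) 0 (by omega) (m (φ k))).2 ⟨rfl, .inl rfl⟩
          rwa [revLegs, hs] at this
        · obtain ⟨k, h3, -, h4⟩ := hedge i j e
          exact ⟨k, h3, by omega, by omega⟩
      · refine hasLadder_of_ladder (exists_ladder hP' hQ hP'Q (hL.comp hφ) (.inl hOn)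
          (.inr (h2.comp hφ)) fun i j e => ?_)
        obtain ⟨k, -, h3, -⟩ := hedge i j e
        have := hs (φ k)
        omega

/-- Two disjoint rays without edges between them and infinitely many legs that join them. -/
lemma hasLadder_of_raw (hlf : ∀ w, (G.neighborSet w).Finite) {P Q : ℕ → V}
    (hP : IsRay G P) (hQ : IsRay G Q) (hPQ : ∀ i j, P i ≠ Q j)
    (hno : ∀ i j, ¬ G.Adj (P i) (Q j)) {n w m w' s : ℕ → ℕ} {f : ℕ → ℕ → V} (hL : Legs G s f)
    (h1 : Raw G P n w s f) (h2 : Raw G Q m w' s (revLegs s f))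
    (hs : (∀ k, s k = 0) ∨ ∀ k, 1 ≤ s k) : HasLadder G := by
  have hno' : ∀ i j, ¬ G.Adj (Q i) (P j) := fun i j e => hno j i e.symm
  obtain ⟨φ, hφ, ⟨n', hOn, hLc⟩ | ⟨n', hOff⟩ | ⟨n', P', hP', hOn, hPP⟩⟩ := h1.normalize hP hL
  -- With the ends at `P` in normal form, the rays exchange roles and the ends at `Q` are treated
  -- next.
  · refine hasLadder_of_raw_right hlf hQ hP (fun i j => (hPQ j i).symm) hno' hLc.rev
      ((h2.comp hφ).extend (fun k i hi => ?_) (fun k j => ?_) fun k j => ?_)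
      (.inl ⟨hOn.congr fun k i hi => revLegs_revLegs hi, fun k => by omega⟩)
    · exact revLegs_consFn (s := fun k => s (φ k)) (f := fun k => f (φ k)) hi
    · rw [revLegs_consFn_last (s := fun k => s (φ k)) (f := fun k => f (φ k))]
      exact hPQ _ _
    · rw [revLegs_consFn_last (s := fun k => s (φ k)) (f := fun k => f (φ k))]
      exact hno _ _
  · refine hasLadder_of_raw_right hlf hQ hP (fun i j => (hPQ j i).symm) hno' (hL.comp hφ).rev
      (h2.comp hφ)
      (.inr ⟨hOff.congr fun k i hi => revLegs_revLegs (s := fun k => s (φ k))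
        (f := fun k => f (φ k)) hi, hs.imp (fun h k => h _) fun h k => h _⟩)
  · have hend : ∀ k, revLegs s f k (s k) = f k 0 := fun k => by rw [revLegs, Nat.sub_self]
    have hP'Q : ∀ i j, P' i ≠ Q j := by
      intro i j e
      rcases hPP i with ⟨i', e'⟩ | ⟨k, -, e'⟩
      · exact hPQ i' j (e'.symm.trans e)
      · exact h2.ne (φ k) _ le_rfl j ((hend _).trans (e'.symm.trans e))
    have hedge : ∀ i j, G.Adj (P' i) (Q j) → ∃ k, i = n' k ∧ s (φ k) = 0 ∧
        m (φ k) ≤ j ∧ j ≤ w' (φ k) := by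
      intro i j e
      rcases hPP i with ⟨i', e'⟩ | ⟨k, hk, e'⟩
      · exact absurd (e' ▸ e) (hno i' j)
      · rw [e', ← hend] at e
        exact ⟨k, hk, h2.adj (φ k) _ le_rfl j e⟩
    -- A single-vertex leg now lies on the rerouted ray and sees a whole window of `Q`, which gives
    -- a clean ladder; otherwise there are still no edges between the rays and the other ends can be
    -- treated.
    rcases hs with hs | hs
    · refine hasLadder_of_contacts hlf hP' hQ hP'Q hOn.gap (m := fun k => m (φ k))
        (w := fun k => w' (φ k)) (fun k l hkl => ?_) (fun k => ?_) fun i j e => ?_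
      · have := (h2.comp hφ).far hkl
        omega
      · rw [← (hOn.eq k 0 (by omega) (n' k)).2 ⟨rfl, rfl⟩]
        have := h2.left (φ k)
        rw [revLegs, hs] at this
        exact ⟨_, this⟩
      · obtain ⟨k, h3, -, h4⟩ := hedge i j e
        exact ⟨k, h3, h4⟩
    · refine hasLadder_of_raw_right hlf hQ hP' (fun i j => (hP'Q j i).symm) (fun i j e => ?_)
        (hL.comp hφ).rev (h2.comp hφ)
        (.inl ⟨hOn.congr fun k i hi => revLegs_revLegs (s := fun k => s (φ k))
          (f := fun k => f (φ k)) hi, fun k => hs _⟩)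
      obtain ⟨k, -, h3, -⟩ := hedge j i e.symm
      have := hs (φ k)
      omega

/-! ### One-ended sets -/

/-- The subgraph of `G` induced by `K` has only one end. -/
def OneEnded (G : SimpleGraph V) (K : Set V) : Prop :=
  ∀ F : Set V, F.Finite → ∃ F' : Set V, F'.Finite ∧
    ∀ u ∈ K \ F', ∀ v ∈ K \ F', Joined G (K \ F) u v

lemma IsRay.exists_notMem {P : ℕ → V} (hP : IsRay G P) {F : Set V} (hF : F.Finite) :
    ∃ i, P i ∉ F := by
  by_contra h
  push Not at h
  exact (Set.infinite_of_injective_forall_mem hP.1 h) hF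

/-- A path between the neighbourhoods of two rays that avoids a finite set. -/
lemma exists_leg {K : Set V} (hK : OneEnded G K) {A B : ℕ → V} (hA : IsRay G A) (hB : IsRay G B)
    (hAK : ∀ i, A i ∈ K) (hBK : ∀ i, B i ∈ K) (hAB : ∀ i j, A i ≠ B j) {N : ℕ}
    (hno : ∀ i j, N ≤ i → ¬ G.Adj (A i) (B j)) {F : Set V} (hF : F.Finite) :
    ∃ s f, (∀ i ≤ s, f i ∈ K ∧ f i ∉ F ∧ (∀ m, f i ≠ A m) ∧ ∀ m, f i ≠ B m) ∧
      IsInducedPath G s f ∧ (∃ m, G.Adj (f 0) (A (N + m))) ∧ (∃ m, G.Adj (f s) (B m)) ∧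
      (∀ i ≤ s, ∀ m, G.Adj (f i) (A (N + m)) → i = 0) ∧
      ∀ i ≤ s, ∀ m, G.Adj (f i) (B m) → i = s := by
  -- Removing the beginning of `A` as well makes the path leave `A` at a position from which no edge
  -- goes to `B`; hence it has at least one inner vertex.
  obtain ⟨F', hF', h⟩ := hK (F ∪ A '' Iio N) (hF.union ((finite_Iio N).image A))
  obtain ⟨a, ha⟩ := hA.exists_notMem hF'
  obtain ⟨b, hb⟩ := hB.exists_notMem hF'
  obtain ⟨t, g, hg, hgi, ⟨a', hga⟩, ⟨b', hgb⟩, h1, h2⟩ :=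
    (h (A a) ⟨hAK a, ha⟩ (B b) ⟨hBK b, hb⟩).exists_shortest (A := range A) (B := range B)
    ⟨a, rfl⟩ ⟨b, rfl⟩
  have hNa : N ≤ a' := by
    by_contra hlt
    exact (hg.1 0 (by omega)).2 (.inr ⟨a', by simpa using hlt, hga⟩)
  have ht : 2 ≤ t := by
    by_contra hlt
    rcases (by omega : t = 0 ∨ t = 1) with rfl | rfl
    · exact hAB _ _ (hga.trans hgb.symm)
    · have := hg.2 0 (by omega)
      rw [zero_add, ← hga, ← hgb] at this
      exact hno _ _ hNa this
  have hlink : IsLink G {x | x ∈ K ∧ x ∉ F ∧ (∀ m, x ≠ A m) ∧ ∀ m, x ≠ B m} (t - 2)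
      (fun i => g (i + 1)) := by
    refine ⟨fun i hi => ⟨(hg.1 _ (by omega)).1, fun hf => (hg.1 _ (by omega)).2 (.inl hf),
      fun m e => ?_, fun m e => ?_⟩, fun i hi => hg.2 _ (by omega)⟩
    · have := h1 (i + 1) (by omega) ⟨m, e.symm⟩
      omega
    · have := h2 (i + 1) (by omega) ⟨m, e.symm⟩
      omega
  have ha0 : G.Adj (g 1) (A (N + (a' - N))) := by
    rw [show N + (a' - N) = a' by omega, hga]
    exact (hg.2 0 (by omega)).symm
  have hb0 : G.Adj (g (t - 2 + 1)) (B b') := by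
    have := hg.2 (t - 1) (by omega)
    rwa [show t - 1 + 1 = t by omega, ← hgb, show t - 1 = t - 2 + 1 by omega] at this
  -- Shortening once more among the inner vertices leaves one end as the only vertex that sees `A`
  -- from position `N` on, and the other as the only one that sees `B`.
  obtain ⟨s, f, hf, hfi, h3, h4, h5, h6, -⟩ := exists_shortest_link hlink
    (A := {x | ∃ m, G.Adj x (A (N + m))}) (B := {x | ∃ m, G.Adj x (B m)}) ⟨_, ha0⟩ ⟨_, hb0⟩
  exact ⟨s, f, hf.1, hfi, h3, h4, fun i hi m e => h5 i hi ⟨m, e⟩, fun i hi m e => h6 i hi ⟨m, e⟩⟩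

lemma finite_contacts (hlf : ∀ w, (G.neighborSet w).Finite) {A : ℕ → V} (hA : IsRay G A) (x : V) :
    {m | G.Adj x (A m)}.Finite :=
  Set.Finite.of_finite_image ((hlf x).subset (by rintro _ ⟨m, hm, rfl⟩; exact hm)) hA.1.injOn

/-- A vertex outside this set attaches to the ray only at positions more than one beyond every
attachment of `x`. -/
lemma finite_near (hlf : ∀ w, (G.neighborSet w).Finite) {A : ℕ → V} (hA : IsRay G A) (x : V) :
    {y | ∃ m, G.Adj x (A m) ∧ ∃ j ≤ m + 1, G.Adj (A j) y}.Finite := by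
  refine ((finite_contacts hlf hA x).biUnion fun m _ => (finite_Iic (m + 1)).biUnion
    fun j _ => hlf (A j)).subset ?_
  rintro y ⟨m, hm, j, hj, e⟩
  exact mem_biUnion hm (mem_biUnion (mem_Iic.2 hj) e)

/-- Two suitable disjoint rays in a one-ended set lead to a ladder. -/
theorem hasLadder_of_rays (hlf : ∀ w, (G.neighborSet w).Finite) {K : Set V} (hK : OneEnded G K)
    {A B : ℕ → V} (hA : IsRay G A) (hB : IsRay G B) (hAK : ∀ i, A i ∈ K) (hBK : ∀ i, B i ∈ K)
    (hAB : ∀ i j, A i ≠ B j) (hc : CrossesDegenerate G A B) : HasLadder G := by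
  classical
  by_cases hinf : ∀ N, ∃ i, N ≤ i ∧ ∃ j, G.Adj (A i) (B j)
  · obtain ⟨S, hS⟩ := exists_cleanLadder hlf hA hB hAB hinf hc
    exact ⟨S, .inl hS⟩
  push Not at hinf
  obtain ⟨N, hN⟩ := hinf
  have hA' := hA.shift N
  set A' : ℕ → V := fun i => A (N + i) with hA'd
  set Good : ℕ × (ℕ → V) → Prop := fun p =>
    (∀ i ≤ p.1, p.2 i ∈ K ∧ (∀ m, p.2 i ≠ A m) ∧ ∀ m, p.2 i ≠ B m) ∧
    IsInducedPath G p.1 p.2 ∧ (∃ m, G.Adj (p.2 0) (A' m)) ∧ (∃ m, G.Adj (p.2 p.1) (B m)) ∧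
      (∀ i ≤ p.1, ∀ m, G.Adj (p.2 i) (A' m) → i = 0) ∧
      ∀ i ≤ p.1, ∀ m, G.Adj (p.2 i) (B m) → i = p.1 with hGood
  set Rel : ℕ × (ℕ → V) → ℕ × (ℕ → V) → Prop := fun p q =>
    (∀ i ≤ p.1, ∀ j ≤ q.1, p.2 i ≠ q.2 j ∧ ¬ G.Adj (p.2 i) (q.2 j)) ∧
    (∀ m m', G.Adj (p.2 0) (A' m) → G.Adj (q.2 0) (A' m') → m + 1 < m') ∧
    ∀ m m', G.Adj (p.2 p.1) (B m) → G.Adj (q.2 q.1) (B m') → m + 1 < m' with hRel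
  have key : ∀ T : Finset (ℕ × (ℕ → V)), (∀ p ∈ T, Good p) → ∃ q, Good q ∧ ∀ p ∈ T, Rel p q := by
    intro T _
    -- A new leg that avoids this set is disjoint from the earlier legs, has no edges to them, and
    -- attaches beyond them on both rays.
    have hfin : (⋃ p ∈ T, (⋃ i ∈ Iic p.1, insert (p.2 i) (G.neighborSet (p.2 i))) ∪
        ({y | ∃ m, G.Adj (p.2 0) (A' m) ∧ ∃ j ≤ m + 1, G.Adj (A' j) y} ∪
        {y | ∃ m, G.Adj (p.2 p.1) (B m) ∧ ∃ j ≤ m + 1, G.Adj (B j) y})).Finite := by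
      refine T.finite_toSet.biUnion fun p _ => ?_
      exact ((finite_Iic _).biUnion fun i _ => (hlf _).insert _).union
        ((finite_near hlf hA' _).union (finite_near hlf hB _))
    obtain ⟨s, f, h1, h2⟩ := exists_leg hK hA hB hAK hBK hAB (fun i j hi => hN i hi j) hfin
    refine ⟨(s, f), ⟨fun i hi => ⟨(h1 i hi).1, (h1 i hi).2.2⟩, h2⟩, fun p hp =>
      ⟨fun i hi j hj => ⟨fun e => ?_, fun e => ?_⟩, fun m m' e e' => ?_, fun m m' e e' => ?_⟩⟩
    · exact (h1 j hj).2.1 (mem_biUnion hp (.inl (mem_biUnion (mem_Iic.2 hi) (.inl e.symm))))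
    · exact (h1 j hj).2.1 (mem_biUnion hp (.inl (mem_biUnion (mem_Iic.2 hi) (.inr e))))
    · by_contra hlt
      exact (h1 0 (by omega)).2.1 (mem_biUnion hp (.inr (.inl ⟨m, e, m', by omega, e'.symm⟩)))
    · by_contra hlt
      exact (h1 s le_rfl).2.1 (mem_biUnion hp (.inr (.inr ⟨m, e, m', by omega, e'.symm⟩)))
  obtain ⟨p, hp, hpp⟩ := exists_seq_of_forall_finset_exists Good Rel key
  obtain ⟨φ, hφ, hs⟩ : ∃ φ : ℕ → ℕ, StrictMono φ ∧
      ((∀ k, (p (φ k)).1 = 0) ∨ ∀ k, 1 ≤ (p (φ k)).1) := by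
    rcases exists_subseq_or (fun k => Nat.eq_zero_or_pos (p k).1) with ⟨φ, h, h'⟩ | ⟨φ, h, h'⟩
    exacts [⟨φ, h, .inl h'⟩, ⟨φ, h, .inr h'⟩]
  have hleg : Legs G (fun k => (p k).1) (fun k => (p k).2) := by
    refine ⟨fun k => (hp k).2.1, fun k l hkl i hi j hj => ?_, fun k l hkl i hi j hj => ?_⟩
    · rcases lt_or_gt_of_ne hkl with h | h
      exacts [((hpp k l h).1 i hi j hj).1, ((hpp l k h).1 j hj i hi).1.symm]
    · rcases lt_or_gt_of_ne hkl with h | h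
      exacts [((hpp k l h).1 i hi j hj).2, fun e => ((hpp l k h).1 j hj i hi).2 e.symm]
  obtain ⟨n, w, hraw⟩ : ∃ n w, Raw G A' n w (fun k => (p k).1) (fun k => (p k).2) :=
    exists_raw (fun k i hi m => ((hp k).1 i hi).2.1 _) (fun k => (hp k).2.2.2.2.1)
      (fun k => (hp k).2.2.1) fun k m m' e e' => (hpp k (k + 1) (by omega)).2.1 m m' e e'
  obtain ⟨n', w', hraw'⟩ : ∃ n w, Raw G B n w (fun k => (p k).1)
      (revLegs (fun k => (p k).1) (fun k => (p k).2)) := by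
    refine exists_raw (fun k i hi m => ((hp k).1 _ (Nat.sub_le _ _)).2.2 _) (fun k i hi m e => ?_)
      (fun k => (hp k).2.2.2.1) fun k m m' e e' => (hpp k (k + 1) (by omega)).2.2 m m' e e'
    have hi' := (hp k).2.2.2.2.2 _ (Nat.sub_le _ _) m e
    omega
  exact hasLadder_of_raw hlf hA' hB (fun i j => hAB _ _) (fun i j => hN _ (by omega) j)
    (hleg.comp hφ) (hraw.comp hφ) (hraw'.comp hφ) hs

/-! ### Pairs of disjoint rays with few vertices -/

/-- Disjoint one-way infinite paths with all vertices in `K`. -/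
structure IsRayPair (G : SimpleGraph V) (K : Set V) (A B : ℕ → V) : Prop where
  inj : Function.Injective A
  inj' : Function.Injective B
  adj : ∀ n, G.Adj (A n) (A (n + 1))
  adj' : ∀ n, G.Adj (B n) (B (n + 1))
  mem : ∀ n, A n ∈ K
  mem' : ∀ n, B n ∈ K
  disj : ∀ n m, A n ≠ B m

lemma IsRayPair.symm {K : Set V} {A B : ℕ → V} (h : IsRayPair G K A B) : IsRayPair G K B A :=
  ⟨h.inj', h.inj, h.adj', h.adj, h.mem', h.mem, fun n m => (h.disj m n).symm⟩

/-- The sequence `A 0, …, A i, C j, C (j + 1), …`. -/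
def splice (A : ℕ → V) (i : ℕ) (C : ℕ → V) (j : ℕ) : ℕ → V :=
  fun n => if n ≤ i then A n else C (n - (i + 1) + j)

lemma splice_zero (A : ℕ → V) (i : ℕ) (C : ℕ → V) (j : ℕ) : splice A i C j 0 = A 0 :=
  if_pos (Nat.zero_le _)

lemma splice_cases (A : ℕ → V) (i : ℕ) (C : ℕ → V) (j n : ℕ) :
    (n ≤ i ∧ splice A i C j n = A n) ∨
      (i < n ∧ ∃ m, j ≤ m ∧ m + (i + 1) = n + j ∧ splice A i C j n = C m) := by
  rcases le_or_gt n i with h | h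
  · exact .inl ⟨h, if_pos h⟩
  · exact .inr ⟨h, n - (i + 1) + j, by omega, by omega, if_neg (by omega)⟩

lemma splice_adj {A C : ℕ → V} {i j : ℕ} (hA : ∀ n, G.Adj (A n) (A (n + 1)))
    (hC : ∀ n, G.Adj (C n) (C (n + 1))) (h : G.Adj (A i) (C j)) (n : ℕ) :
    G.Adj (splice A i C j n) (splice A i C j (n + 1)) := by
  rcases splice_cases A i C j n with ⟨h1, e1⟩ | ⟨h1, m, h2, h3, e1⟩ <;>
    rcases splice_cases A i C j (n + 1) with ⟨h1', e1'⟩ | ⟨h1', m', h2', h3', e1'⟩ <;>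
    rw [e1, e1']
  · exact hA n
  · obtain rfl : n = i := by omega
    obtain rfl : m' = j := by omega
    exact h
  · omega
  · obtain rfl : m' = m + 1 := by omega
    exact hC m

lemma splice_injective {A C : ℕ → V} {i j : ℕ} (hA : Function.Injective A)
    (hC : Function.Injective C) (h : ∀ n ≤ i, ∀ m, j ≤ m → A n ≠ C m) :
    Function.Injective (splice A i C j) := by
  intro n n' e
  rcases splice_cases A i C j n with ⟨h1, e1⟩ | ⟨h1, m, h2, h3, e1⟩ <;>
    rcases splice_cases A i C j n' with ⟨h1', e1'⟩ | ⟨h1', m', h2', h3', e1'⟩ <;>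
    rw [e1, e1'] at e
  · exact hA e
  · exact absurd e (h n h1 m' h2')
  · exact absurd e.symm (h n' h1' m h2)
  · have := hC e
    omega

lemma IsRayPair.shortcut {K : Set V} {A B : ℕ → V} (h : IsRayPair G K A B) {i j : ℕ}
    (hij : i < j) (hadj : G.Adj (A i) (A j)) : IsRayPair G K (splice A i A j) B := by
  have hA : ∀ n, ∃ m, splice A i A j n = A m := fun n => by
    rcases splice_cases A i A j n with ⟨-, e⟩ | ⟨-, m, -, -, e⟩
    exacts [⟨_, e⟩, ⟨_, e⟩]
  refine ⟨splice_injective h.inj h.inj fun n hn m hm e => ?_, h.inj', splice_adj h.adj h.adj hadj,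
    h.adj', fun n => ?_, h.mem', fun n m => ?_⟩
  · have := h.inj e
    omega
  · obtain ⟨m, e⟩ := hA n
    exact e ▸ h.mem m
  · obtain ⟨m', e⟩ := hA n
    exact e ▸ h.disj m' m

/-- The rays exchange tails along the two edges of the cross. The vertices strictly inside the two
spans are lost, and no vertices are gained. -/
lemma IsRayPair.switch {K : Set V} {A B : ℕ → V} (h : IsRayPair G K A B) {i j i' j' : ℕ}
    (hi : i < i') (hj : j' < j) (hadj : G.Adj (A i) (B j)) (hadj' : G.Adj (A i') (B j')) :
    IsRayPair G K (splice A i B j) (splice B j' A i') := by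
  refine ⟨splice_injective h.inj h.inj' fun n _ m _ => h.disj n m,
    splice_injective h.inj' h.inj fun n _ m _ => (h.disj m n).symm,
    splice_adj h.adj h.adj' hadj, splice_adj h.adj' h.adj hadj'.symm, fun n => ?_, fun n => ?_,
    fun n n' => ?_⟩
  · rcases splice_cases A i B j n with ⟨-, e⟩ | ⟨-, m, -, -, e⟩ <;> rw [e]
    exacts [h.mem _, h.mem' _]
  · rcases splice_cases B j' A i' n with ⟨-, e⟩ | ⟨-, m, -, -, e⟩ <;> rw [e]
    exacts [h.mem' _, h.mem _]
  · rcases splice_cases A i B j n with ⟨h1, e⟩ | ⟨-, m, h1, -, e⟩ <;>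
      rcases splice_cases B j' A i' n' with ⟨h2, e'⟩ | ⟨-, m', h2, -, e'⟩ <;> rw [e, e']
    · exact h.disj _ _
    · intro e
      have := h.inj e
      omega
    · intro e
      have := h.inj' e
      omega
    · exact (h.disj _ _).symm

/-- Sequences that start with a given vertex and go along edges have a pointwise limit in a
locally finite graph. -/
lemma exists_limit (hlf : ∀ w, (G.neighborSet w).Finite) {ι : Type*} (U : Ultrafilter ι)
    {A : ι → ℕ → V} {a : V} (h0 : ∀ i, A i 0 = a) (hadj : ∀ i n, G.Adj (A i n) (A i (n + 1))) :
    ∃ A' : ℕ → V, ∀ n, ∀ᶠ i in (U : Filter ι), A i n = A' n := by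
  have key : ∀ n, ∃ x, ∀ᶠ i in (U : Filter ι), A i n = x := by
    intro n
    induction n with
    | zero => exact ⟨a, Eventually.of_forall h0⟩
    | succ n ih =>
      obtain ⟨x, hx⟩ := ih
      obtain ⟨y, -, hy⟩ := (Ultrafilter.eventually_exists_mem_iff (hlf x) (f := U)
        (P := fun y i => A i (n + 1) = y)).1 (hx.mono fun i hi =>
          ⟨_, by rw [← hi]; exact hadj i n, rfl⟩)
      exact ⟨y, hy⟩
  choose A' hA' using key
  exact ⟨A', hA'⟩

/-- The number of vertices of `F` on `A` or `B`. -/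
noncomputable def pairCount (F : Finset V) (A B : ℕ → V) : ℕ :=
  {x | x ∈ F ∧ ((∃ n, A n = x) ∨ ∃ n, B n = x)}.ncard

lemma pairCount_lt {F : Finset V} {A B A' B' : ℕ → V}
    (hsub : ∀ x, ((∃ n, A' n = x) ∨ ∃ n, B' n = x) → (∃ n, A n = x) ∨ ∃ n, B n = x) {x : V}
    (hxF : x ∈ F) (hx : (∃ n, A n = x) ∨ ∃ n, B n = x) (hx' : ∀ n, A' n ≠ x)
    (hx'' : ∀ n, B' n ≠ x) : pairCount F A' B' < pairCount F A B := by
  refine Set.ncard_lt_ncard ⟨fun y hy => ⟨hy.1, hsub y hy.2⟩, fun h => ?_⟩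
    (F.finite_toSet.subset fun y hy => hy.1)
  rcases (h ⟨hxF, hx⟩).2 with ⟨n, e⟩ | ⟨n, e⟩
  exacts [hx' n e, hx'' n e]

/-- Among the pairs of disjoint rays there is one without shortcuts and without proper crosses. -/
theorem IsRayPair.exists_tight (hlf : ∀ w, (G.neighborSet w).Finite) {K : Set V} {A₀ B₀ : ℕ → V}
    (h : IsRayPair G K A₀ B₀) : ∃ A B, IsRay G A ∧ IsRay G B ∧ (∀ i, A i ∈ K) ∧ (∀ i, B i ∈ K) ∧
      (∀ i j, A i ≠ B j) ∧ CrossesDegenerate G A B := by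
  classical
  -- A pair of rays has infinitely many vertices, so only those in a finite set `F` are counted. The
  -- initial vertices are fixed in order to have limits.
  have hmin : ∀ F : Finset V, ∃ A B, (IsRayPair G K A B ∧ A 0 = A₀ 0 ∧ B 0 = B₀ 0) ∧
      ∀ A' B', IsRayPair G K A' B' → A' 0 = A₀ 0 → B' 0 = B₀ 0 →
        pairCount F A B ≤ pairCount F A' B' := by
    intro F
    have hex : ∃ c A B, (IsRayPair G K A B ∧ A 0 = A₀ 0 ∧ B 0 = B₀ 0) ∧ pairCount F A B = c :=
      ⟨_, A₀, B₀, ⟨h, rfl, rfl⟩, rfl⟩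
    obtain ⟨A, B, h1, h2⟩ := Nat.find_spec hex
    exact ⟨A, B, h1, fun A' B' h3 h4 h5 => h2 ▸ Nat.find_min' hex ⟨A', B', ⟨h3, h4, h5⟩, rfl⟩⟩
  choose A B hAB hle using hmin
  -- Along this ultrafilter the minimizing pairs converge pointwise. Any finite part of the limit
  -- agrees with the minimizing pair of some `F` that contains a prescribed finite set.
  set U : Ultrafilter (Finset V) := Ultrafilter.of atTop with hU
  obtain ⟨A', hA'⟩ := exists_limit hlf U (fun F => (hAB F).2.1) (fun F => (hAB F).1.adj)
  obtain ⟨B', hB'⟩ := exists_limit hlf U (fun F => (hAB F).2.2) (fun F => (hAB F).1.adj')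
  have key : ∀ (N : ℕ) (E : Finset V), ∃ F, E ⊆ F ∧ ∀ n ≤ N, A F n = A' n ∧ B F n = B' n := by
    intro N E
    have h1 : ∀ᶠ F in (U : Filter (Finset V)), ∀ n ∈ Iic N, A F n = A' n ∧ B F n = B' n :=
      (Filter.eventually_all_finite (finite_Iic N)).2 fun n _ => (hA' n).and (hB' n)
    have h2 : ∀ᶠ F in (U : Filter (Finset V)), E ⊆ F :=
      (Ultrafilter.of_le atTop) (eventually_ge_atTop E)
    obtain ⟨F, h3, h4⟩ := (h1.and h2).exists
    exact ⟨F, h4, h3⟩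
  have hpair : IsRayPair G K A' B' := by
    refine ⟨fun i j e => ?_, fun i j e => ?_, fun n => ?_, fun n => ?_, fun n => ?_, fun n => ?_,
      fun n m e => ?_⟩
    · obtain ⟨F, -, hF⟩ := key (max i j) ∅
      rw [← (hF i (le_max_left _ _)).1, ← (hF j (le_max_right _ _)).1] at e
      exact (hAB F).1.inj e
    · obtain ⟨F, -, hF⟩ := key (max i j) ∅
      rw [← (hF i (le_max_left _ _)).2, ← (hF j (le_max_right _ _)).2] at e
      exact (hAB F).1.inj' e
    · obtain ⟨F, -, hF⟩ := key (n + 1) ∅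
      rw [← (hF n (by omega)).1, ← (hF (n + 1) (by omega)).1]
      exact (hAB F).1.adj n
    · obtain ⟨F, -, hF⟩ := key (n + 1) ∅
      rw [← (hF n (by omega)).2, ← (hF (n + 1) (by omega)).2]
      exact (hAB F).1.adj' n
    · obtain ⟨F, -, hF⟩ := key n ∅
      rw [← (hF n (by omega)).1]
      exact (hAB F).1.mem n
    · obtain ⟨F, -, hF⟩ := key n ∅
      rw [← (hF n (by omega)).2]
      exact (hAB F).1.mem' n
    · obtain ⟨F, -, hF⟩ := key (max n m) ∅
      rw [← (hF n (le_max_left _ _)).1, ← (hF m (le_max_right _ _)).2] at e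
      exact (hAB F).1.disj n m e
  have hshort : ∀ i j, G.Adj (A' i) (A' j) → i < j → j = i + 1 := by
    intro i j e hij
    by_contra hne
    -- A shortcut of the limit is one of this minimizing pair, and taking it loses a vertex of `F`.
    obtain ⟨F, hE, hF⟩ := key j {A' (i + 1)}
    rw [← (hF i (by omega)).1, ← (hF j le_rfl).1] at e
    have hxF : A F (i + 1) ∈ F := by
      rw [(hF (i + 1) (by omega)).1]
      exact hE (Finset.mem_singleton_self _)
    refine absurd (hle F _ _ ((hAB F).1.shortcut hij e) ?_ (hAB F).2.2)
      (not_le.2 (pairCount_lt ?_ hxF (.inl ⟨_, rfl⟩) ?_ fun n => ((hAB F).1.disj _ _).symm))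
    · rw [splice_zero, (hAB F).2.1]
    · rintro x (⟨n, rfl⟩ | h)
      · rcases splice_cases (A F) i (A F) j n with ⟨-, e⟩ | ⟨-, m, -, -, e⟩
        exacts [.inl ⟨_, e.symm⟩, .inl ⟨_, e.symm⟩]
      · exact .inr h
    · intro n hn
      rcases splice_cases (A F) i (A F) j n with ⟨h1, e⟩ | ⟨-, m, h1, -, e⟩ <;> rw [e] at hn
      · have := (hAB F).1.inj hn
        omega
      · have := (hAB F).1.inj hn
        omega
  have hshort' : ∀ i j, G.Adj (B' i) (B' j) → i < j → j = i + 1 := by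
    intro i j e hij
    by_contra hne
    obtain ⟨F, hE, hF⟩ := key j {B' (i + 1)}
    rw [← (hF i (by omega)).2, ← (hF j le_rfl).2] at e
    have hxF : B F (i + 1) ∈ F := by
      rw [(hF (i + 1) (by omega)).2]
      exact hE (Finset.mem_singleton_self _)
    refine absurd (hle F _ _ ((hAB F).1.symm.shortcut hij e).symm (hAB F).2.1 ?_)
      (not_le.2 (pairCount_lt ?_ hxF (.inr ⟨_, rfl⟩) (fun n => (hAB F).1.disj _ _) ?_))
    · rw [splice_zero, (hAB F).2.2]
    · rintro x (h | ⟨n, rfl⟩)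
      · exact .inl h
      · rcases splice_cases (B F) i (B F) j n with ⟨-, e⟩ | ⟨-, m, -, -, e⟩
        exacts [.inr ⟨_, e.symm⟩, .inr ⟨_, e.symm⟩]
    · intro n hn
      rcases splice_cases (B F) i (B F) j n with ⟨h1, e⟩ | ⟨-, m, h1, -, e⟩ <;> rw [e] at hn
      · have := (hAB F).1.inj' hn
        omega
      · have := (hAB F).1.inj' hn
        omega
  have hray : ∀ {C : ℕ → V}, Function.Injective C → (∀ n, G.Adj (C n) (C (n + 1))) →
      (∀ i j, G.Adj (C i) (C j) → i < j → j = i + 1) → IsRay G C := by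
    intro C h1 h2 h3
    refine ⟨h1, fun i j => ⟨fun e => ?_, ?_⟩⟩
    · rcases lt_trichotomy i j with h | rfl | h
      exacts [.inl (h3 i j e h), absurd e (G.irrefl), .inr (h3 j i e.symm h)]
    · rintro (rfl | rfl)
      exacts [h2 _, (h2 _).symm]
  refine ⟨A', B', hray hpair.inj hpair.adj hshort, hray hpair.inj' hpair.adj' hshort', hpair.mem,
    hpair.mem', hpair.disj, fun i j i' j' e e' hi hj => ?_⟩
  by_contra hne
  obtain ⟨F, hE, hF⟩ := key (max i' j) {A' (i + 1), B' (j' + 1)}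
  have hA1 : ∀ n ≤ i', A F n = A' n := fun n hn => (hF n (hn.trans (le_max_left _ _))).1
  have hB1 : ∀ n ≤ j, B F n = B' n := fun n hn => (hF n (hn.trans (le_max_right _ _))).2
  rw [← hA1 i hi.le, ← hB1 j le_rfl] at e
  rw [← hA1 i' le_rfl, ← hB1 j' hj.le] at e'
  have hlt : pairCount F (splice (A F) i (B F) j) (splice (B F) j' (A F) i') <
      pairCount F (A F) (B F) := by
    have hsub : ∀ x, ((∃ n, splice (A F) i (B F) j n = x) ∨
        ∃ n, splice (B F) j' (A F) i' n = x) → (∃ n, A F n = x) ∨ ∃ n, B F n = x := by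
      rintro x (⟨n, rfl⟩ | ⟨n, rfl⟩)
      · rcases splice_cases (A F) i (B F) j n with ⟨-, e⟩ | ⟨-, m, -, -, e⟩
        exacts [.inl ⟨_, e.symm⟩, .inr ⟨_, e.symm⟩]
      · rcases splice_cases (B F) j' (A F) i' n with ⟨-, e⟩ | ⟨-, m, -, -, e⟩
        exacts [.inr ⟨_, e.symm⟩, .inl ⟨_, e.symm⟩]
    -- In a nondegenerate cross one of the spans has an inner vertex. Both candidates were put into
    -- `F`, and the switch loses one of them.
    by_cases hii : i' = i + 1
    · have hjj : j' + 1 < j := by omega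
      have hxF : B F (j' + 1) ∈ F := by
        rw [hB1 _ hjj.le]
        exact hE (by simp)
      refine pairCount_lt hsub hxF (.inr ⟨_, rfl⟩) (fun n hn => ?_) (fun n hn => ?_)
      · rcases splice_cases (A F) i (B F) j n with ⟨-, e⟩ | ⟨-, m, h1, -, e⟩ <;> rw [e] at hn
        · exact (hAB F).1.disj _ _ hn
        · have := (hAB F).1.inj' hn
          omega
      · rcases splice_cases (B F) j' (A F) i' n with ⟨h1, e⟩ | ⟨-, m, -, -, e⟩ <;> rw [e] at hn
        · have := (hAB F).1.inj' hn
          omega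
        · exact (hAB F).1.disj _ _ hn
    · have hxF : A F (i + 1) ∈ F := by
        rw [hA1 _ (by omega)]
        exact hE (by simp)
      refine pairCount_lt hsub hxF (.inl ⟨_, rfl⟩) (fun n hn => ?_) (fun n hn => ?_)
      · rcases splice_cases (A F) i (B F) j n with ⟨h1, e⟩ | ⟨-, m, -, -, e⟩ <;> rw [e] at hn
        · have := (hAB F).1.inj hn
          omega
        · exact (hAB F).1.disj _ _ hn.symm
      · rcases splice_cases (B F) j' (A F) i' n with ⟨-, e⟩ | ⟨-, m, h1, -, e⟩ <;> rw [e] at hn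
        · exact (hAB F).1.disj _ _ hn.symm
        · have := (hAB F).1.inj hn
          omega
  refine absurd (hle F _ _ ((hAB F).1.switch hi hj e e') ?_ ?_) (not_le.2 hlt)
  · rw [splice_zero, (hAB F).2.1]
  · rw [splice_zero, (hAB F).2.2]

/-- In a locally finite graph, two disjoint rays in a one-ended set lead to a ladder. -/
theorem IsRayPair.hasLadder (hlf : ∀ w, (G.neighborSet w).Finite) {K : Set V}
    (hK : OneEnded G K) {A B : ℕ → V} (h : IsRayPair G K A B) : HasLadder G := by
  obtain ⟨A', B', hA, hB, hAK, hBK, hAB, hc⟩ := h.exists_tight hlf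
  exact hasLadder_of_rays hlf hK hA hB hAK hBK hAB hc

/-! ### Connected sets of vertices -/

/-- Any two vertices of `S` are joined within `S`. -/
def Linked (G : SimpleGraph V) (S : Set V) : Prop :=
  ∀ u ∈ S, ∀ v ∈ S, Joined G S u v

lemma Linked.connected {S : Set V} (h : Linked G S) (hne : S.Nonempty) :
    (G.induce S).Connected := by
  have : Nonempty S := hne.to_subtype
  refine ⟨fun u v => ?_⟩
  obtain ⟨p, hp⟩ := h u u.2 v v.2
  exact ⟨p.induce S hp⟩

lemma joined_of_reachable {S : Set V} {u v : S} (h : (G.induce S).Reachable u v) :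
    Joined G S u v := by
  obtain ⟨p⟩ := h
  induction p with
  | nil => exact .refl (Subtype.coe_prop _)
  | cons h _ ih => exact .trans (.of_adj h (Subtype.coe_prop _) (Subtype.coe_prop _)) ih

lemma IsLink.linked {I : Set V} {s : ℕ} {f : ℕ → V} (h : IsLink G I s f) :
    Linked G (f '' Iic s) := by
  have h' : IsLink G (f '' Iic s) s f := ⟨fun i hi => ⟨i, hi, rfl⟩, h.2⟩
  rintro _ ⟨i, hi, rfl⟩ _ ⟨j, hj, rfl⟩
  exact h'.joined hi hj

lemma Linked.union {S T : Set V} (hS : Linked G S) (hT : Linked G T)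
    (hne : (S ∩ T).Nonempty) : Linked G (S ∪ T) := by
  obtain ⟨x, hxS, hxT⟩ := hne
  have key : ∀ u ∈ S ∪ T, Joined G (S ∪ T) u x := by
    rintro u (hu | hu)
    exacts [(hS u hu x hxS).mono subset_union_left, (hT u hu x hxT).mono subset_union_right]
  exact fun u hu v hv => (key u hu).trans (key v hv).symm

lemma linked_segment {R : ℕ → V} (hR : ∀ n, G.Adj (R n) (R (n + 1))) (a b : ℕ) :
    Linked G (R '' Icc a b) := by
  have key : ∀ m, a ≤ m → m ≤ b → Joined G (R '' Icc a b) (R a) (R m) := by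
    intro m hm
    induction m, hm using Nat.le_induction with
    | base => exact fun h => .refl ⟨a, ⟨le_rfl, h⟩, rfl⟩
    | succ m hm ih =>
      exact fun h => (ih (by omega)).trans (.of_adj (hR m) ⟨m, ⟨hm, by omega⟩, rfl⟩
        ⟨m + 1, ⟨by omega, h⟩, rfl⟩)
  rintro _ ⟨i, hi, rfl⟩ _ ⟨j, hj, rfl⟩
  exact (key i hi.1 hi.2).symm.trans (key j hj.1 hj.2)

lemma linked_chain {Z : ℕ → Set V} (h : ∀ k, Linked G (Z k))
    (hne : ∀ k, (Z k ∩ Z (k + 1)).Nonempty) (N : ℕ) : Linked G {x | ∃ k, N ≤ k ∧ x ∈ Z k} := by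
  have hsub : ∀ k, N ≤ k → Z k ⊆ {x | ∃ k, N ≤ k ∧ x ∈ Z k} := fun k hk x hx => ⟨k, hk, hx⟩
  obtain ⟨z, hz, -⟩ := hne N
  have key : ∀ k, N ≤ k → ∀ x ∈ Z k, Joined G {x | ∃ k, N ≤ k ∧ x ∈ Z k} z x := by
    intro k hk
    induction k, hk using Nat.le_induction with
    | base => exact fun x hx => (h N z hz x hx).mono (hsub N le_rfl)
    | succ k hk ih =>
      intro x hx
      obtain ⟨y, hy, hy'⟩ := hne k
      exact (ih y hy).trans ((h (k + 1) y hy' x hx).mono (hsub _ (by omega)))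
  rintro u ⟨k, hk, hu⟩ v ⟨l, hl, hv⟩
  exact (key k hk u hu).symm.trans (key l hl v hv)

/-- A chain of finite connected sets is one-ended. -/
lemma oneEnded_chain {Z : ℕ → Set V} (h : ∀ k, Linked G (Z k))
    (hne : ∀ k, (Z k ∩ Z (k + 1)).Nonempty) (hfin : ∀ k, (Z k).Finite)
    (hlf : ∀ x, {k | x ∈ Z k}.Finite) : OneEnded G {x | ∃ k, x ∈ Z k} := by
  intro F hF
  -- Beyond index `N` the sets of the chain miss `F`, and their union is still connected.
  obtain ⟨N, hN⟩ := (hF.biUnion fun x _ => hlf x).bddAbove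
  have hN' : ∀ k, N + 1 ≤ k → ∀ x ∈ Z k, x ∉ F := fun k hk x hx hxF => by
    have := hN (mem_biUnion hxF hx)
    omega
  refine ⟨⋃ k ∈ Iic N, Z k, (finite_Iic N).biUnion fun k _ => hfin k, ?_⟩
  rintro u ⟨⟨k, hu⟩, hu'⟩ v ⟨⟨l, hv⟩, hv'⟩
  have hk : N + 1 ≤ k := by
    by_contra hlt
    exact hu' (mem_biUnion (mem_Iic.2 (by omega)) hu)
  have hl : N + 1 ≤ l := by
    by_contra hlt
    exact hv' (mem_biUnion (mem_Iic.2 (by omega)) hv)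
  refine (linked_chain h hne (N + 1) u ⟨k, hk, hu⟩ v ⟨l, hl, hv⟩).mono ?_
  rintro x ⟨m, hm, hx⟩
  exact ⟨⟨m, hx⟩, hN' m hm x hx⟩

/-- In a locally finite graph, the star–comb lemma yields a comb. -/
lemma exists_comb {K : SimpleGraph V} (hlf : ∀ w, (K.neighborSet w).Finite) (hK : K.Connected)
    (r : V) {U : Set V} (hU : U.Infinite) :
    ∃ R : ℕ → V, R 0 = r ∧ (∀ n, K.Adj (R n) (R (n + 1))) ∧ (∀ n, K.dist r (R n) = n) ∧
      ∀ n, (desc K r U (R n)).Infinite := by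
  rcases exists_star_or_comb hK r hU with ⟨x, s, g, hg, hd⟩ | h
  -- The centre of a star would have infinitely many neighbours, the second vertices of the
  -- geodesics.
  · refine absurd (hlf x) (Set.infinite_of_injective_forall_mem (f := fun j => g j 1) ?_ ?_)
    · intro j j' e
      by_contra hne
      rcases lt_or_gt_of_ne hne with h | h
      · exact hd j j' h 1 1 le_rfl (hg j).1 le_rfl (hg j').1 e
      · exact hd j' j h 1 1 le_rfl (hg j').1 le_rfl (hg j).1 e.symm
    · intro j
      obtain ⟨h1, h2, -, h3, -⟩ := hg j
      have := h3.2 0 (by omega)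
      rwa [h2] at this
  · exact h

lemma finite_neighborSet_induce (hlf : ∀ w, (G.neighborSet w).Finite) {S : Set V} (w : S) :
    ((G.induce S).neighborSet w).Finite :=
  Set.Finite.of_finite_image ((hlf w).subset (by rintro _ ⟨x, hx, rfl⟩; exact hx))
    Subtype.val_injective.injOn

lemma Linked.exists_ray (hlf : ∀ w, (G.neighborSet w).Finite) {S : Set V} (h : Linked G S)
    (hS : S.Infinite) : ∃ X : ℕ → V, Function.Injective X ∧ (∀ n, G.Adj (X n) (X (n + 1))) ∧
      ∀ n, X n ∈ S := by
  have : Infinite S := hS.to_subtype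
  obtain ⟨r⟩ : Nonempty S := inferInstance
  obtain ⟨R, -, h1, h2, -⟩ := exists_comb (finite_neighborSet_induce hlf)
    (h.connected hS.nonempty) r infinite_univ
  exact ⟨fun n => R n, Subtype.val_injective.comp (geodesic_injective h2), h1, fun n => (R n).2⟩

lemma TwoConnected.joined (hG : TwoConnected G) {x u v : V} (hu : u ≠ x) (hv : v ≠ x) :
    Joined G {y | y ≠ x} u v :=
  joined_of_reachable ((hG x).preconnected ⟨u, hu⟩ ⟨v, hv⟩)

lemma TwoConnected.connected [Infinite V] (hG : TwoConnected G) : G.Connected := by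
  classical
  have : Nonempty V := inferInstance
  refine ⟨fun u v => ?_⟩
  obtain ⟨x, hx⟩ := Infinite.exists_notMem_finset ({u, v} : Finset V)
  simp only [Finset.mem_insert, Finset.mem_singleton, not_or] at hx
  obtain ⟨p, -⟩ := hG.joined (Ne.symm hx.1) (Ne.symm hx.2)
  exact ⟨p⟩

/-! ### A component outside a ray that attaches to it infinitely often -/

/-- The component `C` of `c` outside the ray has infinitely many vertices with neighbours on `R`,
and a comb for them in `C` has a spine `X`. Disjoint finite connected sets join `X` to `R` further
and further out. They only have to make the union with the two rays one-ended, so they may meet `X`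
repeatedly. -/
lemma hasLadder_of_component (hlf : ∀ w, (G.neighborSet w).Finite) {R : ℕ → V} (hR : IsRay G R)
    {c : V} (hc : {j | ∃ v, G.Adj v (R j) ∧ Joined G (range R)ᶜ c v}.Infinite) : HasLadder G := by
  classical
  set C : Set V := {x | Joined G (range R)ᶜ c x} with hC
  have hRadj : ∀ n, G.Adj (R n) (R (n + 1)) := fun n => (hR.2 _ _).2 (.inl rfl)
  have hlink : Linked G C := by
    have key : ∀ x ∈ C, Joined G C c x := by
      intro x hx
      obtain ⟨s, f, hf, rfl, rfl⟩ := Joined.exists_link hx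
      have hf' : IsLink G C s f := ⟨fun i hi => hf.joined (Nat.zero_le s) hi, hf.2⟩
      exact hf'.joined (Nat.zero_le s) le_rfl
    exact fun u hu v hv => (key u hu).symm.trans (key v hv)
  obtain ⟨-, v₀, -, hv₀⟩ := hc.nonempty
  have hconn := hlink.connected ⟨v₀, hv₀⟩
  have hlfC := finite_neighborSet_induce hlf (S := C)
  set U : Set C := {u | ∃ j, G.Adj u (R j)} with hU
  have hUinf : U.Infinite := by
    intro hfin
    refine hc ((hfin.biUnion fun u _ => finite_contacts hlf hR (u : V)).subset ?_)
    rintro j ⟨v, h1, h2⟩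
    exact mem_biUnion (x := (⟨v, h2⟩ : C)) ⟨j, h1⟩ h1
  obtain ⟨X, -, hX1, hX2, hX3⟩ := exists_comb hlfC hconn ⟨v₀, hv₀⟩ hUinf
  have hXR : ∀ n m, (X n : V) ≠ R m := fun n m e => (X n).2.right_mem ⟨m, e.symm⟩
  set Good : ℕ × ℕ × Set V → Prop := fun p =>
    p.2.2.Finite ∧ Linked G p.2.2 ∧ (X p.1 : V) ∈ p.2.2 ∧ R p.2.1 ∈ p.2.2 with hGood
  set Rel : ℕ × ℕ × Set V → ℕ × ℕ × Set V → Prop := fun p q =>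
    p.1 < q.1 ∧ p.2.1 < q.2.1 ∧ Disjoint p.2.2 q.2.2 with hRel
  have key : ∀ T : Finset (ℕ × ℕ × Set V), (∀ p ∈ T, Good p) →
      ∃ q, Good q ∧ ∀ p ∈ T, Rel p q := by
    intro T hT
    have hF : (⋃ p ∈ T, p.2.2).Finite := T.finite_toSet.biUnion fun p hp => (hT p hp).1
    obtain ⟨N₁, hN₁⟩ := ((hF.preimage hR.1.injOn).union
      (T.finite_toSet.image fun p => p.2.1)).bddAbove
    obtain ⟨N₂, hN₂⟩ := (((hF.preimage (Subtype.val_injective (p := (· ∈ C))).injOn).image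
      fun x => (G.induce C).dist ⟨v₀, hv₀⟩ x).union (T.finite_toSet.image fun p => p.1)).bddAbove
    have hnear : {u : C | ∃ j ≤ N₁, G.Adj u (R j)}.Finite := by
      refine Set.Finite.of_finite_image (((finite_Iic N₁).biUnion fun j _ =>
        hlf (R j)).subset ?_) Subtype.val_injective.injOn
      rintro _ ⟨u, ⟨j, hj, e⟩, rfl⟩
      exact mem_biUnion (mem_Iic.2 hj) e.symm
    -- Within `C`, the geodesic from `X (N₂ + 1)` to `u` stays above all levels used so far, and `u`
    -- sees `R` only beyond position `N₁`; so the new connector misses the earlier ones.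
    obtain ⟨u, hu, hu'⟩ := ((hX3 (N₂ + 1)).sdiff hnear).nonempty
    obtain ⟨j, hj⟩ := hu.1
    have hjN : N₁ < j := by
      by_contra hlt
      exact hu' ⟨j, by omega, hj⟩
    obtain ⟨s, g, hg, hg0, hgs, hlev, -⟩ := exists_geodesic hconn hu
    have hgl : IsLink G univ s (fun i => (g i : V)) := ⟨fun _ _ => trivial, hg.2⟩
    have hmem : (u : V) ∈ (fun i => (g i : V)) '' Iic s := ⟨s, mem_Iic.2 le_rfl, by simp only [hgs]⟩
    refine ⟨(N₂ + 1, j, (fun i => (g i : V)) '' Iic s ∪ {u.1, R j}), ⟨?_, ?_, ?_, ?_⟩,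
      fun p hp => ⟨?_, ?_, ?_⟩⟩
    · exact ((finite_Iic s).image _).union (toFinite _)
    · refine hgl.linked.union ?_ ⟨u, hmem, .inl rfl⟩
      rintro a (rfl | rfl) b (rfl | rfl)
      · exact .refl (.inl rfl)
      · exact .of_adj hj (.inl rfl) (.inr rfl)
      · exact .of_adj hj.symm (.inr rfl) (.inl rfl)
      · exact .refl (.inr rfl)
    · exact .inl ⟨0, Nat.zero_le _, by simp only [hg0]⟩
    · exact .inr (.inr rfl)
    · exact Nat.lt_succ_of_le (hN₂ (.inr ⟨p, hp, rfl⟩))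
    · exact (hN₁ (.inr ⟨p, hp, rfl⟩)).trans_lt hjN
    · have hout : ∀ i ≤ s, (g i : V) ∉ p.2.2 := by
        intro i hi hpi
        have h1 := hN₂ (.inl ⟨g i, mem_biUnion hp hpi, rfl⟩)
        have h2 := hlev i hi
        rw [hX2] at h2
        simp only at h1
        omega
      refine Set.disjoint_left.2 fun x hx hx' => ?_
      rcases hx' with ⟨i, hi, rfl⟩ | rfl | rfl
      · exact hout i hi hx
      · exact hout s le_rfl (hgs ▸ hx)
      · have := hN₁ (.inl (mem_biUnion hp hx))
        omega
  obtain ⟨p, hp, hpp⟩ := exists_seq_of_forall_finset_exists Good Rel key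
  set n : ℕ → ℕ := fun k => (p k).1 with hn
  set a : ℕ → ℕ := fun k => (p k).2.1 with ha
  set L : ℕ → Set V := fun k => (p k).2.2 with hL
  have hnlt : ∀ k, n k < n (k + 1) := fun k => (hpp k (k + 1) (by omega)).1
  have halt : ∀ k, a k < a (k + 1) := fun k => (hpp k (k + 1) (by omega)).2.1
  have hXL : ∀ k, (X (n k) : V) ∈ L k := fun k => (hp k).2.2.1
  have hRL : ∀ k, R (a k) ∈ L k := fun k => (hp k).2.2.2
  set X' : ℕ → V := fun i => X i with hX'
  have hX'inj : Function.Injective X' := Subtype.val_injective.comp (geodesic_injective hX2)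
  set Z : ℕ → Set V := fun k =>
    (R '' Icc (a k) (a (k + 1)) ∪ L k) ∪ X' '' Icc (n k) (n (k + 1)) with hZ
  have hRZ : ∀ k m, a k ≤ m → m ≤ a (k + 1) → R m ∈ Z k := fun k m h1 h2 =>
    .inl (.inl ⟨m, ⟨h1, h2⟩, rfl⟩)
  have hXZ : ∀ k m, n k ≤ m → m ≤ n (k + 1) → X' m ∈ Z k := fun k m h1 h2 =>
    .inr ⟨m, ⟨h1, h2⟩, rfl⟩
  have hone : OneEnded G {x | ∃ k, x ∈ Z k} := by
    refine oneEnded_chain (fun k => ?_) (fun k => ?_) (fun k => ?_) fun x => ?_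
    · refine ((linked_segment hRadj _ _).union (hp k).2.1
        ⟨R (a k), ⟨a k, ⟨le_rfl, (halt k).le⟩, rfl⟩, hRL k⟩).union
        (linked_segment (R := X') (fun n => hX1 n) _ _) ⟨X' (n k), .inr (hXL k), ⟨n k, ⟨le_rfl, (hnlt k).le⟩, rfl⟩⟩
    · exact ⟨R (a (k + 1)), hRZ k _ (halt k).le le_rfl, hRZ (k + 1) _ le_rfl (halt _).le⟩
    · exact (((finite_Icc _ _).image _).union (hp k).1).union ((finite_Icc _ _).image _)
    · have h1 : {k | x ∈ R '' Icc (a k) (a (k + 1))}.Finite := by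
        by_cases hx : ∃ m, R m = x
        · obtain ⟨m, rfl⟩ := hx
          refine (finite_Iic m).subset ?_
          rintro k ⟨m', hm', e⟩
          obtain rfl := hR.1 e
          exact ((strictMono_nat_of_lt_succ halt).id_le k).trans hm'.1
        · refine finite_empty.subset ?_
          rintro k ⟨m', -, e⟩
          exact hx ⟨m', e⟩
      have h2 : {k | x ∈ X' '' Icc (n k) (n (k + 1))}.Finite := by
        by_cases hx : ∃ m, X' m = x
        · obtain ⟨m, rfl⟩ := hx
          refine (finite_Iic m).subset ?_
          rintro k ⟨m', hm', e⟩
          obtain rfl := hX'inj e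
          exact ((strictMono_nat_of_lt_succ hnlt).id_le k).trans hm'.1
        · refine finite_empty.subset ?_
          rintro k ⟨m', -, e⟩
          exact hx ⟨m', e⟩
      have h3 : {k | x ∈ L k}.Subsingleton := by
        intro k hk l hl
        by_contra hne
        rcases lt_or_gt_of_ne hne with h | h
        exacts [Set.disjoint_left.1 (hpp k l h).2.2 hk hl,
          Set.disjoint_left.1 (hpp l k h).2.2 hl hk]
      refine ((h1.union h3.finite).union h2).subset ?_
      rintro k ((h | h) | h)
      exacts [.inl (.inl h), .inl (.inr h), .inr h]
  refine IsRayPair.hasLadder hlf hone (A := fun i => R (a 0 + i)) (B := fun i => X' (n 0 + i))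
    ⟨(hR.shift _).1, fun i j e => ?_, fun i => hRadj _, fun i => hX1 _, fun i => ?_, fun i => ?_,
      fun i j => (hXR _ _).symm⟩
  · have := hX'inj e
    omega
  · obtain ⟨k, h1, h2⟩ := exists_index_of_le halt (Nat.le_add_right (a 0) i)
    exact ⟨k, hRZ k _ h1 h2.le⟩
  · obtain ⟨k, h1, h2⟩ := exists_index_of_le hnlt (Nat.le_add_right (n 0) i)
    exact ⟨k, hXZ k _ h1 h2.le⟩

/-! ### Ears of a ray -/

/-- There is a path from `R i` to `R j` through vertices outside the ray. -/
def IsEar (G : SimpleGraph V) (R : ℕ → V) (i j : ℕ) : Prop :=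
  ∃ u v, G.Adj u (R i) ∧ G.Adj v (R j) ∧ Joined G (range R)ᶜ u v

/-- After deletion of `R n`, a shortest path from the part of the ray before it to the part after it
has no inner vertices on the ray. It is not a single edge because the ray is induced. -/
lemma TwoConnected.exists_ear (hG : TwoConnected G) {R : ℕ → V} (hR : IsRay G R) {n : ℕ}
    (hn : 1 ≤ n) : ∃ i j, i < n ∧ n < j ∧ IsEar G R i j := by
  have h1 : R (n - 1) ≠ R n := fun e => by have := hR.1 e; omega
  have h2 : R (n + 1) ≠ R n := fun e => by have := hR.1 e; omega
  obtain ⟨s, f, hf, -, ⟨i, hi, hfi⟩, ⟨j, hj, hfj⟩, h3, h4⟩ :=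
    (hG.joined h1 h2).exists_shortest (A := R '' Iio n) (B := R '' Ioi n)
      ⟨n - 1, mem_Iio.2 (by omega), rfl⟩ ⟨n + 1, mem_Ioi.2 (by omega), rfl⟩
  rw [mem_Iio] at hi
  rw [mem_Ioi] at hj
  have hs : 2 ≤ s := by
    by_contra hlt
    rcases (by omega : s = 0 ∨ s = 1) with rfl | rfl
    · have := hR.1 (hfi.trans hfj.symm)
      omega
    · have := hf.2 0 (by omega)
      rw [zero_add, ← hfi, ← hfj, hR.2] at this
      omega
  have hlink : IsLink G (range R)ᶜ (s - 2) (fun t => f (t + 1)) := by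
    refine ⟨?_, fun t ht => hf.2 _ (by omega)⟩
    rintro t ht ⟨m, hm⟩
    rcases lt_trichotomy m n with h | rfl | h
    · have := h3 (t + 1) (by omega) ⟨m, h, hm⟩
      omega
    · exact hf.1 (t + 1) (by omega) hm.symm
    · have := h4 (t + 1) (by omega) ⟨m, h, hm⟩
      omega
  refine ⟨i, j, hi, hj, f 1, f (s - 2 + 1), ?_, ?_, hlink.joined (Nat.zero_le _) le_rfl⟩
  · rw [hfi]
    exact (hf.2 0 (by omega)).symm
  · have := hf.2 (s - 1) (by omega)
    rwa [show s - 1 + 1 = s by omega, ← hfj, show s - 1 = s - 2 + 1 by omega] at this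

lemma Linked.insert {S : Set V} (h : Linked G S) {x y : V} (hx : x ∈ S) (hxy : G.Adj x y) :
    Linked G (insert y S) := by
  rw [← singleton_union, union_comm]
  have h2 : Linked G {x, y} := by
    rintro a (rfl | rfl) b (rfl | rfl)
    · exact .refl (.inl rfl)
    · exact .of_adj hxy (.inl rfl) (.inr rfl)
    · exact .of_adj hxy.symm (.inr rfl) (.inl rfl)
    · exact .refl (.inr rfl)
  have := h.union h2 ⟨x, hx, .inl rfl⟩
  rwa [show S ∪ {x, y} = S ∪ {y} by
    rw [Set.union_insert, Set.insert_eq_of_mem (.inl hx)]] at this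

/-- Only finitely many ears start at a given vertex, so among the ears that start before a given
position one reaches farthest. Iterating this choice gives ears from `a k` to `c (k + 1)` with `c k
≤ a (k + 1) < c (k + 1)`: consecutive ears overlap, and those two apart do not. Alternating between
ears and the parts of `R` that connect them, the even and the odd indices yield two disjoint
connected sets, each of which contains a ray. -/
lemma hasLadder_of_ears (hG : TwoConnected G) (hlf : ∀ w, (G.neighborSet w).Finite) {R : ℕ → V}
    (hR : IsRay G R)
    (hfin : ∀ c, {j | ∃ v, G.Adj v (R j) ∧ Joined G (range R)ᶜ c v}.Finite) : HasLadder G := by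
  classical
  have hRadj : ∀ n, G.Adj (R n) (R (n + 1)) := fun n => (hR.2 _ _).2 (.inl rfl)
  have hear : ∀ i, {j | IsEar G R i j}.Finite := by
    intro i
    refine ((hlf (R i)).biUnion fun u _ => hfin u).subset ?_
    rintro j ⟨u, v, h1, h2, h3⟩
    exact mem_biUnion (x := u) h1.symm ⟨v, h2, h3⟩
  have hfar : ∀ n, 1 ≤ n → ∃ b a, n < b ∧ a < n ∧ IsEar G R a b ∧
      ∀ i < n, ∀ j, IsEar G R i j → j ≤ b := by
    intro n hn
    obtain ⟨i, j, hi, hj, hij⟩ := hG.exists_ear hR hn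
    have hfin : (⋃ i ∈ Iio n, {j | IsEar G R i j}).Finite :=
      (finite_Iio n).biUnion fun i _ => hear i
    obtain ⟨b, hb⟩ := hfin.exists_maximal ⟨j, mem_biUnion (mem_Iio.2 hi) hij⟩
    obtain ⟨a, ha, hab⟩ := mem_iUnion₂.1 hb.1
    have hmax : ∀ i < n, ∀ j, IsEar G R i j → j ≤ b := fun i hi j hij => by
      by_contra hlt
      exact hlt (hb.2 (mem_biUnion (mem_Iio.2 hi) hij) (by omega))
    exact ⟨b, a, hj.trans_le (hmax i hi j hij), ha, hab, hmax⟩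
  choose! b₀ a₀ hb₀ ha₀ hab₀ hmax₀ using hfar
  -- The start is 1 because no ear passes over the initial vertex of the ray.
  set c : ℕ → ℕ := fun k => Nat.rec 1 (fun _ n => b₀ n) k with hc
  have hcs : ∀ k, c (k + 1) = b₀ (c k) := fun _ => rfl
  have hc1 : ∀ k, 1 ≤ c k := by
    intro k
    induction k with
    | zero => exact le_rfl
    | succ k ih => have := hb₀ _ ih; rw [hcs]; omega
  set a : ℕ → ℕ := fun k => a₀ (c k) with ha
  have hclt : ∀ k, c k < c (k + 1) := fun k => hb₀ _ (hc1 k)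
  have hcmono : StrictMono c := strictMono_nat_of_lt_succ hclt
  have hac : ∀ k, a k < c k := fun k => ha₀ _ (hc1 k)
  have hE : ∀ k, IsEar G R (a k) (c (k + 1)) := fun k => hab₀ _ (hc1 k)
  have hmax : ∀ k, ∀ i < c k, ∀ j, IsEar G R i j → j ≤ c (k + 1) := fun k => hmax₀ _ (hc1 k)
  clear_value a c
  have hca : ∀ k, c k ≤ a (k + 1) := by
    intro k
    by_contra hlt
    have := hmax k _ (not_le.1 hlt) _ (hE (k + 1))
    have := hclt (k + 1)
    omega
  have hlinks : ∀ k, ∃ s g, IsLink G (range R)ᶜ s g ∧ G.Adj (g 0) (R (a k)) ∧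
      G.Adj (g s) (R (c (k + 1))) := by
    intro k
    obtain ⟨u, v, h1, h2, h3⟩ := hE k
    obtain ⟨s, g, hg, rfl, rfl⟩ := h3.exists_link
    exact ⟨s, g, hg, h1, h2⟩
  choose s g hg hg0 hgs using hlinks
  set E : ℕ → Set V := fun k => g k '' Iic (s k) with hEdef
  have hER : ∀ k m, R m ∉ E k := by
    rintro k m ⟨i, hi, e⟩
    exact (hg k).1 i hi ⟨m, e.symm⟩
  -- Ears with a common vertex would combine to one from `a k` to `c (l + 1)`, which reaches farther
  -- than the `k`-th choice allowed.
  have hEd : ∀ k l x, k < l → x ∈ E k → x ∈ E l → False := by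
    rintro k l x hkl ⟨i, hi, rfl⟩ ⟨j, hj, e⟩
    have hj2 := (hg l).joined hj (le_refl (s l))
    rw [e] at hj2
    have := hmax k _ (hac k) _
      ⟨_, _, hg0 k, hgs l, ((hg k).joined (Nat.zero_le _) hi).trans hj2⟩
    have := hcmono (show k + 1 < l + 1 by omega)
    omega
  have hEd' : ∀ k l x, x ∈ E k → x ∈ E l → k = l := by
    intro k l x hk hl
    by_contra hne
    rcases lt_or_gt_of_ne hne with h | h
    exacts [hEd k l x h hk hl, hEd l k x h hl hk]
  set D : ℕ → Set V := fun k => insert (R (a k)) (insert (R (c (k + 1))) (E k)) with hD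
  have hDl : ∀ k, Linked G (D k) := fun k =>
    ((hg k).linked.insert ⟨s k, mem_Iic.2 le_rfl, rfl⟩ (hgs k)).insert
      (.inr ⟨0, Nat.zero_le _, rfl⟩) (hg0 k)
  -- `Y k` leads from `R (c k)` along the ray to the start of ear `k + 1`, and over this ear to `R
  -- (c (k + 2))`, where `Y (k + 2)` begins. The larger sets `Z k` fill in the ray, which connects
  -- both sides to a one-ended chain.
  set Y : ℕ → Set V := fun k => R '' Icc (c k) (a (k + 1)) ∪ D (k + 1) with hY
  set Z : ℕ → Set V := fun k => R '' Icc (c k) (c (k + 2)) ∪ D (k + 1) with hZ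
  have hYZ : ∀ k, Y k ⊆ Z k := fun k => union_subset_union_left _
    (image_mono (Icc_subset_Icc_right (by
      have h1 := hac (k + 1)
      have h2 : c (k + 1) < c (k + 2) := hclt (k + 1)
      omega)))
  have hYl : ∀ k, Linked G (Y k) := fun k => (linked_segment hRadj _ _).union (hDl (k + 1))
    ⟨R (a (k + 1)), ⟨_, ⟨hca k, le_rfl⟩, rfl⟩, .inl rfl⟩
  have hZl : ∀ k, Linked G (Z k) := fun k => (linked_segment hRadj _ _).union (hDl (k + 1))
    ⟨R (c (k + 2)), ⟨_, ⟨(hcmono (show k < k + 2 by omega)).le, le_rfl⟩, rfl⟩, .inr (.inl rfl)⟩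
  have hcY : ∀ k, R (c k) ∈ Y k := fun k => .inl ⟨_, ⟨le_rfl, hca k⟩, rfl⟩
  have hcY' : ∀ k, R (c (k + 2)) ∈ Y k := fun k => .inr (.inr (.inl rfl))
  -- The ray vertices of `Y k` lie only in intervals between consecutive `c q` with `q` of the same
  -- parity as `k`, which separates the even side from the odd one.
  have hYR : ∀ k m, R m ∈ Y k → ∃ q, (q = k ∨ q = k + 2) ∧ c q ≤ m ∧ m < c (q + 1) := by
    rintro k m (⟨m', hm, e⟩ | e | e | e)
    · obtain rfl := hR.1 e
      exact ⟨k, .inl rfl, hm.1, hm.2.trans_lt (hac _)⟩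
    · obtain rfl := hR.1 e
      exact ⟨k, .inl rfl, hca k, hac _⟩
    · obtain rfl := hR.1 e
      exact ⟨k + 2, .inr rfl, le_rfl, hclt _⟩
    · exact absurd e (hER _ _)
  have hYE : ∀ k x, x ∈ Y k → (∃ m, x = R m) ∨ x ∈ E (k + 1) := by
    rintro k x (⟨m', hm, e⟩ | e | e | e)
    exacts [.inl ⟨_, e.symm⟩, .inl ⟨_, e⟩, .inl ⟨_, e⟩, .inr e]
  have hYd : ∀ k l x, k % 2 ≠ l % 2 → x ∈ Y k → x ∉ Y l := by
    intro k l x hkl hk hl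
    rcases hYE k x hk with ⟨m, rfl⟩ | hk'
    · obtain ⟨q, hq, h1, h2⟩ := hYR k m hk
      obtain ⟨q', hq', h1', h2'⟩ := hYR l m hl
      have e1 := hcmono.lt_iff_lt.1 (h1.trans_lt h2')
      have e2 := hcmono.lt_iff_lt.1 (h1'.trans_lt h2)
      omega
    · rcases hYE l x hl with ⟨m, rfl⟩ | hl'
      · exact hER _ _ hk'
      · have := hEd' _ _ _ hk' hl'
        omega
  have hone : OneEnded G {x | ∃ k, x ∈ Z k} := by
    refine oneEnded_chain hZl (fun k => ?_) (fun k => ?_) fun x => ?_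
    · exact ⟨R (c (k + 2)), .inr (.inr (.inl rfl)),
        .inl ⟨_, ⟨(hclt (k + 1)).le, (hclt (k + 2)).le⟩, rfl⟩⟩
    · exact ((finite_Icc _ _).image _).union ((((finite_Iic _).image _).insert _).insert _)
    · by_cases hx : ∃ m, x = R m
      · obtain ⟨m, rfl⟩ := hx
        refine (finite_Iic m).subset ?_
        have hid := hcmono.id_le
        rintro k (⟨m', hm, e⟩ | e | e | e)
        · obtain rfl := hR.1 e
          exact (hid k).trans hm.1
        · obtain rfl := hR.1 e
          exact (hid k).trans (hca k)
        · obtain rfl := hR.1 e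
          exact (hid k).trans (hcmono (show k < k + 2 by omega)).le
        · exact absurd e (hER _ _)
      · have hsub : {k | x ∈ Z k}.Subsingleton := by
          have h : ∀ k, x ∈ Z k → x ∈ E (k + 1) := by
            rintro k (⟨m', hm, e⟩ | e | e | e)
            exacts [absurd ⟨_, e.symm⟩ hx, absurd ⟨_, e⟩ hx, absurd ⟨_, e⟩ hx, e]
          intro k hk l hl
          have := hEd' _ _ _ (h k hk) (h l hl)
          omega
        exact hsub.finite
  have hside : ∀ p, ∃ X : ℕ → V, Function.Injective X ∧ (∀ n, G.Adj (X n) (X (n + 1))) ∧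
      ∀ n, ∃ k, X n ∈ Y (2 * k + p) := by
    intro p
    have hl := linked_chain (fun k => hYl (2 * k + p)) (fun k =>
      ⟨R (c (2 * k + p + 2)), hcY' _, by
        rw [show 2 * (k + 1) + p = 2 * k + p + 2 by omega]
        exact hcY (2 * k + p + 2)⟩) 0
    obtain ⟨X, h1, h2, h3⟩ := hl.exists_ray hlf (Set.infinite_of_injective_forall_mem
      (f := fun k => R (c (2 * k + p))) (fun k l e => by have := hcmono.injective (hR.1 e); omega)
      fun k => ⟨k, Nat.zero_le _, hcY _⟩)
    exact ⟨X, h1, h2, fun n => (h3 n).imp fun k hk => hk.2⟩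
  obtain ⟨A, hA1, hA2, hA3⟩ := hside 0
  obtain ⟨B, hB1, hB2, hB3⟩ := hside 1
  refine IsRayPair.hasLadder hlf hone (A := A) (B := B) ⟨hA1, hB1, hA2, hB2, fun n => ?_,
    fun n => ?_, fun n m e => ?_⟩
  · obtain ⟨k, hk⟩ := hA3 n
    exact ⟨_, hYZ (2 * k + 0) hk⟩
  · obtain ⟨k, hk⟩ := hB3 n
    exact ⟨_, hYZ (2 * k + 1) hk⟩
  · obtain ⟨k, hk⟩ := hA3 n
    obtain ⟨l, hl⟩ := hB3 m
    exact hYd (2 * k + 0) (2 * l + 1) _ (by omega) hk (e ▸ hl)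

/-- Infinite locally finite `2`-connected graphs contain ladders. -/
theorem TwoConnected.hasLadder [Infinite V] (hG : TwoConnected G)
    (hlf : ∀ w, (G.neighborSet w).Finite) : HasLadder G := by
  obtain ⟨r⟩ : Nonempty V := inferInstance
  have hconn := hG.connected
  obtain ⟨R, -, h1, h2, -⟩ := exists_comb hlf hconn r infinite_univ
  have hR : IsRay G R := ⟨geodesic_injective h2, geodesic_adj_iff hconn h1 h2⟩
  -- The question is whether each component outside the ray attaches to it finitely often; for `c`
  -- on the ray the set is empty.
  by_cases hfin : ∀ c, {j | ∃ v, G.Adj v (R j) ∧ Joined G (range R)ᶜ c v}.Finite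
  · exact hasLadder_of_ears hG hlf hR hfin
  · push Not at hfin
    obtain ⟨c, hc⟩ := hfin
    exact hasLadder_of_component hlf hR hc

end InfTwoConnected

/-! ### The main theorem: locally finite graphs against a vertex of infinite degree -/

theorem theorem1p6 {V : Type*} [Infinite V] (G : SimpleGraph V)
    (hG : InfTwoConnected.TwoConnected G) :
    ∃ S : Set V,
      InfTwoConnected.IsKInf (G.induce S) ∨
      InfTwoConnected.IsCleanLadder (G.induce S) ∨
      InfTwoConnected.IsTheta (G.induce S) ∨
      InfTwoConnected.IsFan (G.induce S) ∨
      InfTwoConnected.IsDeltaFan (G.induce S) ∨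
      InfTwoConnected.IsLadder (G.induce S) ∨
      InfTwoConnected.IsDeltaLadder (G.induce S) ∨
      InfTwoConnected.IsNablaDeltaLadder (G.induce S) := by
  by_cases hlf : ∀ w, (G.neighborSet w).Finite
  · obtain ⟨S, h | h | h | h⟩ := hG.hasLadder hlf
    · exact ⟨S, .inr (.inl h)⟩
    · exact ⟨S, .inr (.inr (.inr (.inr (.inr (.inl h)))))⟩
    · exact ⟨S, .inr (.inr (.inr (.inr (.inr (.inr (.inl h))))))⟩
    · exact ⟨S, .inr (.inr (.inr (.inr (.inr (.inr (.inr h))))))⟩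
  · push Not at hlf
    obtain ⟨v, hv⟩ := hlf
    obtain ⟨S, h | h | h | h⟩ := InfTwoConnected.exists_of_infinite_degree hG hv
    · exact ⟨S, .inl h⟩
    · exact ⟨S, .inr (.inr (.inl h))⟩
    · exact ⟨S, .inr (.inr (.inr (.inl h)))⟩
    · exact ⟨S, .inr (.inr (.inr (.inr (.inl h))))⟩
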